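/- **Setting.** Consider a tabular episodic MDP $M=(\mathcal S,\mathcal A,P,r,H)$ with $|\mathcal S|=S$, $|\mathcal A|=A$, horizon $H\ge 1$, time-homogeneous transition probabilities $P(\cdot\mid s,a)$ and mean rewards $r(s,a)$. In each episode $k=1,2,\dots$ the environment picks an initial state $s_1^k$ (possibly adaptively); the agent follows a policy $\pi^k=(\pi^k_h)_{h\le H}$, $\pi_h^k:\mathcal S\to\mathcal A$, takes $a_h^k=\pi_h^k(s_h^k)$, and, conditionally on $\mathcal F_h^k:=\sigma(s_1^1,a_1^1,R_1^1,\dots,s_h^k,a_h^k)$ (the full history up to the action at step $h$ of episode $k$), receives a reward $R_h^k$ with mean $r(s_h^k,a_h^k)$ and moves to $s_{h+1}^k\sim P(\cdot\mid s_h^k,a_h^k)$. Let $V_h^\pi(s)=\mathbb E_\pi[\sum_{j=h}^H r(s_j,a_j)\mid s_h=s]$, $Q_h^\pi(s,a)=r(s,a)+\sum_{s'}P(s'\mid s,a)V_{h+1}^\pi(s')$, $V_h^*=\max_\pi V_h^\pi$, $Q_h^*=\max_\pi Q_h^\pi$ (with $V_{H+1}\equiv 0$). The regret is $\mathrm{Reg}_M(K)=\sum_{k=1}^K\big(V_1^*(s_1^k)-V_1^{\pi^k}(s_1^k)\big)$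 and the distributional regret is $\mathrm{Reg}_M(K,\delta)=\inf\{x\in\mathbb R:\ \mathbb P(\mathrm{Reg}_M(K)>x)\le\delta\}$, $\delta\in(0,1]$. **Class $\mathcal M$.** Fix $V_{\max}\ge 0$. The class $\mathcal M$ consists of the MDPs with $0\le V_h^\pi(s)\le V_{\max}$ for all $h\in[H]$, $s$, $\pi$, for which there are $\sigma_{\exp}:[H]\times\mathcal S\times\mathcal A\to[0,\infty)$ and $V_\alpha\in[0,2V_{\max}]$ such that (i) $\mathbb E_\pi\big[\sum_{j=h}^H\tfrac12\sigma_{\exp}^2(j,s_j,a_j)\mid s_h=s\big]\le 2V_{\max}^2$ for all $h\in[H]$, $s$, $\pi$, and (ii) at every visit (step $j$ of episode $k$) and for every $h\in[H]$, the variable $X=R_j^k+V_{h+1}^*(s_{j+1}^k)-Q_h^*(s_j^k,a_j^k)$ satisfies $\mathbb E[e^{\lambda X}\mid\mathcal F_j^k]\le e^{\lambda^2\sigma_{\exp}^2(h,s_j^k,a_j^k)/2}$ almost surely for all $\lambda$ with $|\lambda|V_\alpha\le 1$. **Algorithm ($\mathrm{EQO}^+$ with input $(c_{1,k},c_{2,k})_{k\ge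 1}$).** Let $N^k(s,a)$, $\hat r^k(s,a)$, $\hat P^k(s'\mid s,a)$ be the visit count, the empirical mean reward and the empirical transition frequencies of $(s,a)$ over episodes $1,\dots,k-1$ (all steps $h\in[H]$), and $b^k=\frac{c_{1,k}}{N^k}\wedge\frac{c_{2,k}}{\sqrt{N^k}}$. Set $V_{H+1}^k=0$ and, for $h=H,\dots,1$, $$Q_h^k(s,a)=\begin{cases}\Big(\big(\hat r^k(s,a)+\sum_{s'}\hat P^k(s'\mid s,a)V_{h+1}^k(s')\big)\vee 0+b^k(s,a)\Big)\wedge V_{\max}& N^k(s,a)>0,\\ V_{\max}& N^k(s,a)=0,\end{cases}$$ $V_h^k(s)=\max_a Q_h^k(s,a)$ and $\pi_h^k(s)\in\arg\max_a Q_h^k(s,a)$ (any fixed measurable tie-breaking rule). For $k\ge 1$ put $\ell_k(\delta)=\log\dfrac{32HSA\,(\log(e^2kH))^2}{\delta}$. **Corollary.** Let $c_1>0$, and let $c_{2,k}=\infty$ for all $k$. 1. Let $K\ge 1$ and $c_{1,k}=c_1V_{\max}\sqrt{\dfrac{k\,\ell_k(1)}{SA\log KH}}$. Then for all $\delta\in(0,1]$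 $$\sup_{M\in\mathcal M}\mathrm{Reg}_M(K,\delta)\le\Big(\frac{36\log\frac1\delta}{c_1\log HSA}+\frac{36}{c_1}+8c_1\Big)V_{\max}\sqrt{KSA\,\ell_K(1)\log KH}+72V_{\max}S^2A\,\ell_K(\delta)\log 2KH .$$ (If $HSA=1$, the quotient by $\log HSA$ is read as $0$; if $KH=1$, the value of $c_{1,1}$ is immaterial.) 2. There is a constant $C>0$ depending only on $c_1$ such that, for all $H,S,A$, $V_{\max}$ and $K\ge 3$, with the same parameters, $$\sup_{M\in\mathcal M}\mathbb E[\mathrm{Reg}_M(K)]\le C\Big(V_{\max}\sqrt{SAK\,(\log KH)\,\log(HSA\log K)}+V_{\max}S^2A\,(\log KH)\,\log(HSA\log K)\Big).$$ 3. There is a constant $C>0$ depending only on $c_1$ such that, for all $H,S,A$, $V_{\max}$ and $K\ge 3$, with the parameters $c_{1,k}=c_1V_{\max}\sqrt{\dfrac{K\log HSA}{SA\log KH}}$ (constant in $k$; $K$ known), $$\sup_{M\in\mathcal M}\mathbb E[\mathrm{Reg}_M(K)]\le C\Big(V_{\max}\sqrt{SAK\,(\log KH)\,\log(HSA)}+V_{\max}S^2A\,(\log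 KH)\,\log(HSA\log K)\Big).$$ -/

import Mathlib

open MeasureTheory

noncomputable section

namespace EQOPlus

/-- A tabular episodic MDP `(S, A, P, r, H)` with time-homogeneous transition probabilities
`P s a s' = P(s' ∣ s, a)`, mean rewards `r s a`, and horizon `H ≥ 1`. -/
structure MDP (S A : Type*) [Fintype S] where
  H : ℕ
  H_pos : 1 ≤ H
  P : S → A → S → ℝ
  P_nonneg : ∀ s a s', 0 ≤ P s a s'
  P_sum : ∀ s a, ∑ s', P s a s' = 1
  r : S → A → ℝ

namespace MDP

variable {S A : Type*} [Fintype S] (M : MDP S A)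

/-- Expected sum of `f j s_j a_j` over the last `n` steps `j = H - n + 1, …, H` of an episode, when
the state at step `H - n + 1` is `s` and the actions are `a_j = π j s_j`. -/
def toGo (f : ℕ → S → A → ℝ) (π : ℕ → S → A) : ℕ → S → ℝ
  | 0, _ => 0
  | n + 1, s => f (M.H - n) s (π (M.H - n) s)
      + ∑ s', M.P s (π (M.H - n) s) s' * toGo f π n s'

/-- `E_π[∑_{j = h}^H f j s_j a_j ∣ s_h = s]`, for steps `1 ≤ h ≤ H + 1`. -/
def expSum (f : ℕ → S → A → ℝ) (π : ℕ → S → A) (h : ℕ) (s : S) : ℝ :=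
  M.toGo f π (M.H + 1 - h) s

/-- The value function `V_h^π(s)` of a policy `π` (`π h s` is the action at step `h`). -/
def V (π : ℕ → S → A) (h : ℕ) (s : S) : ℝ := M.expSum (fun _ => M.r) π h s

/-- The action value function `Q_h^π(s, a)`. -/
def Q (π : ℕ → S → A) (h : ℕ) (s : S) (a : A) : ℝ :=
  M.r s a + ∑ s', M.P s a s' * M.V π (h + 1) s'

/-- The optimal value function `V_h^*(s)`. -/
def Vstar (h : ℕ) (s : S) : ℝ := ⨆ π : ℕ → S → A, M.V π h s

/-- The optimal action value function `Q_h^*(s, a)`. -/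
def Qstar (h : ℕ) (s : S) (a : A) : ℝ := ⨆ π : ℕ → S → A, M.Q π h s a

/-- The total variance proxy function `W_h^π(s)` of a variance proxy `σ h s a`. -/
def W (σ : ℕ → S → A → ℝ) (π : ℕ → S → A) (h : ℕ) (s : S) : ℝ :=
  M.expSum (fun j x a => (1 / 2) * σ j x a ^ 2) π h s

end MDP

/-- The random objects of an infinite sequence of episodes on a sample space `Ω`: in episode `k ≥ 1`,
the state `s_h^k` (`1 ≤ h ≤ H + 1`), the action `a_h^k` and the reward `R_h^k` (`1 ≤ h ≤ H`), and the
policy `π^k` chosen by the agent. Values at other indices play no role. -/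
structure Run (S A Ω : Type*) where
  state : ℕ → ℕ → Ω → S
  action : ℕ → ℕ → Ω → A
  reward : ℕ → ℕ → Ω → ℝ
  policy : ℕ → Ω → ℕ → S → A

/-- `X` is `m`-conditionally `(σ, α)`-sub-exponential. The condition `|t| * α ≤ 1` is
`t ∈ [-1/α, 1/α]`, read as `t ∈ ℝ` when `α = 0`. -/
def CondSubExp {Ω : Type*} (m : MeasurableSpace Ω) {_mΩ : MeasurableSpace Ω} (μ : Measure Ω)
    (X σ : Ω → ℝ) (α : ℝ) : Prop :=
  ∀ t : ℝ, |t| * α ≤ 1 →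
    Integrable (fun ω => Real.exp (t * X ω)) μ ∧
      μ[fun ω => Real.exp (t * X ω) | m] ≤ᵐ[μ] fun ω => Real.exp (σ ω ^ 2 * t ^ 2 / 2)

/-- The bonus `c₁ / n ∧ c₂ / √n`, where `c₂ = ⊤` switches the second part off. -/
def bonus (c₁ : ℝ) (c₂ : WithTop ℝ) (n : ℕ) : ℝ :=
  match c₂ with
  | none => c₁ / n
  | some c => min (c₁ / n) (c / Real.sqrt n)

/-- An argmax with a fixed but arbitrary tie-breaking, which may depend on the episode, the step and
the state. -/
def IsArgmaxRule {S A : Type*} [MeasurableSpace A] (sel : ℕ → ℕ → S → (A → ℝ) → A) : Prop :=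
  ∀ k h s, Measurable (sel k h s) ∧ ∀ (q : A → ℝ) (a : A), q a ≤ q (sel k h s q)

namespace Run

section History

variable {S A Ω : Type*} [mS : MeasurableSpace S] [mA : MeasurableSpace A] (X : Run S A Ω) (H : ℕ)

/-- The σ-algebra `F_h^k = σ(s_1^1, a_1^1, R_1^1, …, s_h^k, a_h^k)`: everything observed in the
episodes before `k` (including their final states `s_{H+1}`), and in episode `k` the states and
actions up to step `h` and the rewards before step `h`. -/
@[reducible]
def history (k h : ℕ) : MeasurableSpace Ω :=
  (⨆ (i : ℕ) (j : ℕ) (_ : 1 ≤ i ∧ 1 ≤ j ∧ ((i < k ∧ j ≤ H + 1) ∨ (i = k ∧ j ≤ h))),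
      mS.comap (X.state i j)) ⊔
  (⨆ (i : ℕ) (j : ℕ) (_ : 1 ≤ i ∧ 1 ≤ j ∧ ((i < k ∧ j ≤ H) ∨ (i = k ∧ j ≤ h))),
      mA.comap (X.action i j)) ⊔
  (⨆ (i : ℕ) (j : ℕ) (_ : 1 ≤ i ∧ 1 ≤ j ∧ ((i < k ∧ j ≤ H) ∨ (i = k ∧ j < h))),
      (inferInstance : MeasurableSpace ℝ).comap (X.reward i j))

end History

section Algorithm

variable {S A Ω : Type*} [DecidableEq S] [DecidableEq A] (X : Run S A Ω) (H : ℕ)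

/-- The visit count `N^k(s, a)`. -/
def count (k : ℕ) (ω : Ω) (s : S) (a : A) : ℕ :=
  ∑ i ∈ Finset.Ico 1 k, ∑ h ∈ Finset.Icc 1 H,
    if X.state i h ω = s ∧ X.action i h ω = a then 1 else 0

/-- The empirical mean reward of `(s, a)` before episode `k`. -/
def rHat (k : ℕ) (ω : Ω) (s : S) (a : A) : ℝ :=
  (∑ i ∈ Finset.Ico 1 k, ∑ h ∈ Finset.Icc 1 H,
    if X.state i h ω = s ∧ X.action i h ω = a then X.reward i h ω else 0) / X.count H k ω s a

/-- The empirical transition probability from `(s, a)` to `s'` before episode `k`. -/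
def pHat (k : ℕ) (ω : Ω) (s : S) (a : A) (s' : S) : ℝ :=
  (∑ i ∈ Finset.Ico 1 k, ∑ h ∈ Finset.Icc 1 H,
    if X.state i h ω = s ∧ X.action i h ω = a ∧ X.state i (h + 1) ω = s' then (1 : ℝ) else 0)
      / X.count H k ω s a

variable [Fintype S] (Vmax : ℝ) (c₁ : ℕ → ℝ) (c₂ : ℕ → WithTop ℝ)

/-- One backup of the algorithm in episode `k`: the value `Q_h^k(s, a)` computed from
`v = V_{h+1}^k`. -/
def backup (k : ℕ) (ω : Ω) (v : S → ℝ) (s : S) (a : A) : ℝ :=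
  if X.count H k ω s a = 0 then Vmax
  else min (max (X.rHat H k ω s a + ∑ s', X.pHat H k ω s a s' * v s') 0
    + bonus (c₁ k) (c₂ k) (X.count H k ω s a)) Vmax

/-- The estimated value with `n` steps to go, that is `V_{H + 1 - n}^k`. -/
def vEst (k : ℕ) (ω : Ω) : ℕ → S → ℝ
  | 0, _ => 0
  | n + 1, s => ⨆ a : A, X.backup H Vmax c₁ c₂ k ω (vEst k ω n) s a

/-- The estimated action value `Q_h^k(s, a)`, for `1 ≤ h ≤ H`. -/
def qEst (k : ℕ) (ω : Ω) (h : ℕ) (s : S) (a : A) : ℝ :=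
  X.backup H Vmax c₁ c₂ k ω (X.vEst H Vmax c₁ c₂ k ω (H - h)) s a

/-- The agent runs `EQO+` with input `(c₁, c₂)`: in each episode it executes a greedy policy with
respect to the estimated action values. -/
def FollowsEQO [MeasurableSpace A] : Prop :=
  (∃ sel : ℕ → ℕ → S → (A → ℝ) → A, IsArgmaxRule sel ∧
    ∀ k ω h s, 1 ≤ k → 1 ≤ h → h ≤ H →
      X.policy k ω h s = sel k h s (X.qEst H Vmax c₁ c₂ k ω h s)) ∧
  ∀ k ω h, 1 ≤ k → 1 ≤ h → h ≤ H → X.action k h ω = X.policy k ω h (X.state k h ω)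

end Algorithm

section Environment

variable {S A Ω : Type*} [Fintype S] [DecidableEq S] [MeasurableSpace S] [MeasurableSpace A]
  {mΩ : MeasurableSpace Ω}

/-- The run takes place in the MDP `M`: given the history up to the action at step `h` of episode `k`,
the next state has law `P(s_h^k, a_h^k)` and the reward has mean `r(s_h^k, a_h^k)`. The initial states
`s_1^k` are not restricted: they may be chosen adaptively. -/
structure InEnvironment (X : Run S A Ω) (M : MDP S A) (μ : Measure Ω) : Prop where
  measurable_state : ∀ k h, Measurable (X.state k h)
  measurable_action : ∀ k h, Measurable (X.action k h)
  measurable_reward : ∀ k h, Measurable (X.reward k h)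
  integrable_reward : ∀ k h, 1 ≤ k → 1 ≤ h → h ≤ M.H → Integrable (X.reward k h) μ
  reward_mean : ∀ k h, 1 ≤ k → 1 ≤ h → h ≤ M.H →
    μ[X.reward k h | X.history M.H k h] =ᵐ[μ] fun ω => M.r (X.state k h ω) (X.action k h ω)
  transition : ∀ k h, 1 ≤ k → 1 ≤ h → h ≤ M.H → ∀ s' : S,
    μ[fun ω => if X.state k (h + 1) ω = s' then (1 : ℝ) else 0 | X.history M.H k h]
      =ᵐ[μ] fun ω => M.P (X.state k h ω) (X.action k h ω) s'

/-- The environment belongs to the class with value range `Vmax`: all value functions lie in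
`[0, Vmax]`, and there are a variance proxy `σ` and a constant `Vα ≤ 2 Vmax` with
`max W_h^π(s) ≤ 2 Vmax²` such that, at every visit (step `j` of episode `k`) and for every `h`,
`R_j^k + V_{h+1}^*(s_{j+1}^k) - Q_h^*(s_j^k, a_j^k)` is conditionally
`(σ h s_j^k a_j^k, Vα)`-sub-exponential given the history. -/
structure InClass (X : Run S A Ω) (M : MDP S A) (μ : Measure Ω) (Vmax : ℝ) : Prop where
  env : X.InEnvironment M μ
  Vmax_nonneg : 0 ≤ Vmax
  bounded : ∀ (π : ℕ → S → A) (h : ℕ) (s : S), 1 ≤ h → h ≤ M.H →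
    0 ≤ M.V π h s ∧ M.V π h s ≤ Vmax
  subExp : ∃ (σ : ℕ → S → A → ℝ) (Vα : ℝ),
    (∀ h s a, 0 ≤ σ h s a) ∧ 0 ≤ Vα ∧ Vα ≤ 2 * Vmax ∧
    (∀ (π : ℕ → S → A) (h : ℕ) (s : S), 1 ≤ h → h ≤ M.H → M.W σ π h s ≤ 2 * Vmax ^ 2) ∧
    ∀ k j h, 1 ≤ k → 1 ≤ j → j ≤ M.H → 1 ≤ h → h ≤ M.H →
      CondSubExp (X.history M.H k j) μ
        (fun ω => X.reward k j ω + M.Vstar (h + 1) (X.state k (j + 1) ω)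
          - M.Qstar h (X.state k j ω) (X.action k j ω))
        (fun ω => σ h (X.state k j ω) (X.action k j ω)) Vα

/-- The cumulative regret over `K` episodes. -/
def regret (X : Run S A Ω) (M : MDP S A) (K : ℕ) (ω : Ω) : ℝ :=
  ∑ k ∈ Finset.Icc 1 K,
    (M.Vstar 1 (X.state k 1 ω) - M.V (X.policy k ω) 1 (X.state k 1 ω))

/-- The distributional regret `inf {x ∈ ℝ ∣ ℙ(regret > x) ≤ δ}`, as an extended real number (it is
`-∞` for `δ = 1`). -/
def distRegret (X : Run S A Ω) (M : MDP S A) (μ : Measure Ω) (K : ℕ) (δ : ℝ) : EReal :=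
  sInf ((fun x : ℝ => (x : EReal)) '' {x | μ {ω | x < X.regret M K ω} ≤ ENNReal.ofReal δ})

end Environment

end Run

/-- The logarithmic factor `ℓ(δ) = log (32 H S A (log (e² k H))² / δ)` of episode `k`. -/
def ell (H S A k : ℕ) (δ : ℝ) : ℝ :=
  Real.log (32 * H * S * A * Real.log (Real.exp 2 * k * H) ^ 2 / δ)

/-- The parameters `c_{1,k} = c₁ Vmax √(k ℓ(1) / (S A log KH))`. -/
def paramEll (c₁ Vmax : ℝ) (H S A K k : ℕ) : ℝ :=
  c₁ * Vmax * Real.sqrt (k * ell H S A k 1 / (S * A * Real.log (K * H)))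

/-- The parameters `c_{1,k} = c₁ Vmax √(K log HSA / (S A log KH))` for known `K`; they do not depend
on `k`. -/
def paramKnown (c₁ Vmax : ℝ) (H S A K : ℕ) : ℝ :=
  c₁ * Vmax * Real.sqrt (K * Real.log (H * S * A) / (S * A * Real.log (K * H)))

end EQOPlus

end

/-! ### Variances under finite weights and dynamic programming. -/

noncomputable section
namespace EQOPlus

/-! The bonus is read through a rate `λ` with 9/8 · L/λ ≤ c. For a fixed `λ`, exponential
supermartingales show that the empirical Bellman backup of the fixed function V* errs by at most
L/(λN) + λσ²/2, in all episodes at once (`InEnvironment.subExp_tail`,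
`measure_not_concentrated_le`). The bonus covers L/(λN). The other part does not shrink with N, but
its expected sum along an episode is at most 2V²λ. The estimates are therefore optimistic only up to
a deficit of order V²λ (`Concentrated.quasi_optimism`). The deficit has the shape 3w − w², where w
is the normalized variance to go: concavity releases the variance of w, and this pays for the error
in averaging the deficit itself under the empirical transitions, without a factor S.

In the other direction, the estimated value V^k exceeds a true backup of itself by the bonus plus an
estimation error. The transition part of that error splits into a term with V*, controlled as above,
and a term with V^k − V*. The latter function depends on the data, so it is treated one next state
at a time, at the price of order S·log/N plus a fraction 1/(9V) of its variance (`sum_sub_mul_le`).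
A quadratic potential of the shifted gap absorbs this variance (`potential_step`). One episode then
costs 10V²λ plus 3/2 of an expected sum of costs β/N, truncated at V in every step
(`Concentrated.episode_regret`).

Expected costs are compared with realized ones by a multiplicative supermartingale, stopped once
some count more than doubles inside the episode (`FollowsEQO.measure_sum_episodeCost_le`). For each
pair there are at most log₂(2KH) doublings, and the remaining inverse counts telescope to at most 2
log KH (`sum_totalCost_le`).

It remains to choose rates. One rate per dyadic block of episodes (or a single one if K is known)
makes λ of order 1/√k, respectively 1/√K, and both ∑ V²λ and c_K·SA·log KH become of order √K. The
level δ enters `L` and `λ` but not the algorithm, so the resulting bound is affine in log(1/δ) for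
one and the same run; integrating this tail bounds the expected regret (`integral_le_of_exp_tail`).
-/

/-- Variance of `g` under the weights `p`. -/
def pvar {S : Type*} [Fintype S] (p g : S → ℝ) : ℝ :=
  ∑ s, p s * g s ^ 2 - (∑ s, p s * g s) ^ 2

section Pvar

variable {S : Type*} [Fintype S] {p : S → ℝ} (hp : ∀ s, 0 ≤ p s) (hp1 : ∑ s, p s = 1)

include hp1 in
theorem sum_mul_sub_sq (g : S → ℝ) (c : ℝ) :
    ∑ s, p s * (g s - c) ^ 2 = pvar p g + (∑ s, p s * g s - c) ^ 2 := by
  have h : ∀ s, p s * (g s - c) ^ 2 = p s * g s ^ 2 - 2 * c * (p s * g s) + c ^ 2 * p s := by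
    intro s; ring
  simp only [h, Finset.sum_add_distrib, Finset.sum_sub_distrib, ← Finset.mul_sum, hp1, pvar]
  ring

include hp1 in
theorem pvar_eq (g : S → ℝ) : pvar p g = ∑ s, p s * (g s - ∑ x, p x * g x) ^ 2 := by
  rw [sum_mul_sub_sq hp1]; ring

include hp hp1 in
theorem pvar_nonneg (g : S → ℝ) : 0 ≤ pvar p g := by
  rw [pvar_eq hp1]
  exact Finset.sum_nonneg fun s _ => mul_nonneg (hp s) (sq_nonneg _)

include hp1 in
theorem pvar_add_const (g : S → ℝ) (c : ℝ) : pvar p (fun s => g s + c) = pvar p g := by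
  have h1 : ∑ x, p x * (g x + c) = ∑ x, p x * g x + c := by
    simp only [mul_add, Finset.sum_add_distrib, ← Finset.sum_mul, hp1, one_mul]
  rw [pvar_eq hp1, pvar_eq hp1, h1]
  refine Finset.sum_congr rfl fun s _ => by ring

include hp1 in
theorem sum_mul_const_eq (c : ℝ) : ∑ s, p s * c = c := by
  rw [← Finset.sum_mul, hp1, one_mul]

include hp hp1 in
theorem sum_mul_le_of_le {g : S → ℝ} {c : ℝ} (h : ∀ s, g s ≤ c) : ∑ s, p s * g s ≤ c :=
  (Finset.sum_le_sum fun s _ => mul_le_mul_of_nonneg_left (h s) (hp s)).trans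
    (sum_mul_const_eq hp1 c).le

include hp hp1 in
theorem le_sum_mul_of_le {g : S → ℝ} {c : ℝ} (h : ∀ s, c ≤ g s) : c ≤ ∑ s, p s * g s :=
  (sum_mul_const_eq hp1 c).ge.trans
    (Finset.sum_le_sum fun s _ => mul_le_mul_of_nonneg_left (h s) (hp s))

include hp in
theorem sum_mul_mono {g g' : S → ℝ} (h : ∀ s, g s ≤ g' s) : ∑ s, p s * g s ≤ ∑ s, p s * g' s :=
  Finset.sum_le_sum fun s _ => mul_le_mul_of_nonneg_left (h s) (hp s)

end Pvar

namespace MDP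

variable {S A : Type*} [Fintype S] (M : MDP S A)

/-- Largest expected sum of `f` over the last `n` steps of an episode, by dynamic programming. -/
def optGo (f : ℕ → S → A → ℝ) : ℕ → S → ℝ
  | 0, _ => 0
  | n + 1, s => ⨆ a, (f (M.H - n) s a + ∑ s', M.P s a s' * optGo f n s')

variable [Finite A]

theorem le_optGo_succ (f : ℕ → S → A → ℝ) (n : ℕ) (s : S) (a : A) :
    f (M.H - n) s a + ∑ s', M.P s a s' * M.optGo f n s' ≤ M.optGo f (n + 1) s :=
  le_ciSup (f := fun a => f (M.H - n) s a + ∑ s', M.P s a s' * M.optGo f n s')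
    (Set.finite_range _).bddAbove a

theorem toGo_le_optGo (f : ℕ → S → A → ℝ) (π : ℕ → S → A) (n : ℕ) (s : S) :
    M.toGo f π n s ≤ M.optGo f n s := by
  induction n generalizing s with
  | zero => simp [toGo, optGo]
  | succ n ih =>
    refine le_trans ?_ (M.le_optGo_succ f n s (π (M.H - n) s))
    simp only [toGo]
    gcongr with s' _
    · exact M.P_nonneg _ _ _
    · exact ih s'

/-- Acting greedily in the dynamic programming equation is optimal from every step and state
simultaneously. For `n > M.H`, truncated subtraction would no longer match steps with remaining
lengths. -/
theorem exists_toGo_eq_optGo [Nonempty A] (f : ℕ → S → A → ℝ) :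
    ∃ π : ℕ → S → A, ∀ n ≤ M.H, ∀ s, M.toGo f π n s = M.optGo f n s := by
  have h : ∀ (j : ℕ) (s : S), ∃ a, ∀ b, f j s b + ∑ s', M.P s b s' * M.optGo f (M.H - j) s'
      ≤ f j s a + ∑ s', M.P s a s' * M.optGo f (M.H - j) s' := fun j s =>
    Finite.exists_max fun b => f j s b + ∑ s', M.P s b s' * M.optGo f (M.H - j) s'
  choose π hπ using h
  refine ⟨π, fun n => ?_⟩
  induction n with
  | zero => intro _ s; simp [toGo, optGo]
  | succ n ih =>
    intro hn s
    have e : M.H - (M.H - n) = n := by omega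
    have hm := hπ (M.H - n) s
    rw [e] at hm
    refine le_antisymm (M.toGo_le_optGo f π _ s) ?_
    simp only [toGo, optGo, ih (by omega)]
    exact ciSup_le hm

theorem Vstar_eq_optGo [Nonempty A] {h : ℕ} (hh : 1 ≤ h) (s : S) :
    M.Vstar h s = M.optGo (fun _ => M.r) (M.H + 1 - h) s := by
  obtain ⟨π, hπ⟩ := M.exists_toGo_eq_optGo (fun _ => M.r)
  refine le_antisymm (ciSup_le fun π => M.toGo_le_optGo _ π _ s) ?_
  rw [← hπ _ (by omega)]
  exact le_ciSup (f := fun π => M.V π h s)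
    ⟨_, Set.forall_mem_range.2 fun π => M.toGo_le_optGo _ π _ s⟩ π

/-- One policy is optimal from all next states, so the supremum passes through the expectation.
Writing `M.H - (M.H - n)` for the remaining length keeps this valid without a bound on `n`. -/
theorem Qstar_eq_optGo [Nonempty A] {n : ℕ} (s : S) (a : A) :
    M.Qstar (M.H - n) s a =
      M.r s a + ∑ s', M.P s a s' * M.optGo (fun _ => M.r) (M.H - (M.H - n)) s' := by
  obtain ⟨π, hπ⟩ := M.exists_toGo_eq_optGo (fun _ => M.r)
  have e : M.H + 1 - (M.H - n + 1) = M.H - (M.H - n) := by omega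
  have key : ∀ π, M.Q π (M.H - n) s a ≤
      M.r s a + ∑ s', M.P s a s' * M.optGo (fun _ => M.r) (M.H - (M.H - n)) s' := fun π => by
    simp only [Q, V, expSum, e]
    gcongr
    · exact M.P_nonneg _ _ _
    · exact M.toGo_le_optGo _ _ _ _
  refine le_antisymm (ciSup_le key) ?_
  have : M.Q π (M.H - n) s a =
      M.r s a + ∑ s', M.P s a s' * M.optGo (fun _ => M.r) (M.H - (M.H - n)) s' := by
    simp only [Q, V, expSum, e, hπ _ (Nat.sub_le _ _)]
  rw [← this]
  exact le_ciSup (f := fun π => M.Q π (M.H - n) s a) ⟨_, Set.forall_mem_range.2 key⟩ π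

theorem optGo_nonneg [Nonempty A] {f : ℕ → S → A → ℝ} (hf : ∀ h s a, 0 ≤ f h s a) (n : ℕ) (s : S) :
    0 ≤ M.optGo f n s := by
  induction n generalizing s with
  | zero => simp [optGo]
  | succ n ih =>
    refine le_trans ?_ (M.le_optGo_succ f n s (Classical.arbitrary A))
    exact add_nonneg (hf _ _ _) (Finset.sum_nonneg fun t _ => mul_nonneg (M.P_nonneg _ _ _) (ih t))

/-- All value functions of `M` take values in `[0, v]`. -/
def ValuesIn (v : ℝ) : Prop := ∀ (π : ℕ → S → A) (h : ℕ) (s : S), 1 ≤ h → h ≤ M.H →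
    0 ≤ M.V π h s ∧ M.V π h s ≤ v

omit [Finite A] in
theorem ValuesIn.toGo_mem {M : MDP S A} {v : ℝ} (hv : M.ValuesIn v) (hv0 : 0 ≤ v) (π : ℕ → S → A)
    {n : ℕ} (hn : n ≤ M.H) (s : S) :
    0 ≤ M.toGo (fun _ => M.r) π n s ∧ M.toGo (fun _ => M.r) π n s ≤ v := by
  rcases Nat.eq_zero_or_pos n with rfl | hpos
  · simp [toGo, hv0]
  · have := hv π (M.H + 1 - n) s (by omega) (by omega)
    rwa [V, expSum, show M.H + 1 - (M.H + 1 - n) = n by omega] at this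

theorem ValuesIn.optGo_mem [Nonempty A] {M : MDP S A} {v : ℝ} (hv : M.ValuesIn v) (hv0 : 0 ≤ v)
    {n : ℕ} (hn : n ≤ M.H) (s : S) :
    0 ≤ M.optGo (fun _ => M.r) n s ∧ M.optGo (fun _ => M.r) n s ≤ v := by
  obtain ⟨π, hπ⟩ := M.exists_toGo_eq_optGo (fun _ => M.r)
  rw [← hπ n hn]
  exact hv.toGo_mem hv0 π hn s

omit [Finite A] in
-- At the last step the value of a constant policy is the mean reward. Nonnegative rewards are
-- needed later, where the estimate is clipped at 0.
theorem ValuesIn.r_nonneg {M : MDP S A} {v : ℝ} (hv : M.ValuesIn v) (s : S) (a : A) :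
    0 ≤ M.r s a := by
  have := (hv (fun _ _ => a) M.H s M.H_pos le_rfl).1
  simpa [V, expSum, toGo] using this

end MDP

end EQOPlus
end

/-! ### Conditional expectations and a maximal inequality. -/

noncomputable section
namespace EQOPlus

section Probability

open scoped ENNReal

variable {Ω : Type*} {mΩ : MeasurableSpace Ω} {μ : Measure Ω}

/-- A bound on a conditional expectation can be integrated against nonnegative weights. -/
theorem lintegral_mul_le_of_condExp_le [IsFiniteMeasure μ] {m : MeasurableSpace Ω} (hm : m ≤ mΩ)
    {Y g : Ω → ℝ} (hY : Integrable Y μ) (hYm : Measurable[mΩ] Y) (hY0 : ∀ ω, 0 ≤ Y ω)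
    (hg : Measurable[m] g) (hle : μ[Y | m] ≤ᵐ[μ] g) {Z : Ω → ℝ≥0∞} (hZ : Measurable[m] Z) :
    ∫⁻ ω, Z ω * ENNReal.ofReal (Y ω) ∂μ ≤ ∫⁻ ω, Z ω * ENNReal.ofReal (g ω) ∂μ := by
  have hYe : Measurable[mΩ] fun ω => ENNReal.ofReal (Y ω) := hYm.ennreal_ofReal
  have hge : Measurable[mΩ] fun ω => ENNReal.ofReal (g ω) := (hg.mono hm le_rfl).ennreal_ofReal
  have hZ' : Measurable[mΩ] Z := hZ.mono hm le_rfl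
  -- Comparing the two weighted measures on `m` is enough, because `Z` is `m`-measurable. Nothing
  -- has to be assumed about the integrability of `Z`.
  have key : (μ.withDensity fun ω => ENNReal.ofReal (Y ω)).trim hm
      ≤ (μ.withDensity fun ω => ENNReal.ofReal (g ω)).trim hm := by
    refine Measure.le_intro fun s hs _ => ?_
    rw [trim_measurableSet_eq hm hs, trim_measurableSet_eq hm hs,
      withDensity_apply _ (hm s hs), withDensity_apply _ (hm s hs),
      ← ofReal_integral_eq_lintegral_ofReal hY.integrableOn (Filter.Eventually.of_forall hY0),
      ← setIntegral_condExp hm hY hs]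
    have h0 : 0 ≤ᵐ[μ.restrict s] μ[Y | m] :=
      ae_restrict_of_ae (condExp_nonneg (Filter.Eventually.of_forall hY0))
    rw [ofReal_integral_eq_lintegral_ofReal integrable_condExp.integrableOn h0]
    refine lintegral_mono_ae ?_
    filter_upwards [ae_restrict_of_ae hle] with ω hω
    exact ENNReal.ofReal_le_ofReal hω
  calc ∫⁻ ω, Z ω * ENNReal.ofReal (Y ω) ∂μ
      = ∫⁻ ω, Z ω ∂((μ.withDensity fun ω => ENNReal.ofReal (Y ω)).trim hm) := by
        rw [lintegral_trim hm hZ, lintegral_withDensity_eq_lintegral_mul _ hYe hZ']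
        simp only [Pi.mul_apply, mul_comm]
    _ ≤ ∫⁻ ω, Z ω ∂((μ.withDensity fun ω => ENNReal.ofReal (g ω)).trim hm) :=
        lintegral_mono' key le_rfl
    _ = ∫⁻ ω, Z ω * ENNReal.ofReal (g ω) ∂μ := by
        rw [lintegral_trim hm hZ, lintegral_withDensity_eq_lintegral_mul _ hge hZ']
        simp only [Pi.mul_apply, mul_comm]

/-- Maximal inequality for a nonnegative supermartingale `M` with `∫ M 0 ≤ 1`. -/
theorem mul_measure_exists_ge_le {F : ℕ → MeasurableSpace Ω} (hF : ∀ k, F k ≤ mΩ)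
    (hmono : Monotone F) {M : ℕ → Ω → ℝ≥0∞} (hM : ∀ k, Measurable[F k] (M k))
    (h0 : ∫⁻ ω, M 0 ω ∂μ ≤ 1)
    {n : ℕ} (hstep : ∀ k < n, ∀ s, MeasurableSet[F k] s →
      ∫⁻ ω in s, M (k + 1) ω ∂μ ≤ ∫⁻ ω in s, M k ω ∂μ) (c : ℝ≥0∞) :
    c * μ {ω | ∃ k ≤ n, c ≤ M k ω} ≤ 1 := by
  have hset : ∀ n, MeasurableSet[F n] {ω | ∃ k ≤ n, c ≤ M k ω} := by
    intro n
    have : {ω | ∃ k ≤ n, c ≤ M k ω} = ⋃ k ∈ Set.Iic n, {ω | c ≤ M k ω} := by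
      ext ω; simp
    rw [this]
    refine MeasurableSet.biUnion (Set.to_countable _) fun k hk => ?_
    exact measurableSet_le (mδ := F n) measurable_const ((hM k).mono (hmono hk) le_rfl)
  -- The invariant replaces a stopping time: mass `c` on the paths that have already crossed, plus
  -- what the process still carries on the others.
  have key : ∀ j ≤ n, c * μ {ω | ∃ k ≤ j, c ≤ M k ω}
      + ∫⁻ ω in {ω | ∃ k ≤ j, c ≤ M k ω}ᶜ, M j ω ∂μ ≤ 1 := by
    intro j
    induction j with
    | zero =>
      intro _
      have hs := hF 0 _ (hset 0)
      refine le_trans ?_ ((lintegral_add_compl (M 0) hs).trans_le h0)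
      refine add_le_add_left ?_ _
      rw [← setLIntegral_const]
      refine setLIntegral_mono' hs fun ω hω => ?_
      obtain ⟨k, hk, h⟩ := hω
      rwa [Nat.le_zero.1 hk] at h
    | succ j ih =>
      intro hj
      refine le_trans ?_ (ih (by omega))
      set B := {ω | ∃ k ≤ j, c ≤ M k ω} with hB
      have hBm : MeasurableSet[F j] B := hset j
      set D := {ω | c ≤ M (j + 1) ω} with hD
      have hDm : MeasurableSet D :=
        measurableSet_le measurable_const ((hM (j + 1)).mono (hF _) le_rfl)
      have hun : {ω | ∃ k ≤ j + 1, c ≤ M k ω} = B ∪ (Bᶜ ∩ D) := by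
        ext ω
        simp only [hB, hD, Set.mem_ofPred_eq, Set.mem_union, Set.mem_inter_iff, Set.mem_compl_iff]
        constructor
        · rintro ⟨k, hk, h⟩
          rcases Nat.le_succ_iff.1 hk with hk' | rfl
          · exact Or.inl ⟨k, hk', h⟩
          · by_cases hb : ∃ k ≤ j, c ≤ M k ω
            · exact Or.inl hb
            · exact Or.inr ⟨hb, h⟩
        · rintro (⟨k, hk, h⟩ | ⟨_, h⟩)
          · exact ⟨k, by omega, h⟩
          · exact ⟨j + 1, le_rfl, h⟩
      have hco : {ω | ∃ k ≤ j + 1, c ≤ M k ω}ᶜ = Bᶜ \ D := by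
        rw [hun]; ext ω; simp only [Set.mem_compl_iff, Set.mem_union, Set.mem_inter_iff,
          Set.mem_sdiff]; tauto
      rw [hco, hun]
      have h1 : ∫⁻ ω in Bᶜ, M (j + 1) ω ∂μ ≤ ∫⁻ ω in Bᶜ, M j ω ∂μ :=
        hstep j (by omega) _ hBm.compl
      rw [← lintegral_inter_add_sdiff _ Bᶜ hDm] at h1
      have h2 : c * μ (Bᶜ ∩ D) ≤ ∫⁻ ω in Bᶜ ∩ D, M (j + 1) ω ∂μ := by
        rw [← setLIntegral_const]
        exact setLIntegral_mono' ((hF j _ hBm).compl.inter hDm) fun ω hω => hω.2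
      calc c * μ (B ∪ Bᶜ ∩ D) + ∫⁻ ω in Bᶜ \ D, M (j + 1) ω ∂μ
          ≤ c * (μ B + μ (Bᶜ ∩ D)) + ∫⁻ ω in Bᶜ \ D, M (j + 1) ω ∂μ := by
            gcongr; exact measure_union_le _ _
        _ = c * μ B + (c * μ (Bᶜ ∩ D) + ∫⁻ ω in Bᶜ \ D, M (j + 1) ω ∂μ) := by ring
        _ ≤ c * μ B + ∫⁻ ω in Bᶜ, M j ω ∂μ := by
            gcongr; exact le_trans (by gcongr) h1
  exact le_trans (le_add_right le_rfl) (key n le_rfl)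

end Probability

end EQOPlus
end

/-! ### Histories and exponential supermartingales along the run. -/

noncomputable section
namespace EQOPlus
namespace Run

open scoped ENNReal

section History

variable {S A Ω : Type*} [mS : MeasurableSpace S] [mA : MeasurableSpace A] {X : Run S A Ω} {H : ℕ}

theorem measurable_state_history {i j k h : ℕ} (hi : 1 ≤ i) (hj : 1 ≤ j)
    (hlt : (i < k ∧ j ≤ H + 1) ∨ (i = k ∧ j ≤ h)) :
    Measurable[X.history H k h] (X.state i j) := by
  rw [measurable_iff_comap_le]
  refine le_trans ?_ (le_sup_left.trans le_sup_left)
  exact le_iSup_of_le i (le_iSup_of_le j (le_iSup_of_le ⟨hi, hj, hlt⟩ le_rfl))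

theorem measurable_action_history {i j k h : ℕ} (hi : 1 ≤ i) (hj : 1 ≤ j)
    (hlt : (i < k ∧ j ≤ H) ∨ (i = k ∧ j ≤ h)) :
    Measurable[X.history H k h] (X.action i j) := by
  rw [measurable_iff_comap_le]
  refine le_trans ?_ (le_sup_right.trans le_sup_left)
  exact le_iSup_of_le i (le_iSup_of_le j (le_iSup_of_le ⟨hi, hj, hlt⟩ le_rfl))

theorem measurable_reward_history {i j k h : ℕ} (hi : 1 ≤ i) (hj : 1 ≤ j)
    (hlt : (i < k ∧ j ≤ H) ∨ (i = k ∧ j < h)) :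
    Measurable[X.history H k h] (X.reward i j) := by
  rw [measurable_iff_comap_le]
  refine le_trans ?_ le_sup_right
  exact le_iSup_of_le i (le_iSup_of_le j (le_iSup_of_le ⟨hi, hj, hlt⟩ le_rfl))

theorem history_le_of_measurable {m : MeasurableSpace Ω} {k h : ℕ}
    (hs : ∀ i j, 1 ≤ i → 1 ≤ j → ((i < k ∧ j ≤ H + 1) ∨ (i = k ∧ j ≤ h)) →
      Measurable[m] (X.state i j))
    (ha : ∀ i j, 1 ≤ i → 1 ≤ j → ((i < k ∧ j ≤ H) ∨ (i = k ∧ j ≤ h)) → Measurable[m] (X.action i j))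
    (hr : ∀ i j, 1 ≤ i → 1 ≤ j → ((i < k ∧ j ≤ H) ∨ (i = k ∧ j < h)) → Measurable[m] (X.reward i j)) :
    X.history H k h ≤ m :=
  sup_le (sup_le
    (iSup_le fun i => iSup_le fun j => iSup_le fun hij => (hs i j hij.1 hij.2.1 hij.2.2).comap_le)
    (iSup_le fun i => iSup_le fun j => iSup_le fun hij => (ha i j hij.1 hij.2.1 hij.2.2).comap_le))
    (iSup_le fun i => iSup_le fun j => iSup_le fun hij => (hr i j hij.1 hij.2.1 hij.2.2).comap_le)

/-- Passing to a later episode keeps the actions only up to step `H`, hence the condition `h ≤ H`.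
-/
theorem history_mono {k h k' h' : ℕ} (hH : h ≤ H) (hlt : k < k' ∨ (k = k' ∧ h ≤ h')) :
    X.history H k h ≤ X.history H k' h' := by
  refine history_le_of_measurable (fun i j hi hj hij => measurable_state_history hi hj ?_)
    (fun i j hi hj hij => measurable_action_history hi hj ?_)
    (fun i j hi hj hij => measurable_reward_history hi hj ?_) <;> omega

end History

section Environment

variable {S A Ω : Type*} [Fintype S] [DecidableEq S] [MeasurableSpace S] [DiscreteMeasurableSpace S]
  [Finite A] [MeasurableSpace A] [DiscreteMeasurableSpace A]
  {mΩ : MeasurableSpace Ω} {μ : Measure Ω} {X : Run S A Ω} {M : MDP S A}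

omit [DiscreteMeasurableSpace S] [Finite A] [DiscreteMeasurableSpace A] in
theorem InEnvironment.history_le (hX : X.InEnvironment M μ) (k h : ℕ) : X.history M.H k h ≤ mΩ :=
  history_le_of_measurable (fun _ _ _ _ _ => hX.measurable_state _ _)
    (fun _ _ _ _ _ => hX.measurable_action _ _) (fun _ _ _ _ _ => hX.measurable_reward _ _)

/-- Splitting by the value of the next state reduces an average over it to the conditional laws of
finitely many indicators. The weight `G` may depend on the history, with the next state as a
separate parameter. -/
theorem InEnvironment.lintegral_next_le [IsFiniteMeasure μ] (hX : X.InEnvironment M μ) {k h : ℕ}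
    (hk : 1 ≤ k) (hh : 1 ≤ h) (hH : h ≤ M.H) {G : S → Ω → ℝ≥0∞}
    (hG : ∀ s', Measurable[X.history M.H k h] (G s')) :
    ∫⁻ ω, G (X.state k (h + 1) ω) ω ∂μ ≤
      ∫⁻ ω, ∑ s', ENNReal.ofReal (M.P (X.state k h ω) (X.action k h ω) s') * G s' ω ∂μ := by
  have hle := hX.history_le k h
  have hs := measurable_state_history (X := X) (H := M.H) (k := k) (h := h) hk hh
    (Or.inr ⟨rfl, le_rfl⟩)
  have ha := measurable_action_history (X := X) (H := M.H) (k := k) (h := h) hk hh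
    (Or.inr ⟨rfl, le_rfl⟩)
  have hP : ∀ s', Measurable[X.history M.H k h]
      fun ω => M.P (X.state k h ω) (X.action k h ω) s' := fun s' =>
    (measurable_of_countable (fun p : S × A => M.P p.1 p.2 s')).comp (hs.prodMk ha)
  have hI : ∀ s', Measurable fun ω => if X.state k (h + 1) ω = s' then (1 : ℝ) else 0 := fun s' =>
    (measurable_of_countable (fun x : S => if x = s' then (1 : ℝ) else 0)).comp
      (hX.measurable_state k (h + 1))
  have hsplit : ∀ ω, G (X.state k (h + 1) ω) ω =
      ∑ s', G s' ω * ENNReal.ofReal (if X.state k (h + 1) ω = s' then (1 : ℝ) else 0) := by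
    intro ω
    rw [Finset.sum_eq_single (X.state k (h + 1) ω)]
    · simp
    · intro b _ hb; rw [if_neg (Ne.symm hb)]; simp
    · simp
  simp_rw [hsplit]
  rw [lintegral_finsetSum, lintegral_finsetSum]
  · refine Finset.sum_le_sum fun s' _ => ?_
    simp_rw [mul_comm (ENNReal.ofReal (M.P _ _ _))]
    refine lintegral_mul_le_of_condExp_le hle ?_ (hI s') (fun ω => by split_ifs <;> norm_num) (hP s')
      (hX.transition k h hk hh hH s').le (hG s')
    refine Integrable.of_bound (hI s').aestronglyMeasurable 1 (Filter.Eventually.of_forall fun ω => ?_)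
    split_ifs <;> norm_num
  · intro s' _
    exact ((hP s').mono hle le_rfl).ennreal_ofReal.mul ((hG s').mono hle le_rfl)
  · intro s' _
    exact ((hG s').mono hle le_rfl).mul (hI s').ennreal_ofReal

omit [DecidableEq S] [DiscreteMeasurableSpace S] [Finite A] [DiscreteMeasurableSpace A] in
/-- Multiplying by the factors `Y k 1, …, Y k h` of one episode does not increase integrals. -/
theorem lintegral_mul_prod_le {k : ℕ} {Y : ℕ → Ω → ℝ≥0∞}
    (hY : ∀ j h, 1 ≤ j → j < h → h ≤ M.H → Measurable[X.history M.H k h] (Y j))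
    (hstep : ∀ h, 1 ≤ h → h ≤ M.H → ∀ Z : Ω → ℝ≥0∞, Measurable[X.history M.H k h] Z →
      ∫⁻ ω, Z ω * Y h ω ∂μ ≤ ∫⁻ ω, Z ω ∂μ)
    {Z : Ω → ℝ≥0∞} (hZ : Measurable[X.history M.H k 1] Z) {h : ℕ} (hh : h ≤ M.H) :
    ∫⁻ ω, Z ω * ∏ j ∈ Finset.Icc 1 h, Y j ω ∂μ ≤ ∫⁻ ω, Z ω ∂μ := by
  induction h with
  | zero => simp
  | succ h ih =>
    refine le_trans ?_ (ih (by omega))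
    simp_rw [Finset.prod_Icc_succ_top (Nat.le_add_left 1 h), ← mul_assoc]
    refine hstep (h + 1) (by omega) hh _ ?_
    refine (hZ.mono (history_mono M.H_pos (Or.inr ⟨rfl, by omega⟩)) le_rfl).mul ?_
    refine Finset.measurable_fun_prod _ fun j hj => ?_
    rw [Finset.mem_Icc] at hj
    exact hY j (h + 1) hj.1 (by omega) hh

omit [DiscreteMeasurableSpace S] [Finite A] [DiscreteMeasurableSpace A] in
/-- Time-uniform exponential tail bound for sums of increments `ξ i j` whose exponentials have
conditional mean at most one. -/
theorem InEnvironment.measure_exists_sum_ge_le [IsProbabilityMeasure μ] (hX : X.InEnvironment M μ)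
    {ξ : ℕ → ℕ → Ω → ℝ}
    (hξ : ∀ i j k h, 1 ≤ i → 1 ≤ j → j ≤ M.H → (i < k ∨ (i = k ∧ j < h)) →
      Measurable[X.history M.H k h] (ξ i j))
    (hstep : ∀ k h, 1 ≤ k → 1 ≤ h → h ≤ M.H → ∀ Z : Ω → ℝ≥0∞, Measurable[X.history M.H k h] Z →
      ∫⁻ ω, Z ω * ENNReal.ofReal (Real.exp (ξ k h ω)) ∂μ ≤ ∫⁻ ω, Z ω ∂μ) (n : ℕ) (L : ℝ) :
    μ {ω | ∃ k ≤ n, L < ∑ i ∈ Finset.Ico 1 (k + 1), ∑ h ∈ Finset.Icc 1 M.H, ξ i h ω} ≤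
      ENNReal.ofReal (Real.exp (-L)) := by
  set Y : ℕ → ℕ → Ω → ℝ≥0∞ := fun i j ω => ENNReal.ofReal (Real.exp (ξ i j ω)) with hYdef
  set N : ℕ → Ω → ℝ≥0∞ := fun k ω =>
    ∏ i ∈ Finset.Ico 1 (k + 1), ∏ h ∈ Finset.Icc 1 M.H, Y i h ω with hN
  have hYm : ∀ i j k h, 1 ≤ i → 1 ≤ j → j ≤ M.H → (i < k ∨ (i = k ∧ j < h)) →
      Measurable[X.history M.H k h] (Y i j) := fun i j k h hi hj hjH hlt =>
    ENNReal.measurable_ofReal.comp (Real.measurable_exp.comp (hξ i j k h hi hj hjH hlt))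
  have hNm : ∀ k, Measurable[X.history M.H (k + 1) 1] (N k) := fun k => by
    refine Finset.measurable_fun_prod _ fun i hi => Finset.measurable_fun_prod _ fun j hj => ?_
    rw [Finset.mem_Ico] at hi
    rw [Finset.mem_Icc] at hj
    exact hYm i j _ _ hi.1 hj.1 hj.2 (Or.inl hi.2)
  -- Sampling the filtration at the starts of episodes is enough, because the estimates change only
  -- there. The product over episodes up to `k` is known at the start of episode `k + 1`.
  have key := mul_measure_exists_ge_le (μ := μ) (F := fun k => X.history M.H (k + 1) 1)
    (fun k => hX.history_le _ _)
    (monotone_nat_of_le_succ fun k => history_mono M.H_pos (Or.inl (by omega))) hNm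
    (by simp [hN]) (n := n) (fun k _ s hs => ?_) (ENNReal.ofReal (Real.exp L))
  · have hexp : ENNReal.ofReal (Real.exp (-L)) = (ENNReal.ofReal (Real.exp L))⁻¹ := by
      rw [Real.exp_neg, ENNReal.ofReal_inv_of_pos (Real.exp_pos L)]
    rw [hexp, ENNReal.le_inv_iff_mul_le, mul_comm]
    refine le_trans ?_ key
    refine mul_le_mul' le_rfl (measure_mono ?_)
    rintro ω ⟨k, hk, h⟩
    refine ⟨k, hk, ?_⟩
    simp only [hN, hYdef]
    simp_rw [← ENNReal.ofReal_prod_of_nonneg fun _ _ => (Real.exp_pos _).le]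
    rw [← ENNReal.ofReal_prod_of_nonneg fun _ _ => Finset.prod_nonneg fun _ _ => (Real.exp_pos _).le]
    simp_rw [← Real.exp_sum]
    exact ENNReal.ofReal_le_ofReal (Real.exp_le_exp.2 h.le)
  · rw [← lintegral_indicator (hX.history_le _ _ _ hs), ← lintegral_indicator (hX.history_le _ _ _ hs)]
    have := lintegral_mul_prod_le (μ := μ) (X := X) (M := M) (k := k + 1) (Y := Y (k + 1))
      (fun j h hj hjh hh => hYm _ _ _ _ (by omega) hj (by omega) (Or.inr ⟨rfl, hjh⟩))
      (fun h hh hH => hstep (k + 1) h (by omega) hh hH)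
      (Z := s.indicator (N k)) ((hNm k).indicator hs) le_rfl
    refine le_trans (le_of_eq ?_) this
    refine lintegral_congr fun ω => ?_
    by_cases hω : ω ∈ s
    · simp only [Set.indicator_of_mem hω, hN]
      rw [Finset.prod_Ico_succ_top (by omega)]
    · simp [Set.indicator_of_notMem hω]

end Environment

end Run
end EQOPlus
end

/-! ### Tail bounds for the empirical averages of one state-action pair. -/

noncomputable section
namespace EQOPlus

/-- The Taylor remainder of third order is at most 2/9·|x|³ ≤ 2/27·x², and 1/2 + 2/27 < 3/5. -/
theorem exp_le_one_add_add_sq {x : ℝ} (hx : |x| ≤ 1 / 3) : Real.exp x ≤ 1 + x + 3 / 5 * x ^ 2 := by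
  have h := Real.exp_bound (x := x) (by linarith) (n := 3) (by norm_num)
  have h2 := (abs_le.1 h).2
  simp only [Finset.sum_range_succ, Finset.sum_range_zero, Nat.factorial] at h2
  have h3 : |x| ^ 3 ≤ 1 / 3 * x ^ 2 := by
    rw [pow_succ, sq_abs]; nlinarith [sq_nonneg x]
  norm_num at h2
  nlinarith [sq_nonneg x]

/-- Bernstein's bound on the moment generating function of a bounded function. -/
theorem sum_mul_exp_le {S : Type*} [Fintype S] {p : S → ℝ} (hp : ∀ s, 0 ≤ p s)
    (hp1 : ∑ s, p s = 1) (g : S → ℝ) (t : ℝ) (ht : ∀ s, |t * (g s - ∑ x, p x * g x)| ≤ 1 / 3) :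
    ∑ s, p s * Real.exp (t * (g s - ∑ x, p x * g x)) ≤ Real.exp (3 / 5 * t ^ 2 * pvar p g) := by
  calc ∑ s, p s * Real.exp (t * (g s - ∑ x, p x * g x))
      ≤ ∑ s, p s * (1 + t * (g s - ∑ x, p x * g x) + 3 / 5 * (t * (g s - ∑ x, p x * g x)) ^ 2) :=
        sum_mul_mono hp fun s => exp_le_one_add_add_sq (ht s)
    _ = 3 / 5 * t ^ 2 * pvar p g + 1 := by
        rw [pvar_eq hp1]
        set c := ∑ x, p x * g x with hc
        have : ∀ s, p s * (1 + t * (g s - c) + 3 / 5 * (t * (g s - c)) ^ 2)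
            = p s + t * (p s * g s) - t * c * p s + 3 / 5 * t ^ 2 * (p s * (g s - c) ^ 2) := by
          intro s; ring
        simp only [this, Finset.sum_add_distrib, Finset.sum_sub_distrib, ← Finset.mul_sum, hp1, ← hc]
        ring
    _ ≤ _ := Real.add_one_le_exp _

namespace Run

open scoped ENNReal

section Tails

variable {S A Ω : Type*} [Fintype S] [DecidableEq S] [MeasurableSpace S] [DiscreteMeasurableSpace S]
  [Finite A] [DecidableEq A] [MeasurableSpace A] [DiscreteMeasurableSpace A]
  {mΩ : MeasurableSpace Ω} {μ : Measure Ω} [IsProbabilityMeasure μ] {X : Run S A Ω} {M : MDP S A}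

omit [Fintype S] [DecidableEq S] [DecidableEq A] in
theorem measurableSet_visit [Finite S] {H i j k h : ℕ} (hi : 1 ≤ i) (hj : 1 ≤ j)
    (hlt : (i < k ∧ j ≤ H) ∨ (i = k ∧ j ≤ h)) (s : S) (a : A) :
    MeasurableSet[X.history H k h] {ω | X.state i j ω = s ∧ X.action i j ω = a} := by
  have h1 := measurable_state_history (X := X) (H := H) (k := k) (h := h) hi hj (by omega)
  have h2 := measurable_action_history (X := X) (H := H) (k := k) (h := h) hi hj hlt
  exact (h1 (measurableSet_singleton s)).inter (h2 (measurableSet_singleton a))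

/-- The term σ²t²/2 compensates the conditional moment bound at visits to `(s, a)`, and all other
steps contribute a factor 1. Visits at every step of an episode are pooled, while `f`, `q` and `σ`
stay fixed; later they come from a single step of the value recursion. Summing over actual visits
avoids a union bound over the values of the count. -/
theorem InEnvironment.subExp_tail (hX : X.InEnvironment M μ) {f : S → ℝ} {q σ : S → A → ℝ} {α : ℝ}
    (hsub : ∀ k j, 1 ≤ k → 1 ≤ j → j ≤ M.H → CondSubExp (X.history M.H k j) μ
      (fun ω => X.reward k j ω + f (X.state k (j + 1) ω) - q (X.state k j ω) (X.action k j ω))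
      (fun ω => σ (X.state k j ω) (X.action k j ω)) α)
    (s : S) (a : A) {t : ℝ} (ht : |t| * α ≤ 1) (n : ℕ) (L : ℝ) :
    μ {ω | ∃ k ≤ n, L < ∑ i ∈ Finset.Ico 1 (k + 1), ∑ h ∈ Finset.Icc 1 M.H,
        if X.state i h ω = s ∧ X.action i h ω = a then
          t * (X.reward i h ω + f (X.state i (h + 1) ω) - q s a) - σ s a ^ 2 * t ^ 2 / 2 else 0} ≤
      ENNReal.ofReal (Real.exp (-L)) := by
  have hf : Measurable f := measurable_of_countable f
  have hq : Measurable fun p : S × A => q p.1 p.2 := measurable_of_countable _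
  refine hX.measure_exists_sum_ge_le (ξ := fun i h ω =>
    if X.state i h ω = s ∧ X.action i h ω = a then
      t * (X.reward i h ω + f (X.state i (h + 1) ω) - q s a) - σ s a ^ 2 * t ^ 2 / 2 else 0) ?_ ?_ n L
  · intro i j k h hi hj hjH hlt
    refine Measurable.ite (measurableSet_visit hi hj (by omega) s a) ?_ measurable_const
    have h1 := measurable_reward_history (X := X) (H := M.H) (k := k) (h := h) hi hj (by omega)
    have h2 := hf.comp (measurable_state_history (X := X) (H := M.H) (k := k) (h := h)
      hi (j := j + 1) (by omega) (by omega))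
    exact (((h1.add h2).sub measurable_const).const_mul t).sub measurable_const
  · intro k h hk hh hH Z hZ
    obtain ⟨h_int, hle⟩ := hsub k h hk hh hH t ht
    have hm := hX.history_le k h
    set D := {ω | X.state k h ω = s ∧ X.action k h ω = a} with hD
    have hDm : MeasurableSet[X.history M.H k h] D := measurableSet_visit hk hh (by omega) s a
    -- The conditional bound is used only on the visit event; off it the integrand is `Z` itself and
    -- is carried along as `Dᶜ.indicator Z`.
    set W : Ω → ℝ≥0∞ := D.indicator fun ω => Z ω * ENNReal.ofReal (Real.exp (-(σ s a ^ 2 * t ^ 2 / 2)))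
      with hW
    have hWm : Measurable[X.history M.H k h] W := (hZ.mul measurable_const).indicator hDm
    set Y : Ω → ℝ := fun ω => Real.exp (t * (X.reward k h ω + f (X.state k (h + 1) ω)
      - q (X.state k h ω) (X.action k h ω))) with hY
    have hYm : Measurable Y := Real.measurable_exp.comp ((((hX.measurable_reward k h).add
      (hf.comp (hX.measurable_state k (h + 1)))).sub
        (hq.comp ((hX.measurable_state k h).prodMk (hX.measurable_action k h)))).const_mul t)
    have hs := measurable_state_history (X := X) (H := M.H) (k := k) (h := h) hk hh
      (Or.inr ⟨rfl, le_rfl⟩)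
    have ha := measurable_action_history (X := X) (H := M.H) (k := k) (h := h) hk hh
      (Or.inr ⟨rfl, le_rfl⟩)
    have hgm : Measurable[X.history M.H k h] fun ω =>
        Real.exp (σ (X.state k h ω) (X.action k h ω) ^ 2 * t ^ 2 / 2) :=
      (measurable_of_countable
        (fun p : S × A => Real.exp (σ p.1 p.2 ^ 2 * t ^ 2 / 2))).comp (hs.prodMk ha)
    have key := lintegral_mul_le_of_condExp_le hm h_int hYm (fun ω => (Real.exp_pos _).le) hgm hle hWm
    have e1 : ∀ ω, Z ω * ENNReal.ofReal (Real.exp (if X.state k h ω = s ∧ X.action k h ω = a then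
        t * (X.reward k h ω + f (X.state k (h + 1) ω) - q s a) - σ s a ^ 2 * t ^ 2 / 2 else 0))
        = W ω * ENNReal.ofReal (Y ω) + Dᶜ.indicator Z ω := by
      intro ω
      by_cases hω : X.state k h ω = s ∧ X.action k h ω = a
      · have hmem : ω ∈ D := hω
        rw [if_pos hω, hW, Set.indicator_of_mem hmem, Set.indicator_of_notMem (by simpa using hmem),
          add_zero, mul_assoc, ← ENNReal.ofReal_mul (Real.exp_pos _).le, ← Real.exp_add, hω.1, hω.2]
        congr 3; ring
      · have hmem : ω ∉ D := hω
        rw [if_neg hω, hW, Set.indicator_of_notMem hmem, Set.indicator_of_mem (by simpa using hmem)]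
        simp
    have e2 : ∀ ω, Z ω = W ω * ENNReal.ofReal
        (Real.exp (σ (X.state k h ω) (X.action k h ω) ^ 2 * t ^ 2 / 2)) + Dᶜ.indicator Z ω := by
      intro ω
      by_cases hω : X.state k h ω = s ∧ X.action k h ω = a
      · have hmem : ω ∈ D := hω
        rw [hW, Set.indicator_of_mem hmem, Set.indicator_of_notMem (by simpa using hmem),
          add_zero, mul_assoc, ← ENNReal.ofReal_mul (Real.exp_pos _).le, ← Real.exp_add, hω.1, hω.2]
        simp
      · have hmem : ω ∉ D := hω
        rw [hW, Set.indicator_of_notMem hmem, Set.indicator_of_mem (by simpa using hmem)]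
        simp
    have hZc : Measurable (Dᶜ.indicator Z) := (hZ.mono hm le_rfl).indicator (hm _ hDm).compl
    calc _ = ∫⁻ ω, W ω * ENNReal.ofReal (Y ω) ∂μ + ∫⁻ ω, Dᶜ.indicator Z ω ∂μ := by
          rw [← lintegral_add_right _ hZc]; exact lintegral_congr e1
      _ ≤ ∫⁻ ω, W ω * ENNReal.ofReal
            (Real.exp (σ (X.state k h ω) (X.action k h ω) ^ 2 * t ^ 2 / 2)) ∂μ
            + ∫⁻ ω, Dᶜ.indicator Z ω ∂μ := by gcongr
      _ = ∫⁻ ω, Z ω ∂μ := by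
          rw [← lintegral_add_right _ hZc]; exact lintegral_congr fun ω => (e2 ω).symm

/-- The same supermartingale, for a function of the next state only: `sum_mul_exp_le` supplies the
compensator, now in terms of the true variance of that function. -/
theorem InEnvironment.bounded_tail (hX : X.InEnvironment M μ) (g : S → ℝ) (s : S) (a : A) {t : ℝ}
    (ht : ∀ s', |t * (g s' - ∑ x, M.P s a x * g x)| ≤ 1 / 3) (n : ℕ) (L : ℝ) :
    μ {ω | ∃ k ≤ n, L < ∑ i ∈ Finset.Ico 1 (k + 1), ∑ h ∈ Finset.Icc 1 M.H,
        if X.state i h ω = s ∧ X.action i h ω = a then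
          t * (g (X.state i (h + 1) ω) - ∑ x, M.P s a x * g x)
            - 3 / 5 * t ^ 2 * pvar (M.P s a) g else 0} ≤
      ENNReal.ofReal (Real.exp (-L)) := by
  have hg : Measurable g := measurable_of_countable g
  set c := ∑ x, M.P s a x * g x with hc
  set v := 3 / 5 * t ^ 2 * pvar (M.P s a) g with hv
  refine hX.measure_exists_sum_ge_le (ξ := fun i h ω =>
    if X.state i h ω = s ∧ X.action i h ω = a then t * (g (X.state i (h + 1) ω) - c) - v else 0)
    ?_ ?_ n L
  · intro i j k h hi hj hjH hlt
    refine Measurable.ite (measurableSet_visit hi hj (by omega) s a) ?_ measurable_const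
    have h2 := hg.comp (measurable_state_history (X := X) (H := M.H) (k := k) (h := h)
      hi (j := j + 1) (by omega) (by omega))
    exact ((h2.sub measurable_const).const_mul t).sub measurable_const
  · intro k h hk hh hH Z hZ
    have hDm : MeasurableSet[X.history M.H k h] {ω | X.state k h ω = s ∧ X.action k h ω = a} :=
      measurableSet_visit hk hh (by omega) s a
    refine le_trans (hX.lintegral_next_le hk hh hH (G := fun s' ω => Z ω * ENNReal.ofReal (Real.exp
      (if X.state k h ω = s ∧ X.action k h ω = a then t * (g s' - c) - v else 0))) ?_) ?_
    · intro s'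
      exact hZ.mul (ENNReal.measurable_ofReal.comp (Real.measurable_exp.comp
        (Measurable.ite hDm measurable_const measurable_const)))
    · refine lintegral_mono fun ω => ?_
      by_cases hω : X.state k h ω = s ∧ X.action k h ω = a
      · simp only [hω.1, hω.2, and_self, if_true]
        have h1 : ∀ s', ENNReal.ofReal (M.P s a s') * (Z ω * ENNReal.ofReal (Real.exp
            (t * (g s' - c) - v))) = Z ω * ENNReal.ofReal (M.P s a s' * Real.exp
            (t * (g s' - c) - v)) := by
          intro s'
          rw [ENNReal.ofReal_mul (M.P_nonneg _ _ _)]; ring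
        simp only [h1, ← Finset.mul_sum]
        rw [← ENNReal.ofReal_sum_of_nonneg
          fun s' _ => mul_nonneg (M.P_nonneg _ _ _) (Real.exp_pos _).le]
        refine mul_le_of_le_one_right' ?_
        rw [← ENNReal.ofReal_one]
        refine ENNReal.ofReal_le_ofReal ?_
        have := sum_mul_exp_le (M.P_nonneg s a) (M.P_sum s a) g t ht
        simp only [Real.exp_sub, ← mul_div_assoc, ← Finset.sum_div]
        rw [div_le_one (Real.exp_pos _)]
        exact this
      · simp only [if_neg hω, Real.exp_zero, ENNReal.ofReal_one, mul_one]
        rw [← Finset.sum_mul, ← ENNReal.ofReal_sum_of_nonneg fun s' _ => M.P_nonneg _ _ _, M.P_sum]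
        simp

end Tails

section Empirical

variable {S A Ω : Type*} [DecidableEq S] [DecidableEq A] (X : Run S A Ω) (H : ℕ)

theorem count_mul_eq_sum (k : ℕ) (ω : Ω) (s : S) (a : A) (c : ℝ) :
    X.count H k ω s a * c = ∑ i ∈ Finset.Ico 1 k, ∑ h ∈ Finset.Icc 1 H,
      if X.state i h ω = s ∧ X.action i h ω = a then c else 0 := by
  simp only [count, Nat.cast_sum, Finset.sum_mul, Nat.cast_ite, Nat.cast_one, Nat.cast_zero, ite_mul,
    one_mul, zero_mul]

theorem count_mul_rHat {k : ℕ} {ω : Ω} {s : S} {a : A} (hN : X.count H k ω s a ≠ 0) :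
    X.count H k ω s a * X.rHat H k ω s a = ∑ i ∈ Finset.Ico 1 k, ∑ h ∈ Finset.Icc 1 H,
      if X.state i h ω = s ∧ X.action i h ω = a then X.reward i h ω else 0 := by
  rw [rHat, mul_div_cancel₀]
  exact_mod_cast hN

theorem count_mul_sum_pHat [Fintype S] {k : ℕ} {ω : Ω} {s : S} {a : A}
    (hN : X.count H k ω s a ≠ 0) (g : S → ℝ) :
    X.count H k ω s a * ∑ s', X.pHat H k ω s a s' * g s' =
      ∑ i ∈ Finset.Ico 1 k, ∑ h ∈ Finset.Icc 1 H,
        if X.state i h ω = s ∧ X.action i h ω = a then g (X.state i (h + 1) ω) else 0 := by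
  have hN' : (X.count H k ω s a : ℝ) ≠ 0 := by exact_mod_cast hN
  have h1 : ∀ s', X.count H k ω s a * (X.pHat H k ω s a s' * g s') =
      ∑ i ∈ Finset.Ico 1 k, ∑ h ∈ Finset.Icc 1 H,
        if X.state i (h + 1) ω = s' then
          (if X.state i h ω = s ∧ X.action i h ω = a then g s' else 0) else 0 := by
    intro s'
    rw [← mul_assoc, pHat, mul_div_cancel₀ _ hN']
    simp only [Finset.sum_mul]
    refine Finset.sum_congr rfl fun i _ => Finset.sum_congr rfl fun h _ => ?_
    split_ifs <;> simp_all
  rw [Finset.mul_sum]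
  simp only [h1]
  rw [Finset.sum_comm]
  refine Finset.sum_congr rfl fun i _ => ?_
  rw [Finset.sum_comm]
  refine Finset.sum_congr rfl fun h _ => ?_
  simp

theorem pHat_nonneg (k : ℕ) (ω : Ω) (s : S) (a : A) (s' : S) : 0 ≤ X.pHat H k ω s a s' :=
  div_nonneg (Finset.sum_nonneg fun _ _ => Finset.sum_nonneg fun _ _ => by split_ifs <;> norm_num)
    (Nat.cast_nonneg _)

theorem sum_pHat [Fintype S] {k : ℕ} {ω : Ω} {s : S} {a : A} (hN : X.count H k ω s a ≠ 0) :
    ∑ s', X.pHat H k ω s a s' = 1 := by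
  have hN' : (X.count H k ω s a : ℝ) ≠ 0 := by exact_mod_cast hN
  have h := X.count_mul_sum_pHat H hN fun _ => 1
  rw [← X.count_mul_eq_sum H] at h
  simpa using mul_left_cancel₀ hN' h

end Empirical

end Run
end EQOPlus
end

/-! ### Deterministic one-step inequalities. -/

noncomputable section
namespace EQOPlus

section OneStep

variable {S : Type*} [Fintype S] {p p' : S → ℝ}

/-- The geometric grid of rates at which transition frequencies are controlled. -/
def rate (i : ℕ) : ℝ := 3 / 10 * (2 / 3) ^ i

theorem rate_pos (i : ℕ) : 0 < rate i := by unfold rate; positivity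

theorem rate_le (i : ℕ) : rate i ≤ 3 / 10 := by
  unfold rate
  have : ((2 : ℝ) / 3) ^ i ≤ 1 := pow_le_one₀ (by norm_num) (by norm_num)
  linarith

/-- The first grid point below `x` is within a factor 3/2 of it, the ratio of the grid being 2/3.
The grid reaches far enough because `rate G` is at most 3/20/T < 5/27/T. -/
theorem exists_rate_le {x T : ℝ} {G : ℕ} (hT : 0 < T) (hG : 2 * T ≤ (3 / 2 : ℝ) ^ G)
    (hx : 5 / 27 / T ≤ x) (hx1 : x < 3 / 10) : ∃ i < G + 1, rate i ≤ x ∧ x ≤ 3 / 2 * rate i := by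
  classical
  have hG' : rate G ≤ x := by
    refine le_trans ?_ hx
    have h1 : ((2 : ℝ) / 3) ^ G * (3 / 2) ^ G = 1 := by rw [← mul_pow]; norm_num
    have h2 : (0 : ℝ) < (2 / 3) ^ G := by positivity
    rw [le_div_iff₀ hT]
    unfold rate
    nlinarith
  have hex : ∃ i, rate i ≤ x := ⟨G, hG'⟩
  refine ⟨Nat.find hex, Nat.lt_succ_of_le (Nat.find_min' hex hG'), Nat.find_spec hex, ?_⟩
  obtain ⟨j, hj⟩ : ∃ j, Nat.find hex = j + 1 := by
    refine Nat.exists_eq_succ_of_ne_zero fun h0 => ?_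
    have := Nat.find_spec hex
    rw [h0] at this
    simp only [rate, pow_zero, mul_one] at this
    linarith
  have hlt := Nat.find_min hex (m := j) (by omega)
  rw [hj]
  unfold rate at hlt ⊢
  rw [pow_succ]
  linarith

/-- Transition errors are controlled by a fraction of the variance. -/
theorem sum_sub_mul_le (hp : ∀ s, 0 ≤ p s) (hp1 : ∑ s, p s = 1) (hq : ∀ s, 0 ≤ p' s)
    (hq1 : ∑ s, p' s = 1) {V T N L : ℝ} {G : ℕ} (hV : 0 < V) (hN : 1 ≤ N) (hNT : N ≤ T) (hL : 1 ≤ L)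
    (hG : 2 * T ≤ (3 / 2 : ℝ) ^ G)
    (htr : ∀ s, ∀ i < G + 1, |p' s - p s| ≤ L / (rate i * N) + 3 / 5 * rate i * p s)
    {g : S → ℝ} (hg : ∀ s, |g s - ∑ x, p x * g x| ≤ 7 / 5 * V) :
    ∑ s, p' s * g s - ∑ s, p s * g s ≤ 1 / (9 * V) * pvar p g + 9 * Fintype.card S * L * V / N := by
  have hN0 : 0 < N := by linarith
  set c := ∑ x, p x * g x with hc
  -- Both weights sum to one, so `g` may be centred, and then each coordinate is bounded separately.
  have e1 : ∑ s, p' s * g s - c = ∑ s, (p' s - p s) * (g s - c) := by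
    simp only [sub_mul, mul_sub, Finset.sum_sub_distrib, ← Finset.sum_mul, hp1, hq1, ← hc]; ring
  have e2 : 1 / (9 * V) * pvar p g + 9 * Fintype.card S * L * V / N
      = ∑ s, (1 / (9 * V) * (p s * (g s - c) ^ 2) + 9 * L * V / N) := by
    rw [Finset.sum_add_distrib, ← Finset.mul_sum, pvar_eq hp1, Finset.sum_const, Finset.card_univ,
      nsmul_eq_mul]
    ring
  rw [e1, e2]
  refine Finset.sum_le_sum fun s _ => ?_
  have hs1 : p s ≤ 1 := hp1 ▸ Finset.single_le_sum (fun x _ => hp x) (Finset.mem_univ s)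
  have hs2 : p' s ≤ 1 := hq1 ▸ Finset.single_le_sum (fun x _ => hq x) (Finset.mem_univ s)
  have hd1 : |p' s - p s| ≤ 1 := by rw [abs_le]; constructor <;> linarith [hp s, hq s]
  refine (le_abs_self _).trans ?_
  rw [abs_mul, ← sq_abs (g s - c)]
  set e := |g s - c| with he
  have he0 : 0 ≤ e := abs_nonneg _
  have hge : e ≤ 7 / 5 * V := hg s
  -- A deviation this small costs at most V/N even with the trivial bound `|p' - p| ≤ 1`; excluding
  -- it keeps the needed rates bounded away from zero.
  by_cases hsmall : e ≤ V / N
  · have h1 : |p' s - p s| * e ≤ 1 * (V / N) := mul_le_mul hd1 hsmall he0 zero_le_one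
    have h2 : 1 * (V / N) ≤ 9 * L * V / N := by
      rw [one_mul]
      gcongr
      nlinarith
    have h3 : 0 ≤ 1 / (9 * V) * (p s * e ^ 2) := by have := hp s; positivity
    linarith
  · push Not at hsmall
    have hepos : 0 < e := lt_of_le_of_lt (by positivity) hsmall
    -- The rate should be proportional to the deviation, with 3/5 · 5/27 = 1/9 giving the variance
    -- coefficient. The deviation is not known in advance, which is why a whole grid of rates is
    -- controlled. The other term costs 3/2 · 27/5 = 81/10 ≤ 9. Finally 5/27 · 7/5 < 3/10 keeps `x`
    -- inside the grid.
    obtain ⟨i, hi, hr1, hr2⟩ := exists_rate_le (x := 5 / 27 * (e / V)) (T := T) (G := G)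
      (by linarith) hG (by
        rw [div_eq_mul_inv]
        refine mul_le_mul_of_nonneg_left ?_ (by norm_num)
        rw [le_div_iff₀ hV]
        have : V / T ≤ V / N := by gcongr
        rw [inv_mul_eq_div]
        linarith) (by
        have : e / V ≤ 7 / 5 := by rw [div_le_iff₀ hV]; exact hge
        linarith)
    have hrp := rate_pos i
    have h1 := mul_le_mul_of_nonneg_right (htr s i hi) he0
    have h2 : L / (rate i * N) * e ≤ 9 * L * V / N := by
      rw [div_mul_eq_mul_div, div_le_div_iff₀ (by positivity) hN0]
      have h4 : e ≤ 81 / 10 * (V * rate i) := by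
        have := mul_le_mul_of_nonneg_right hr2 hV.le
        have h5 : 5 / 27 * (e / V) * V = 5 / 27 * e := by field_simp
        nlinarith
      have h6 : L * e * N ≤ L * (9 * (V * rate i)) * N := by
        have : 0 < V * rate i := by positivity
        gcongr; linarith
      nlinarith
    have h3 : 3 / 5 * rate i * p s * e ≤ 1 / (9 * V) * (p s * e ^ 2) := by
      have h4 : 3 / 5 * rate i * p s * e ≤ 3 / 5 * (5 / 27 * (e / V)) * p s * e := by
        have := hp s; gcongr
      refine h4.trans (le_of_eq ?_)
      field_simp; ring
    nlinarith

/-- The concave transform `3 w - w ^ 2` of a function with `w' ≥ x + E w` gains the variance. -/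
theorem transform_step (hp : ∀ s, 0 ≤ p s) {w : S → ℝ} {w' x : ℝ}
    (hw : ∀ s, 0 ≤ w s) (hw' : w' ≤ 1) (hx : 0 ≤ x) (h : x + ∑ s, p s * w s ≤ w') :
    x + ∑ s, p s * (3 * w s - w s ^ 2) + pvar p w ≤ 3 * w' - w' ^ 2 := by
  have h0 : 0 ≤ ∑ s, p s * w s := Finset.sum_nonneg fun s _ => mul_nonneg (hp s) (hw s)
  have e : ∑ s, p s * (3 * w s - w s ^ 2) = 3 * ∑ s, p s * w s - ∑ s, p s * w s ^ 2 := by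
    rw [Finset.mul_sum, ← Finset.sum_sub_distrib]
    exact Finset.sum_congr rfl fun s _ => by ring
  rw [e, pvar]
  -- With mean `c`, the last two terms on the left add up to 3c − c². From `c` to `w'` the slope of
  -- the transform is 3 − w' − c ≥ 1, since c ≤ w' ≤ 1, so the increase covers `x`.
  set c := ∑ s, p s * w s
  nlinarith

/-- The transform is 3-Lipschitz on [0, 1], and a variance is at most the mean square deviation from
any point, here from the transform of the mean. -/
theorem pvar_transform_le (hp : ∀ s, 0 ≤ p s) (hp1 : ∑ s, p s = 1) {w : S → ℝ}
    (hw : ∀ s, 0 ≤ w s) (hw1 : ∀ s, w s ≤ 1) :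
    pvar p (fun s => 3 * w s - w s ^ 2) ≤ 9 * pvar p w := by
  set c := ∑ s, p s * w s with hc
  have h0 : 0 ≤ c := le_sum_mul_of_le hp hp1 hw
  have h1 : c ≤ 1 := sum_mul_le_of_le hp hp1 hw1
  have h := sum_mul_sub_sq hp1 (fun s => 3 * w s - w s ^ 2) (3 * c - c ^ 2)
  have h2 : pvar p (fun s => 3 * w s - w s ^ 2)
      ≤ ∑ s, p s * (3 * w s - w s ^ 2 - (3 * c - c ^ 2)) ^ 2 := by
    rw [h]
    exact le_add_of_nonneg_right (sq_nonneg _)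
  refine h2.trans ?_
  rw [pvar_eq hp1 w, ← hc]
  clear_value c
  rw [Finset.mul_sum]
  refine Finset.sum_le_sum fun s _ => ?_
  have : (3 * w s - w s ^ 2 - (3 * c - c ^ 2)) ^ 2 = (3 - w s - c) ^ 2 * (w s - c) ^ 2 := by ring
  rw [this]
  have h3 : (3 - w s - c) ^ 2 ≤ 9 := by nlinarith [hw s, hw1 s]
  have h4 := mul_le_mul_of_nonneg_right h3 (sq_nonneg (w s - c))
  nlinarith [mul_le_mul_of_nonneg_left h4 (hp s)]

/-- One step of the quadratic potential used to absorb the variance of the estimation error. -/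
theorem potential_step (hp : ∀ s, 0 ≤ p s) (hp1 : ∑ s, p s = 1) {V : ℝ} (hV : 0 < V) {E : S → ℝ}
    {E' Δ b x : ℝ} (hE0 : ∀ s, 0 ≤ E s) (hE1 : ∀ s, E s ≤ 7 / 5 * V) (hE'0 : 0 ≤ E')
    (hE'1 : E' ≤ 7 / 5 * V) (hb : 0 ≤ b) (hx : 0 ≤ x) (h1 : E' - ∑ s, p s * E s ≤ Δ)
    (h2 : Δ ≤ b + x + 1 / (9 * V) * pvar p E) :
    2 / 3 * Δ - x ≤ b + 1 / (9 * V) * (∑ s, p s * E s ^ 2 - E' ^ 2) := by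
  set e := ∑ s, p s * E s with he
  have he0 : 0 ≤ e := le_sum_mul_of_le hp hp1 hE0
  have he1 : e ≤ 7 / 5 * V := sum_mul_le_of_le hp hp1 hE1
  -- The expected growth of the squared gap is its variance minus a drift; the drift is what must be
  -- controlled by `Δ`.
  have hvar : ∑ s, p s * E s ^ 2 - E' ^ 2 = pvar p E - (E' - e) * (E' + e) := by
    rw [pvar, ← he]; ring
  have hpv := pvar_nonneg hp hp1 E
  have hV9 : 0 < 1 / (9 * V) := by positivity
  rw [hvar]
  rcases le_or_gt 0 Δ with hΔ | hΔ
  -- As E' + e ≤ 14/5·V, the drift costs at most Δ/3, which leaves the factor 2/3.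
  · have h3 : (E' - e) * (E' + e) ≤ 3 * V * Δ := by
      rcases le_or_gt 0 (E' - e) with h | h
      · nlinarith
      · nlinarith [mul_nonneg hV.le hΔ]
    have h4 : 1 / (9 * V) * ((E' - e) * (E' + e)) ≤ Δ / 3 := by
      refine (mul_le_mul_of_nonneg_left h3 hV9.le).trans (le_of_eq ?_)
      field_simp; norm_num
    rw [mul_sub]; linarith
  -- For negative `Δ` the drift is favourable, and the left side of the goal is negative anyway.
  · have h3 : (E' - e) * (E' + e) ≤ 0 :=
      mul_nonpos_of_nonpos_of_nonneg (by linarith) (by linarith)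
    have h4 : 0 ≤ 1 / (9 * V) * (pvar p E - (E' - e) * (E' + e)) :=
      mul_nonneg hV9.le (by linarith)
    linarith

end OneStep

end EQOPlus
end

/-! ### Quasi-optimism and the regret of one episode. -/

noncomputable section
namespace EQOPlus

namespace MDP

variable {S A : Type*} [Fintype S] (M : MDP S A)

/-- The largest total variance proxy over the last `n` steps, normalized by `2 V ^ 2`. -/
def wBar (σ : ℕ → S → A → ℝ) (V : ℝ) (n : ℕ) (s : S) : ℝ :=
  M.optGo (fun j x a => (1 / 2) * σ j x a ^ 2) n s / (2 * V ^ 2)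

/-- The shape of the optimism deficit. -/
def deficit (σ : ℕ → S → A → ℝ) (V : ℝ) (n : ℕ) (s : S) : ℝ :=
  3 * M.wBar σ V n s - M.wBar σ V n s ^ 2

/-- Expected cost over the last `n` steps, truncated at `V` in every step. -/
def cappedGo (V : ℝ) (B : S → A → ℝ) (π : ℕ → S → A) : ℕ → S → ℝ
  | 0, _ => 0
  | n + 1, s => min V (B s (π (M.H - n) s) + ∑ s', M.P s (π (M.H - n) s) s' * cappedGo V B π n s')

theorem cappedGo_mem {V : ℝ} (hV : 0 ≤ V) {B : S → A → ℝ} (hB : ∀ s a, 0 ≤ B s a)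
    (π : ℕ → S → A) (n : ℕ) (s : S) : 0 ≤ M.cappedGo V B π n s ∧ M.cappedGo V B π n s ≤ V := by
  induction n generalizing s with
  | zero => simp [cappedGo, hV]
  | succ n ih =>
    refine ⟨le_min hV (add_nonneg (hB _ _) ?_), min_le_left _ _⟩
    exact Finset.sum_nonneg fun s' _ => mul_nonneg (M.P_nonneg _ _ _) (ih s').1

variable [Finite A] [Nonempty A] {M} {σ : ℕ → S → A → ℝ} {V : ℝ}

theorem wBar_mem (hV : 0 < V)
    (hW : ∀ (π : ℕ → S → A) (h : ℕ) (s : S), 1 ≤ h → h ≤ M.H → M.W σ π h s ≤ 2 * V ^ 2)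
    {n : ℕ} (hn : n ≤ M.H) (s : S) : 0 ≤ M.wBar σ V n s ∧ M.wBar σ V n s ≤ 1 := by
  refine ⟨div_nonneg (M.optGo_nonneg (fun _ _ _ => by positivity) n s) (by positivity), ?_⟩
  rw [wBar, div_le_one (by positivity)]
  rcases Nat.eq_zero_or_pos n with rfl | hpos
  · simp only [optGo]; positivity
  · obtain ⟨π, hπ⟩ := M.exists_toGo_eq_optGo (fun j x a => (1 / 2) * σ j x a ^ 2)
    have := hW π (M.H + 1 - n) s (by omega) (by omega)
    rwa [W, expSum, show M.H + 1 - (M.H + 1 - n) = n by omega, hπ n hn] at this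

theorem deficit_mem (hV : 0 < V)
    (hW : ∀ (π : ℕ → S → A) (h : ℕ) (s : S), 1 ≤ h → h ≤ M.H → M.W σ π h s ≤ 2 * V ^ 2)
    {n : ℕ} (hn : n ≤ M.H) (s : S) : 0 ≤ M.deficit σ V n s ∧ M.deficit σ V n s ≤ 2 := by
  obtain ⟨h0, h1⟩ := wBar_mem hV hW hn s
  unfold deficit
  constructor <;> nlinarith

/-- This is `transform_step` for the Bellman inequality of the normalized variance to go. The
variance that it releases is exactly the one lost in the field `deficit` of `Concentrated`. -/
theorem deficit_succ_ge (hV : 0 < V)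
    (hW : ∀ (π : ℕ → S → A) (h : ℕ) (s : S), 1 ≤ h → h ≤ M.H → M.W σ π h s ≤ 2 * V ^ 2)
    {n : ℕ} (hn : n < M.H) (s : S) (a : A) :
    σ (M.H - n) s a ^ 2 / (4 * V ^ 2) + ∑ s', M.P s a s' * M.deficit σ V n s'
      + pvar (M.P s a) (M.wBar σ V n) ≤ M.deficit σ V (n + 1) s := by
  refine transform_step (M.P_nonneg s a) (fun s' => (wBar_mem hV hW hn.le s').1)
    (wBar_mem hV hW hn s).2 (by positivity) ?_
  have := M.le_optGo_succ (fun j x a => (1 / 2) * σ j x a ^ 2) n s a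
  rw [wBar, le_div_iff₀ (by positivity), add_mul, Finset.sum_mul]
  refine le_trans (le_of_eq ?_) this
  congr 1
  · field_simp; norm_num
  · refine Finset.sum_congr rfl fun s' _ => ?_
    rw [wBar]; field_simp

end MDP

namespace Run

variable {S A Ω : Type*} [Fintype S] [Fintype A] [DecidableEq S] [DecidableEq A]

/-- Concentration of the estimates of episode `k` at the sample point `ω`. -/
structure Concentrated (X : Run S A Ω) (M : MDP S A) (σ : ℕ → S → A → ℝ) (V : ℝ) (k : ℕ) (ω : Ω)
    (lam L L' : ℝ) (G : ℕ) : Prop where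
  lower : ∀ n < M.H, ∀ s a, X.count M.H k ω s a ≠ 0 →
    M.r s a + ∑ s', M.P s a s' * M.optGo (fun _ => M.r) n s' ≤
      X.rHat M.H k ω s a + ∑ s', X.pHat M.H k ω s a s' * M.optGo (fun _ => M.r) n s'
        + (L / lam / X.count M.H k ω s a + lam * σ (M.H - n) s a ^ 2 / 2)
  upper : ∀ n < M.H, ∀ s a, X.count M.H k ω s a ≠ 0 →
    X.rHat M.H k ω s a + ∑ s', X.pHat M.H k ω s a s' * M.optGo (fun _ => M.r) n s' ≤
      M.r s a + ∑ s', M.P s a s' * M.optGo (fun _ => M.r) n s'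
        + (L / lam / X.count M.H k ω s a + lam * σ (M.H - n) s a ^ 2 / 2)
  deficit : ∀ n < M.H, ∀ s a, X.count M.H k ω s a ≠ 0 →
    ∑ s', X.pHat M.H k ω s a s' * M.deficit σ V n s' ≤
      ∑ s', M.P s a s' * M.deficit σ V n s' + 6 * L / X.count M.H k ω s a
        + pvar (M.P s a) (M.wBar σ V n)
  transition : ∀ s a, X.count M.H k ω s a ≠ 0 → ∀ s', ∀ i < G + 1,
    |X.pHat M.H k ω s a s' - M.P s a s'| ≤
      L' / (rate i * X.count M.H k ω s a) + 3 / 5 * rate i * M.P s a s'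

section Backup

variable {X : Run S A Ω} {M : MDP S A} {V : ℝ} {c : ℕ → ℝ} {k : ℕ} {ω : Ω}

omit [Fintype A] in
theorem backup_mem (hV : 0 ≤ V) (hc : 0 ≤ c k) (v : S → ℝ) (s : S) (a : A) :
    0 ≤ X.backup M.H V c (fun _ => ⊤) k ω v s a ∧ X.backup M.H V c (fun _ => ⊤) k ω v s a ≤ V := by
  unfold backup
  split_ifs
  · exact ⟨hV, le_rfl⟩
  · refine ⟨le_min (add_nonneg (le_max_right _ _) ?_) hV, min_le_right _ _⟩
    exact div_nonneg hc (Nat.cast_nonneg _)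

theorem backup_le_vEst (n : ℕ) (s : S) (a : A) :
    X.backup M.H V c (fun _ => ⊤) k ω (X.vEst M.H V c (fun _ => ⊤) k ω n) s a
      ≤ X.vEst M.H V c (fun _ => ⊤) k ω (n + 1) s :=
  le_ciSup (f := fun a => X.backup M.H V c (fun _ => ⊤) k ω (X.vEst M.H V c (fun _ => ⊤) k ω n) s a)
    (Set.finite_range _).bddAbove a

theorem vEst_mem [Nonempty A] (hV : 0 ≤ V) (hc : 0 ≤ c k) (n : ℕ) (s : S) :
    0 ≤ X.vEst M.H V c (fun _ => ⊤) k ω n s ∧ X.vEst M.H V c (fun _ => ⊤) k ω n s ≤ V := by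
  cases n with
  | zero => simp [vEst, hV]
  | succ n =>
    exact ⟨(backup_mem hV hc _ s (Classical.arbitrary A)).1.trans (backup_le_vEst n s _),
      ciSup_le fun a => (backup_mem hV hc _ s a).2⟩

theorem FollowsEQO.vEst_succ [Nonempty A] [MeasurableSpace A]
    (hE : X.FollowsEQO M.H V c (fun _ => ⊤)) (hk : 1 ≤ k) {n : ℕ} (hn : n < M.H) (s : S) :
    X.vEst M.H V c (fun _ => ⊤) k ω (n + 1) s =
      X.backup M.H V c (fun _ => ⊤) k ω (X.vEst M.H V c (fun _ => ⊤) k ω n) s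
        (X.policy k ω (M.H - n) s) := by
  obtain ⟨⟨sel, hsel, hpol⟩, -⟩ := hE
  refine le_antisymm (ciSup_le fun a => ?_) (backup_le_vEst n s _)
  have e : M.H - (M.H - n) = n := by omega
  have h1 := (hsel k (M.H - n) s).2 (X.qEst M.H V c (fun _ => ⊤) k ω (M.H - n) s) a
  rw [← hpol k ω (M.H - n) s hk (by omega) (by omega)] at h1
  simpa only [qEst, e] using h1

end Backup

section Analysis

variable {X : Run S A Ω} {M : MDP S A} {σ : ℕ → S → A → ℝ} {V : ℝ} {c : ℕ → ℝ} {k : ℕ} {ω : Ω}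
  {lam L L' : ℝ} {G : ℕ} [Nonempty A]

/-- The estimated values are optimistic up to the deficit. -/
theorem Concentrated.quasi_optimism (hC : X.Concentrated M σ V k ω lam L L' G) (hV : 0 < V)
    (hM : M.ValuesIn V)
    (hW : ∀ (π : ℕ → S → A) (h : ℕ) (s : S), 1 ≤ h → h ≤ M.H → M.W σ π h s ≤ 2 * V ^ 2)
    (hlam : 0 < lam) (hL : 0 ≤ L) (hsmall : lam * V ≤ 1 / 10) (hck : 9 / 8 * (L / lam) ≤ c k)
    {n : ℕ} (hn : n ≤ M.H) (s : S) :
    M.optGo (fun _ => M.r) n s - 2 * V ^ 2 * lam * M.deficit σ V n s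
      ≤ X.vEst M.H V c (fun _ => ⊤) k ω n s := by
  set m := 2 * V ^ 2 * lam with hm
  have hm0 : 0 ≤ m := by positivity
  induction n generalizing s with
  | zero => simp [MDP.optGo, vEst, MDP.deficit, MDP.wBar]
  | succ n ih =>
    have hn' : n < M.H := hn
    rw [sub_le_iff_le_add]
    refine ciSup_le fun a => ?_
    rw [← sub_le_iff_le_add]
    refine le_trans ?_ (backup_le_vEst n s a)
    -- Truncating the estimates at `V` cannot destroy optimism, since the optimal action values stay
    -- below `V`.
    have hQ : M.r s a + ∑ s', M.P s a s' * M.optGo (fun _ => M.r) n s' ≤ V :=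
      (M.le_optGo_succ (fun _ => M.r) n s a).trans (hM.optGo_mem hV.le hn s).2
    have hd := (MDP.deficit_mem hV hW hn s).1
    have hmd : 0 ≤ m * M.deficit σ V (n + 1) s := mul_nonneg hm0 hd
    unfold backup
    split_ifs with hN
    · linarith
    · refine le_min ?_ (by linarith)
      have hNpos : (0 : ℝ) < X.count M.H k ω s a := by exact_mod_cast Nat.pos_of_ne_zero hN
      set N : ℝ := ((X.count M.H k ω s a : ℕ) : ℝ) with hNdef
      refine le_trans ?_ (add_le_add_left (le_max_left _ _) _)
      change _ ≤ _ + c k / N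
      have h1 : ∑ s', X.pHat M.H k ω s a s' * (M.optGo (fun _ => M.r) n s'
          - m * M.deficit σ V n s') ≤ ∑ s', X.pHat M.H k ω s a s' *
            X.vEst M.H V c (fun _ => ⊤) k ω n s' :=
        sum_mul_mono (X.pHat_nonneg _ _ _ _ _) fun s' => ih hn'.le s'
      have e1 : ∑ s', X.pHat M.H k ω s a s' * (M.optGo (fun _ => M.r) n s'
          - m * M.deficit σ V n s') = ∑ s', X.pHat M.H k ω s a s' * M.optGo (fun _ => M.r) n s'
          - m * ∑ s', X.pHat M.H k ω s a s' * M.deficit σ V n s' := by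
        rw [Finset.mul_sum, ← Finset.sum_sub_distrib]
        exact Finset.sum_congr rfl fun s' _ => by ring
      rw [e1] at h1
      have h2 := hC.lower n hn' s a hN
      have h3 := mul_le_mul_of_nonneg_left (hC.deficit n hn' s a hN) hm0
      have h4 := mul_le_mul_of_nonneg_left (MDP.deficit_succ_ge hV hW hn' s a) hm0
      -- The scale 2V²λ is chosen so that the growth of the deficit cancels the part of the error
      -- that does not decay with the count.
      have h5 : m * (σ (M.H - n) s a ^ 2 / (4 * V ^ 2)) = lam * σ (M.H - n) s a ^ 2 / 2 := by
        rw [hm]; field_simp; ring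
      -- The bonus pays for both errors of order 1/N. Their sum is (1 + 12(λV)²)·L/(λN), and λV ≤
      -- 1/10 gives 1 + 12/100 ≤ 9/8.
      have h6 : L / lam / N + m * (6 * L / N) ≤ c k / N := by
        have : L / lam / N + m * (6 * L / N) = (L / lam + m * (6 * L)) / N := by ring
        rw [this]
        refine div_le_div_of_nonneg_right (le_trans ?_ hck) hNpos.le
        have h7 : m * (6 * L) = 12 * (lam * V) ^ 2 * (L / lam) := by
          rw [hm]; field_simp; ring
        have h8 : (lam * V) ^ 2 ≤ 1 / 100 := by
          have : 0 ≤ lam * V := by positivity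
          nlinarith
        have h9 : 0 ≤ L / lam := by positivity
        rw [h7]
        nlinarith
      rw [← hNdef] at h2 h3
      rw [mul_add, mul_add] at h3 h4
      linarith

/-- The per-visit cost: `β / N` at visited pairs and `V` elsewhere. -/
def visitCost (X : Run S A Ω) (H : ℕ) (V β : ℝ) (k : ℕ) (ω : Ω) (s : S) (a : A) : ℝ :=
  if X.count H k ω s a = 0 then V else β / X.count H k ω s a

omit [Fintype S] [Fintype A] [Nonempty A] in
theorem visitCost_nonneg {X : Run S A Ω} {H : ℕ} {V β : ℝ} (hV : 0 ≤ V) (hβ : 0 ≤ β) (k : ℕ) (ω : Ω)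
    (s : S) (a : A) : 0 ≤ X.visitCost H V β k ω s a := by
  unfold visitCost
  split_ifs <;> positivity

/-- The estimated values exceed a Bellman backup by a small error along the greedy policy. -/
theorem Concentrated.estimate_gap (hC : X.Concentrated M σ V k ω lam L L' G) (hV : 0 < V)
    (hM : M.ValuesIn V) (hck0 : 0 ≤ c k) (hL' : 1 ≤ L') {T cmax β : ℝ}
    (hNT : ∀ s a, (X.count M.H k ω s a : ℝ) ≤ T) (hG : 2 * T ≤ (3 / 2 : ℝ) ^ G)
    (hlam : 0 < lam) (hL : 0 ≤ L)
    (hck : 9 / 8 * (L / lam) ≤ c k) (hcm : c k ≤ cmax)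
    (hβ : β = 2 * cmax + 9 * Fintype.card S * L' * V)
    {n : ℕ} (hn : n < M.H) (s : S) (a : A) (hN : X.count M.H k ω s a ≠ 0)
    (hD : ∀ s', |(X.vEst M.H V c (fun _ => ⊤) k ω n s' - M.optGo (fun _ => M.r) n s')
      - ∑ x, M.P s a x * (X.vEst M.H V c (fun _ => ⊤) k ω n x - M.optGo (fun _ => M.r) n x)|
        ≤ 7 / 5 * V) :
    X.backup M.H V c (fun _ => ⊤) k ω (X.vEst M.H V c (fun _ => ⊤) k ω n) s a
      - (M.r s a + ∑ s', M.P s a s' * X.vEst M.H V c (fun _ => ⊤) k ω n s') ≤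
      β / X.count M.H k ω s a + lam * σ (M.H - n) s a ^ 2 / 2 + 1 / (9 * V) * pvar (M.P s a)
        (fun s' => X.vEst M.H V c (fun _ => ⊤) k ω n s' - M.optGo (fun _ => M.r) n s') := by
  have hN1 : (1 : ℝ) ≤ X.count M.H k ω s a := by exact_mod_cast Nat.pos_of_ne_zero hN
  -- Only the random difference between estimated and optimal values is treated coordinatewise; the
  -- optimal values are covered by the field `upper`, without a factor `|S|`.
  have htr := sum_sub_mul_le (M.P_nonneg s a) (M.P_sum s a) (X.pHat_nonneg M.H k ω s a)
    (X.sum_pHat M.H hN) hV hN1 (hNT s a) hL' hG (hC.transition s a hN) hD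
  have hup := hC.upper n hn s a hN
  have hpv := pvar_nonneg (M.P_nonneg s a) (M.P_sum s a)
    (fun s' => X.vEst M.H V c (fun _ => ⊤) k ω n s' - M.optGo (fun _ => M.r) n s')
  have hv0 : ∀ s', 0 ≤ X.vEst M.H V c (fun _ => ⊤) k ω n s' := fun s' => (vEst_mem hV.le hck0 n s').1
  set v := X.vEst M.H V c (fun _ => ⊤) k ω n with hv
  set N : ℝ := ((X.count M.H k ω s a : ℕ) : ℝ) with hNdef
  have hNpos : 0 < N := by linarith
  have hLl : 0 ≤ L / lam := by positivity
  -- One `cmax` is for the bonus itself, the other for the term L/λ, which the bonus dominates.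
  have hβN : β / N = cmax / N + cmax / N + 9 * Fintype.card S * L' * V / N := by rw [hβ]; ring
  have hc1 : c k / N ≤ cmax / N := by gcongr
  have hc2 : L / lam / N ≤ cmax / N := by gcongr; linarith
  have hc3 : 0 ≤ L / lam / N := by positivity
  have hS0 : 0 ≤ 9 * Fintype.card S * L' * V / N := by positivity
  have hσ0 : 0 ≤ lam * σ (M.H - n) s a ^ 2 / 2 := by positivity
  have hV9 : 0 ≤ 1 / (9 * V) * pvar (M.P s a) (fun s' => v s' - M.optGo (fun _ => M.r) n s') :=
    mul_nonneg (by positivity) hpv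
  have hb : X.backup M.H V c (fun _ => ⊤) k ω v s a ≤
      max (X.rHat M.H k ω s a + ∑ s', X.pHat M.H k ω s a s' * v s') 0 + c k / N := by
    unfold backup
    rw [if_neg hN]
    exact min_le_left _ _
  -- If the estimate is clipped at 0, only the bonus is left, and the true backup is nonnegative.
  rcases le_total (X.rHat M.H k ω s a + ∑ s', X.pHat M.H k ω s a s' * v s') 0 with h | h
  · rw [max_eq_right h] at hb
    have h1 : 0 ≤ M.r s a + ∑ s', M.P s a s' * v s' := add_nonneg (hM.r_nonneg s a)
      (Finset.sum_nonneg fun s' _ => mul_nonneg (M.P_nonneg _ _ _) (hv0 s'))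
    linarith
  · rw [max_eq_left h] at hb
    simp only [mul_sub, Finset.sum_sub_distrib] at htr
    linarith

/-- The regret of one episode under concentrated estimates. -/
theorem Concentrated.episode_regret [MeasurableSpace A]
    (hC : X.Concentrated M σ V k ω lam L L' G) (hE : X.FollowsEQO M.H V c (fun _ => ⊤)) (hk : 1 ≤ k)
    (hV : 0 < V) (hM : M.ValuesIn V)
    (hW : ∀ (π : ℕ → S → A) (h : ℕ) (s : S), 1 ≤ h → h ≤ M.H → M.W σ π h s ≤ 2 * V ^ 2)
    (hL' : 1 ≤ L') {T cmax β : ℝ}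
    (hNT : ∀ s a, (X.count M.H k ω s a : ℝ) ≤ T) (hG : 2 * T ≤ (3 / 2 : ℝ) ^ G)
    (hlam : 0 < lam) (hL : 0 ≤ L) (hsmall : lam * V ≤ 1 / 10)
    (hck : 9 / 8 * (L / lam) ≤ c k) (hcm : c k ≤ cmax)
    (hβ : β = 2 * cmax + 9 * Fintype.card S * L' * V) (s : S) :
    M.optGo (fun _ => M.r) M.H s - M.toGo (fun _ => M.r) (X.policy k ω) M.H s ≤
      10 * V ^ 2 * lam
        + 3 / 2 * M.cappedGo V (X.visitCost M.H V β k ω) (X.policy k ω) M.H s := by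
  have hLl : 0 ≤ L / lam := by positivity
  have hck0 : 0 ≤ c k := by linarith
  have hβ0 : 0 ≤ β := by rw [hβ]; have : 0 ≤ cmax := hck0.trans hcm; positivity
  set v := X.vEst M.H V c (fun _ => ⊤) k ω with hv
  set o := M.optGo (fun _ => M.r) with ho
  set π := X.policy k ω with hπ
  -- The largest possible optimism deficit, since `M.deficit` is at most 2. Adding it makes the gap
  -- nonnegative, as a squared potential requires, and λV ≤ 1/10 keeps the shifted gap below 7/5·V.
  set m := 4 * V ^ 2 * lam with hm
  have hm0 : 0 ≤ m := by positivity
  have hmV : m ≤ 2 / 5 * V := by rw [hm]; nlinarith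
  have hvm : ∀ n s, 0 ≤ v n s ∧ v n s ≤ V := fun n s => vEst_mem hV.le hck0 n s
  have hom : ∀ n ≤ M.H, ∀ s, 0 ≤ o n s ∧ o n s ≤ V := fun n hn s => hM.optGo_mem hV.le hn s
  have hopt : ∀ n ≤ M.H, ∀ s, o n s - m ≤ v n s := fun n hn s => by
    refine le_trans ?_ (hC.quasi_optimism (c := c) hV hM hW hlam hL hsmall hck hn s)
    have h1 := (MDP.deficit_mem hV hW hn s).2
    have h2 : 0 ≤ 2 * V ^ 2 * lam := by positivity
    rw [hm]; nlinarith
  set E : ℕ → S → ℝ := fun n s => v n s - o n s + m with hEdef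
  have hE0 : ∀ n ≤ M.H, ∀ s, 0 ≤ E n s := fun n hn s => by
    have := hopt n hn s; simp only [hEdef]; linarith
  have hE1 : ∀ n ≤ M.H, ∀ s, E n s ≤ 7 / 5 * V := fun n hn s => by
    have h1 := (hvm n s).2; have h2 := (hom n hn s).1; simp only [hEdef]; linarith
  have hW0 : ∀ n ≤ M.H, ∀ s, 0 ≤ M.toGo (fun j x a => (1 / 2) * σ j x a ^ 2) π n s := by
    intro n
    induction n with
    | zero => intro _ s; simp [MDP.toGo]
    | succ n ih =>
      intro hn s
      simp only [MDP.toGo]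
      exact add_nonneg (by positivity)
        (Finset.sum_nonneg fun s' _ => mul_nonneg (M.P_nonneg _ _ _) (ih (by omega) s'))
  -- The shifted gap equals `m` when no steps remain; subtracting m² makes the potential vanish
  -- there.
  have key : ∀ n ≤ M.H, ∀ s, 2 / 3 * (v n s - M.toGo (fun _ => M.r) π n s)
      + 1 / (9 * V) * (E n s ^ 2 - m ^ 2) - lam * M.toGo (fun j x a => (1 / 2) * σ j x a ^ 2) π n s
      ≤ M.cappedGo V (X.visitCost M.H V β k ω) π n s := by
    intro n
    induction n with
    | zero => intro _ s; simp [MDP.toGo, MDP.cappedGo, hEdef, hv, ho, vEst, MDP.optGo]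
    | succ n ih =>
      intro hn s
      have hn' : n < M.H := hn
      -- The recursion is truncated at `V`, so the left side must not exceed it: 2/3·V from the
      -- values and at most V/3 from the potential. This alone settles unvisited pairs.
      have hVb : 2 / 3 * (v (n + 1) s - M.toGo (fun _ => M.r) π (n + 1) s)
          + 1 / (9 * V) * (E (n + 1) s ^ 2 - m ^ 2)
          - lam * M.toGo (fun j x a => (1 / 2) * σ j x a ^ 2) π (n + 1) s ≤ V := by
        have h1 := (hvm (n + 1) s).2
        have h2 := (hM.toGo_mem hV.le π hn s).1
        have h3 := mul_nonneg hlam.le (hW0 (n + 1) hn s)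
        have h4 : 1 / (9 * V) * (E (n + 1) s ^ 2 - m ^ 2) ≤ 1 / (9 * V) * (3 * V * V) := by
          refine mul_le_mul_of_nonneg_left ?_ (by positivity)
          have := hE1 (n + 1) hn s
          have := hE0 (n + 1) hn s
          nlinarith [sq_nonneg m]
        have h5 : 1 / (9 * V) * (3 * V * V) = V / 3 := by field_simp; norm_num
        linarith
      simp only [MDP.cappedGo]
      refine le_min hVb ?_
      set a := π (M.H - n) s with ha
      have hU0 : 0 ≤ ∑ s', M.P s a s' * M.cappedGo V (X.visitCost M.H V β k ω) π n s' :=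
        Finset.sum_nonneg fun s' _ => mul_nonneg (M.P_nonneg _ _ _)
          (M.cappedGo_mem hV.le (visitCost_nonneg hV.le hβ0 k ω) π n s').1
      by_cases hN : X.count M.H k ω s a = 0
      · rw [visitCost, if_pos hN]
        linarith
      · rw [visitCost, if_neg hN]
        have hNpos : (0 : ℝ) < X.count M.H k ω s a := by exact_mod_cast Nat.pos_of_ne_zero hN
        have hp := M.P_nonneg s a
        have hp1 := M.P_sum s a
        have hvs : v (n + 1) s = X.backup M.H V c (fun _ => ⊤) k ω (v n) s a :=
          hE.vEst_succ hk hn' s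
        set Δ := v (n + 1) s - (M.r s a + ∑ s', M.P s a s' * v n s') with hΔ
        have hsE : ∑ s', M.P s a s' * E n s'
            = ∑ s', M.P s a s' * v n s' - ∑ s', M.P s a s' * o n s' + m := by
          simp only [hEdef, mul_add, mul_sub, Finset.sum_add_distrib, Finset.sum_sub_distrib,
            ← Finset.sum_mul, hp1, one_mul]
        have hgap := hC.estimate_gap (c := c) hV hM hck0 hL' hNT hG hlam hL hck hcm hβ hn' s a hN
          (fun s' => by
            have e1 : ∑ x, M.P s a x * (v n x - o n x) = ∑ x, M.P s a x * E n x - m := by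
              rw [hsE]; simp only [mul_sub, Finset.sum_sub_distrib]; ring
            change |(v n s' - o n s') - ∑ x, M.P s a x * (v n x - o n x)| ≤ _
            rw [e1]
            have h1 := le_sum_mul_of_le hp hp1 (hE0 n hn'.le)
            have h2 := sum_mul_le_of_le hp hp1 (hE1 n hn'.le)
            have h3 := hE0 n hn'.le s'
            have h4 := hE1 n hn'.le s'
            simp only [hEdef] at h3 h4 h1 h2 ⊢
            rw [abs_le]; constructor <;> linarith)
        rw [← hvs] at hgap
        have hpe : pvar (M.P s a) (E n) = pvar (M.P s a) (fun s' => v n s' - o n s') :=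
          pvar_add_const hp1 (fun s' => v n s' - o n s') m
        have hos : M.r s a + ∑ s', M.P s a s' * o n s' ≤ o (n + 1) s :=
          M.le_optGo_succ (fun _ => M.r) n s a
        have hpot := potential_step hp hp1 hV (hE0 n hn'.le) (hE1 n hn'.le) (hE0 (n + 1) hn s)
          (hE1 (n + 1) hn s) (Δ := Δ) (b := β / X.count M.H k ω s a)
          (x := lam * σ (M.H - n) s a ^ 2 / 2) (by positivity) (by positivity)
          (by rw [hsE, hΔ]; simp only [hEdef]; linarith)
          (by rw [hpe]; exact hgap)
        have hih : ∑ s', M.P s a s' * (2 / 3 * (v n s' - M.toGo (fun _ => M.r) π n s')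
            + 1 / (9 * V) * (E n s' ^ 2 - m ^ 2)
            - lam * M.toGo (fun j x a => (1 / 2) * σ j x a ^ 2) π n s')
            ≤ ∑ s', M.P s a s' * M.cappedGo V (X.visitCost M.H V β k ω) π n s' :=
          sum_mul_mono hp fun s' => ih hn'.le s'
        have e2 : ∑ s', M.P s a s' * (2 / 3 * (v n s' - M.toGo (fun _ => M.r) π n s')
            + 1 / (9 * V) * (E n s' ^ 2 - m ^ 2)
            - lam * M.toGo (fun j x a => (1 / 2) * σ j x a ^ 2) π n s')
            = 2 / 3 * (∑ s', M.P s a s' * v n s'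
                - ∑ s', M.P s a s' * M.toGo (fun _ => M.r) π n s')
              + 1 / (9 * V) * (∑ s', M.P s a s' * E n s' ^ 2 - m ^ 2)
              - lam * ∑ s', M.P s a s' * M.toGo (fun j x a => (1 / 2) * σ j x a ^ 2) π n s' := by
          have : ∀ s', M.P s a s' * (2 / 3 * (v n s' - M.toGo (fun _ => M.r) π n s')
            + 1 / (9 * V) * (E n s' ^ 2 - m ^ 2)
            - lam * M.toGo (fun j x a => (1 / 2) * σ j x a ^ 2) π n s')
            = 2 / 3 * (M.P s a s' * v n s') - 2 / 3 * (M.P s a s' * M.toGo (fun _ => M.r) π n s')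
              + 1 / (9 * V) * (M.P s a s' * E n s' ^ 2) - 1 / (9 * V) * m ^ 2 * M.P s a s'
              - lam * (M.P s a s' * M.toGo (fun j x a => (1 / 2) * σ j x a ^ 2) π n s') := by
            intro s'; ring
          simp only [this, Finset.sum_add_distrib, Finset.sum_sub_distrib, ← Finset.mul_sum, hp1]
          ring
        rw [e2] at hih
        simp only [MDP.toGo]
        rw [← ha]
        rw [hΔ] at hpot
        linarith
  -- In units of V²λ, the shift costs 4, the variance proxy 2 and the initial potential 8/45, and 4
  -- + 3/2·(2 + 8/45) < 10.
  have hfin := key M.H le_rfl s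
  have hWs : M.toGo (fun j x a => (1 / 2) * σ j x a ^ 2) π M.H s ≤ 2 * V ^ 2 := by
    have := hW π 1 s le_rfl M.H_pos
    simpa [MDP.W, MDP.expSum] using this
  have h1 := hopt M.H le_rfl s
  have h2 : lam * M.toGo (fun j x a => (1 / 2) * σ j x a ^ 2) π M.H s ≤ lam * (2 * V ^ 2) :=
    mul_le_mul_of_nonneg_left hWs hlam.le
  have h3 : -(1 / (9 * V) * m ^ 2) ≤ 1 / (9 * V) * (E M.H s ^ 2 - m ^ 2) := by
    rw [mul_sub]
    have : 0 ≤ 1 / (9 * V) * E M.H s ^ 2 := by positivity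
    linarith
  have h4 : 1 / (9 * V) * m ^ 2 ≤ 8 / 45 * (V ^ 2 * lam) := by
    have e : 1 / (9 * V) * m ^ 2 = 16 / 9 * (V ^ 2 * lam) * (lam * V) := by
      rw [hm]; field_simp; norm_num
    rw [e]
    have : 0 ≤ V ^ 2 * lam := by positivity
    nlinarith
  have h5 : 0 ≤ V ^ 2 * lam := by positivity
  have hmm : m = 4 * (V ^ 2 * lam) := by rw [hm]; ring
  rw [hmm] at h1
  linarith

end Analysis

end Run
end EQOPlus
end

/-! ### The concentration event. -/

noncomputable section
namespace EQOPlus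
namespace Run

open scoped ENNReal

section VisitSums

variable {S A Ω : Type*} [Fintype S] [DecidableEq S] [DecidableEq A] {X : Run S A Ω} {H k : ℕ} {ω : Ω}
  {s : S} {a : A}

theorem sum_visits_reward (hN : X.count H k ω s a ≠ 0) (f : S → ℝ) (t q x : ℝ) :
    ∑ i ∈ Finset.Ico 1 k, ∑ h ∈ Finset.Icc 1 H, (if X.state i h ω = s ∧ X.action i h ω = a then
      t * (X.reward i h ω + f (X.state i (h + 1) ω) - q) - x else 0) =
    X.count H k ω s a * (t * (X.rHat H k ω s a + ∑ s', X.pHat H k ω s a s' * f s' - q) - x) := by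
  have e : ∀ i h, (if X.state i h ω = s ∧ X.action i h ω = a then
      t * (X.reward i h ω + f (X.state i (h + 1) ω) - q) - x else 0)
      = t * (if X.state i h ω = s ∧ X.action i h ω = a then X.reward i h ω else 0)
        + t * (if X.state i h ω = s ∧ X.action i h ω = a then f (X.state i (h + 1) ω) else 0)
        + (if X.state i h ω = s ∧ X.action i h ω = a then -t * q - x else 0) := by
    intro i h; split_ifs <;> ring
  simp only [e, Finset.sum_add_distrib, ← Finset.mul_sum]
  rw [← X.count_mul_rHat H hN, ← X.count_mul_sum_pHat H hN, ← X.count_mul_eq_sum H]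
  ring

theorem sum_visits_next (hN : X.count H k ω s a ≠ 0) (g : S → ℝ) (t q x : ℝ) :
    ∑ i ∈ Finset.Ico 1 k, ∑ h ∈ Finset.Icc 1 H, (if X.state i h ω = s ∧ X.action i h ω = a then
      t * (g (X.state i (h + 1) ω) - q) - x else 0) =
    X.count H k ω s a * (t * (∑ s', X.pHat H k ω s a s' * g s' - q) - x) := by
  have e : ∀ i h, (if X.state i h ω = s ∧ X.action i h ω = a then
      t * (g (X.state i (h + 1) ω) - q) - x else 0)
      = t * (if X.state i h ω = s ∧ X.action i h ω = a then g (X.state i (h + 1) ω) else 0)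
        + (if X.state i h ω = s ∧ X.action i h ω = a then -t * q - x else 0) := by
    intro i h; split_ifs <;> ring
  simp only [e, Finset.sum_add_distrib, ← Finset.mul_sum]
  rw [← X.count_mul_sum_pHat H hN, ← X.count_mul_eq_sum H]
  ring

end VisitSums

theorem le_div_add_of_mul_le {N t y x L : ℝ} (hN : 0 < N) (ht : 0 < t)
    (h : N * (t * y - t * x) ≤ L) : y ≤ L / t / N + x := by
  rw [div_div, ← sub_le_iff_le_add, le_div_iff₀ (by positivity)]
  linarith

variable {S A Ω : Type*} [Fintype S] [DecidableEq S] [MeasurableSpace S] [DiscreteMeasurableSpace S]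
  [Fintype A] [DecidableEq A] [MeasurableSpace A] [DiscreteMeasurableSpace A] [Nonempty A]
  {mΩ : MeasurableSpace Ω} {μ : Measure Ω} [IsProbabilityMeasure μ] {X : Run S A Ω} {M : MDP S A}

/-- All tails used are uniform over episodes, so the union runs only over rates, steps, pairs and
next states. Each rate needs three tails per step and pair, two for rewards and one for the deficit.
The transition tails do not depend on the rate in `J`. Separate levels `L j` allow the rates to be
weighted. -/
theorem measure_not_concentrated_le (hX : X.InEnvironment M μ) {σ : ℕ → S → A → ℝ} {V Vα : ℝ}
    (hV : 0 < V) (hα : Vα ≤ 2 * V)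
    (hW : ∀ (π : ℕ → S → A) (h : ℕ) (s : S), 1 ≤ h → h ≤ M.H → M.W σ π h s ≤ 2 * V ^ 2)
    (hsub : ∀ k j h, 1 ≤ k → 1 ≤ j → j ≤ M.H → 1 ≤ h → h ≤ M.H →
      CondSubExp (X.history M.H k j) μ
        (fun ω => X.reward k j ω + M.Vstar (h + 1) (X.state k (j + 1) ω)
          - M.Qstar h (X.state k j ω) (X.action k j ω))
        (fun ω => σ h (X.state k j ω) (X.action k j ω)) Vα)
    (J : Finset ℕ) (lam L : ℕ → ℝ) (hlam : ∀ j ∈ J, 0 < lam j) (hsmall : ∀ j ∈ J, lam j * V ≤ 1 / 10)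
    (L' : ℝ) (G K : ℕ) :
    μ {ω | ∃ k, 1 ≤ k ∧ k ≤ K + 1 ∧ ∃ j ∈ J, ¬ X.Concentrated M σ V k ω (lam j) (L j) L' G} ≤
      ENNReal.ofReal (3 * (M.H * Fintype.card S * Fintype.card A) * ∑ j ∈ J, Real.exp (-L j)
        + 2 * (Fintype.card S ^ 2 * Fintype.card A) * (G + 1) * Real.exp (-L')) := by
  classical
  set f : ℕ → S → ℝ := fun n => M.optGo (fun _ => M.r) n with hf
  set q : ℕ → S → A → ℝ := fun n s a => M.r s a + ∑ s', M.P s a s' * f n s' with hq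
  set R : ℕ → ℕ → S → A → ℝ → Set Ω := fun j n s a t => {ω | ∃ k ≤ K, L j <
    ∑ i ∈ Finset.Ico 1 (k + 1), ∑ h ∈ Finset.Icc 1 M.H,
      if X.state i h ω = s ∧ X.action i h ω = a then
        t * (X.reward i h ω + f n (X.state i (h + 1) ω) - q n s a)
          - σ (M.H - n) s a ^ 2 * t ^ 2 / 2 else 0} with hR
  set B : (S → ℝ) → S → A → ℝ → ℝ → Set Ω := fun g s a t ℓ => {ω | ∃ k ≤ K, ℓ <
    ∑ i ∈ Finset.Ico 1 (k + 1), ∑ h ∈ Finset.Icc 1 M.H,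
      if X.state i h ω = s ∧ X.action i h ω = a then
        t * (g (X.state i (h + 1) ω) - ∑ x, M.P s a x * g x)
          - 3 / 5 * t ^ 2 * pvar (M.P s a) g else 0} with hB
  have hRm : ∀ j, ∀ n < M.H, ∀ s a t, |t| * Vα ≤ 1 →
      μ (R j n s a t) ≤ ENNReal.ofReal (Real.exp (-L j)) := by
    intro j n hn s a t ht
    refine hX.subExp_tail (f := f n) (q := q n) (σ := σ (M.H - n)) (α := Vα) ?_ s a ht K (L j)
    intro k i hk hi hiH
    have h1 := hsub k i (M.H - n) hk hi hiH (by omega) (by omega)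
    have e1 : M.Vstar (M.H - n + 1) = f n := by
      funext x
      rw [M.Vstar_eq_optGo (by omega), show M.H + 1 - (M.H - n + 1) = n by omega]
    have e2 : M.Qstar (M.H - n) = q n := by
      funext x b
      rw [M.Qstar_eq_optGo, show M.H - (M.H - n) = n by omega]
    rwa [e1, e2] at h1
  -- The deficit ranges over [0, 2], so 1/6 is the largest rate for which Bernstein's bound applies
  -- to it in general; it is the source of the factor 6 in the field `deficit`.
  have hg1 : ∀ n < M.H, ∀ s a s', |1 / 6 * (M.deficit σ V n s' -
      ∑ x, M.P s a x * M.deficit σ V n x)| ≤ 1 / 3 := by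
    intro n hn s a s'
    have h1 := MDP.deficit_mem hV hW hn.le s'
    have h2 := le_sum_mul_of_le (M.P_nonneg s a) (M.P_sum s a)
      fun x => (MDP.deficit_mem hV hW hn.le x).1
    have h3 := sum_mul_le_of_le (M.P_nonneg s a) (M.P_sum s a)
      fun x => (MDP.deficit_mem hV hW hn.le x).2
    rw [abs_le]; constructor <;> linarith
  set one : S → S → ℝ := fun s' x => if x = s' then 1 else 0 with hone
  have hPone : ∀ s a s', ∑ x, M.P s a x * one s' x = M.P s a s' := by
    intro s a s'; simp [hone]
  have hPle : ∀ s a s', M.P s a s' ≤ 1 := fun s a s' =>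
    M.P_sum s a ▸ Finset.single_le_sum (fun x _ => M.P_nonneg s a x) (Finset.mem_univ s')
  have hg2 : ∀ s a s' t, |t| ≤ 3 / 10 →
      ∀ y, |t * (one s' y - ∑ x, M.P s a x * one s' x)| ≤ 1 / 3 := by
    intro s a s' t ht y
    rw [hPone, abs_mul]
    have h1 : |one s' y - M.P s a s'| ≤ 1 := by
      have := hPle s a s'
      have := M.P_nonneg s a s'
      simp only [hone]
      split_ifs <;> rw [abs_le] <;> constructor <;> linarith
    nlinarith [abs_nonneg t, abs_nonneg (one s' y - M.P s a s')]
  set U1 : Set Ω := ⋃ j ∈ J, ⋃ n ∈ Finset.range M.H, ⋃ s : S, ⋃ a : A,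
    (R j n s a (-lam j) ∪ R j n s a (lam j) ∪ B (M.deficit σ V n) s a (1 / 6) (L j)) with hU1
  set U2 : Set Ω := ⋃ s : S, ⋃ a : A, ⋃ s' : S, ⋃ i ∈ Finset.range (G + 1),
    (B (one s') s a (-rate i) L' ∪ B (one s') s a (rate i) L') with hU2
  have hm1 : μ U1 ≤ ENNReal.ofReal (3 * (M.H * Fintype.card S * Fintype.card A)
      * ∑ j ∈ J, Real.exp (-L j)) := by
    calc μ U1 ≤ ∑ j ∈ J, ∑ n ∈ Finset.range M.H, ∑ s : S, ∑ a : A,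
          ENNReal.ofReal (3 * Real.exp (-L j)) := by
          refine (measure_biUnion_finset_le _ _).trans (Finset.sum_le_sum fun j hj => ?_)
          refine (measure_biUnion_finset_le _ _).trans (Finset.sum_le_sum fun n hn => ?_)
          refine (measure_iUnion_fintype_le _ _).trans (Finset.sum_le_sum fun s _ => ?_)
          refine (measure_iUnion_fintype_le _ _).trans (Finset.sum_le_sum fun a _ => ?_)
          rw [Finset.mem_range] at hn
          -- Here λV ≤ 1/10 and `Vα ≤ 2 * V` give even 1/5.
          have ht : |lam j| * Vα ≤ 1 := by
            rw [abs_of_pos (hlam j hj)]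
            have := hsmall j hj
            nlinarith [mul_le_mul_of_nonneg_left hα (hlam j hj).le]
          refine (measure_union_le _ _).trans ?_
          refine (add_le_add (measure_union_le _ _) le_rfl).trans ?_
          refine (add_le_add (add_le_add (hRm j n hn s a (-lam j) (by rwa [abs_neg]))
            (hRm j n hn s a (lam j) ht)) (hX.bounded_tail _ s a (hg1 n hn s a) K (L j))).trans ?_
          have h0 := (Real.exp_pos (-L j)).le
          rw [← ENNReal.ofReal_add h0 h0, ← ENNReal.ofReal_add (by linarith) h0]
          exact ENNReal.ofReal_le_ofReal (by linarith)
      _ = _ := by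
          simp only [Finset.sum_const, Finset.card_univ, Finset.card_range, nsmul_eq_mul]
          rw [Finset.mul_sum, ENNReal.ofReal_sum_of_nonneg fun j _ => by positivity]
          refine Finset.sum_congr rfl fun j _ => ?_
          rw [← ENNReal.ofReal_natCast, ← ENNReal.ofReal_natCast, ← ENNReal.ofReal_natCast,
            ← ENNReal.ofReal_mul (by positivity), ← ENNReal.ofReal_mul (by positivity),
            ← ENNReal.ofReal_mul (by positivity)]
          congr 1; ring
  have hm2 : μ U2 ≤ ENNReal.ofReal (2 * (Fintype.card S ^ 2 * Fintype.card A) * (G + 1)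
      * Real.exp (-L')) := by
    calc μ U2 ≤ ∑ s : S, ∑ a : A, ∑ s' : S, ∑ i ∈ Finset.range (G + 1),
          ENNReal.ofReal (2 * Real.exp (-L')) := by
          refine (measure_iUnion_fintype_le _ _).trans (Finset.sum_le_sum fun s _ => ?_)
          refine (measure_iUnion_fintype_le _ _).trans (Finset.sum_le_sum fun a _ => ?_)
          refine (measure_iUnion_fintype_le _ _).trans (Finset.sum_le_sum fun s' _ => ?_)
          refine (measure_biUnion_finset_le _ _).trans (Finset.sum_le_sum fun i _ => ?_)
          have ht : |rate i| ≤ 3 / 10 := by rw [abs_of_pos (rate_pos i)]; exact rate_le i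
          refine (measure_union_le _ _).trans ?_
          refine (add_le_add (hX.bounded_tail _ s a (hg2 s a s' _ (by rwa [abs_neg])) K L')
            (hX.bounded_tail _ s a (hg2 s a s' _ ht) K L')).trans ?_
          have h0 := (Real.exp_pos (-L')).le
          rw [← ENNReal.ofReal_add h0 h0]
          exact ENNReal.ofReal_le_ofReal (by linarith)
      _ = _ := by
          simp only [Finset.sum_const, Finset.card_univ, Finset.card_range, nsmul_eq_mul]
          rw [← ENNReal.ofReal_natCast, ← ENNReal.ofReal_natCast, ← ENNReal.ofReal_natCast,
            ← ENNReal.ofReal_mul (by positivity), ← ENNReal.ofReal_mul (by positivity),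
            ← ENNReal.ofReal_mul (by positivity), ← ENNReal.ofReal_mul (by positivity)]
          congr 1; push_cast; ring
  rw [ENNReal.ofReal_add
    (mul_nonneg (by positivity) (Finset.sum_nonneg fun _ _ => (Real.exp_pos _).le)) (by positivity)]
  refine le_trans (measure_mono ?_) ((measure_union_le U1 U2).trans (add_le_add hm1 hm2))
  intro ω hω
  by_contra hcon
  rw [Set.mem_union, not_or] at hcon
  obtain ⟨hc1, hc2⟩ := hcon
  simp only [hU1, hU2, Set.mem_iUnion, Set.mem_union, not_exists, not_or, Finset.mem_range,
    exists_prop, not_and] at hc1 hc2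
  obtain ⟨k, hk1, hkK, j, hj, hnc⟩ := hω
  -- The estimates of episode `k` use the episodes up to `k - 1`, which is the index of the tail
  -- sums.
  obtain ⟨k', rfl⟩ : ∃ k', k = k' + 1 := ⟨k - 1, by omega⟩
  have hk' : k' ≤ K := by omega
  refine hnc ⟨?_, ?_, ?_, ?_⟩
  · intro n hn s a hN
    have h := (hc1 j hj n hn s a).1.1
    simp only [hR, Set.mem_ofPred_eq, not_exists, not_and, not_lt] at h
    have h1 := h k' hk'
    rw [sum_visits_reward hN] at h1
    have hNpos : (0 : ℝ) < X.count M.H (k' + 1) ω s a := by exact_mod_cast Nat.pos_of_ne_zero hN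
    have h2 := le_div_add_of_mul_le (y := q n s a - (X.rHat M.H (k' + 1) ω s a +
      ∑ s', X.pHat M.H (k' + 1) ω s a s' * f n s')) (x := lam j * σ (M.H - n) s a ^ 2 / 2) hNpos
      (hlam j hj) (le_trans (le_of_eq (by ring)) h1)
    simp only [hq] at h2
    linarith
  · intro n hn s a hN
    have h := (hc1 j hj n hn s a).1.2
    simp only [hR, Set.mem_ofPred_eq, not_exists, not_and, not_lt] at h
    have h1 := h k' hk'
    rw [sum_visits_reward hN] at h1
    have hNpos : (0 : ℝ) < X.count M.H (k' + 1) ω s a := by exact_mod_cast Nat.pos_of_ne_zero hN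
    have h2 := le_div_add_of_mul_le (y := (X.rHat M.H (k' + 1) ω s a +
      ∑ s', X.pHat M.H (k' + 1) ω s a s' * f n s') - q n s a)
      (x := lam j * σ (M.H - n) s a ^ 2 / 2) hNpos
      (hlam j hj) (le_trans (le_of_eq (by ring)) h1)
    simp only [hq] at h2
    linarith
  · intro n hn s a hN
    have h := (hc1 j hj n hn s a).2
    simp only [hB, Set.mem_ofPred_eq, not_exists, not_and, not_lt] at h
    have h1 := h k' hk'
    rw [sum_visits_next hN] at h1
    have hNpos : (0 : ℝ) < X.count M.H (k' + 1) ω s a := by exact_mod_cast Nat.pos_of_ne_zero hN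
    have h2 := le_div_add_of_mul_le
      (y := ∑ s', X.pHat M.H (k' + 1) ω s a s' * M.deficit σ V n s'
        - ∑ s', M.P s a s' * M.deficit σ V n s')
      (x := 1 / 10 * pvar (M.P s a) (M.deficit σ V n)) hNpos
      (t := 1 / 6) (by norm_num) (le_trans (le_of_eq (by ring)) h1)
    -- The Bernstein coefficient is 3/5 · 1/6 = 1/10, and 9/10 of the variance of `M.wBar` is within
    -- the allowance.
    have h3 : pvar (M.P s a) (M.deficit σ V n) ≤ 9 * pvar (M.P s a) (M.wBar σ V n) :=
      pvar_transform_le (M.P_nonneg s a) (M.P_sum s a)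
        (fun x => (MDP.wBar_mem hV hW hn.le x).1) (fun x => (MDP.wBar_mem hV hW hn.le x).2)
    have h4 := pvar_nonneg (M.P_nonneg s a) (M.P_sum s a) (M.wBar σ V n)
    have h5 : L j / (1 / 6) = 6 * L j := by ring
    rw [h5] at h2
    linarith
  · intro s a hN s' i hi
    have h := hc2 s a s' i hi
    simp only [hB, Set.mem_ofPred_eq, not_exists, not_and, not_lt] at h
    have h1 := h.1 k' hk'
    have h2 := h.2 k' hk'
    rw [sum_visits_next hN, hPone] at h1 h2
    have hNpos : (0 : ℝ) < X.count M.H (k' + 1) ω s a := by exact_mod_cast Nat.pos_of_ne_zero hN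
    have e : ∑ x, X.pHat M.H (k' + 1) ω s a x * one s' x = X.pHat M.H (k' + 1) ω s a s' := by
      simp [hone]
    rw [e] at h1 h2
    have hr := rate_pos i
    -- An indicator has variance at most its mean.
    have hvar : pvar (M.P s a) (one s') ≤ M.P s a s' := by
      have : ∑ x, M.P s a x * one s' x ^ 2 = M.P s a s' := by simp [hone]
      rw [pvar, this]
      linarith [sq_nonneg (∑ x, M.P s a x * one s' x)]
    have h3 := le_div_add_of_mul_le (y := M.P s a s' - X.pHat M.H (k' + 1) ω s a s')
      (x := 3 / 5 * rate i * pvar (M.P s a) (one s')) hNpos hr (le_trans (le_of_eq (by ring)) h1)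
    have h4 := le_div_add_of_mul_le (y := X.pHat M.H (k' + 1) ω s a s' - M.P s a s')
      (x := 3 / 5 * rate i * pvar (M.P s a) (one s')) hNpos hr (le_trans (le_of_eq (by ring)) h2)
    have h5 : 3 / 5 * rate i * pvar (M.P s a) (one s') ≤ 3 / 5 * rate i * M.P s a s' := by gcongr
    rw [div_div] at h3 h4
    rw [abs_le]; constructor <;> linarith

end Run
end EQOPlus
end

/-! ### Measurability of the algorithm's quantities. -/

noncomputable section
namespace EQOPlus
namespace Run

open scoped ENNReal

section Measurability

variable {S A Ω : Type*} [Fintype S] [DecidableEq S] [MeasurableSpace S] [DiscreteMeasurableSpace S]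
  [Fintype A] [DecidableEq A] [MeasurableSpace A] [DiscreteMeasurableSpace A]
  {X : Run S A Ω} {M : MDP S A} {V : ℝ} {c : ℕ → ℝ} {k h : ℕ}

omit [DecidableEq S] [DecidableEq A] in
-- There are finitely many pairs, so a random pair can be inserted into a family that is measurable
-- pair by pair.
theorem measurable_at_pair {m : MeasurableSpace Ω} {β : Type*} [MeasurableSpace β] {F : S → A → Ω → β}
    (hF : ∀ s a, Measurable[m] (F s a)) {u : Ω → S} {v : Ω → A} (hu : Measurable[m] u)
    (hv : Measurable[m] v) : Measurable[m] fun ω => F (u ω) (v ω) ω := by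
  have h1 : Measurable fun p : (S × A) × Ω => F p.1.1 p.1.2 p.2 :=
    measurable_from_prod_countable_right fun p => hF p.1 p.2
  exact h1.comp ((hu.prodMk hv).prodMk measurable_id)

/-- Only earlier episodes enter, so the statistics of episode `k` are known at each of its steps
`h`. The same holds for the estimates and the policy below. -/
theorem measurable_count (s : S) (a : A) :
    Measurable[X.history M.H k h] fun ω => X.count M.H k ω s a := by
  unfold count
  refine Finset.measurable_fun_sum _ fun i hi => Finset.measurable_fun_sum _ fun j hj => ?_
  rw [Finset.mem_Ico] at hi
  rw [Finset.mem_Icc] at hj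
  exact Measurable.ite (measurableSet_visit hi.1 hj.1 (by omega) s a) measurable_const
    measurable_const

theorem measurable_count_cast (s : S) (a : A) :
    Measurable[X.history M.H k h] fun ω => (X.count M.H k ω s a : ℝ) :=
  (measurable_of_countable (fun n : ℕ => (n : ℝ))).comp (measurable_count s a)

theorem measurable_rHat (s : S) (a : A) :
    Measurable[X.history M.H k h] fun ω => X.rHat M.H k ω s a := by
  unfold rHat
  refine Measurable.div ?_ (measurable_count_cast s a)
  refine Finset.measurable_fun_sum _ fun i hi => Finset.measurable_fun_sum _ fun j hj => ?_
  rw [Finset.mem_Ico] at hi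
  rw [Finset.mem_Icc] at hj
  exact Measurable.ite (measurableSet_visit hi.1 hj.1 (by omega) s a)
    (measurable_reward_history hi.1 hj.1 (by omega)) measurable_const

theorem measurable_pHat (s : S) (a : A) (s' : S) :
    Measurable[X.history M.H k h] fun ω => X.pHat M.H k ω s a s' := by
  unfold pHat
  refine Measurable.div ?_ (measurable_count_cast s a)
  refine Finset.measurable_fun_sum _ fun i hi => Finset.measurable_fun_sum _ fun j hj => ?_
  rw [Finset.mem_Ico] at hi
  rw [Finset.mem_Icc] at hj
  refine Measurable.ite ?_ measurable_const measurable_const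
  have h1 := measurableSet_visit (X := X) (H := M.H) (k := k) (h := h) hi.1 hj.1 (by omega) s a
  have h2 := measurable_state_history (X := X) (H := M.H) (k := k) (h := h) hi.1
    (j := j + 1) (by omega) (by omega) (measurableSet_singleton s')
  convert h1.inter h2 using 1
  ext ω
  simp [and_assoc]

theorem measurable_backup {v : Ω → S → ℝ} (hv : ∀ s, Measurable[X.history M.H k h] fun ω => v ω s)
    (s : S) (a : A) :
    Measurable[X.history M.H k h] fun ω => X.backup M.H V c (fun _ => ⊤) k ω (v ω) s a := by
  unfold backup
  refine Measurable.ite ?_ measurable_const (Measurable.min (Measurable.add (Measurable.max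
    (Measurable.add (measurable_rHat s a) (Finset.measurable_fun_sum _ fun s' _ =>
      (measurable_pHat s a s').mul (hv s'))) measurable_const) ?_) measurable_const)
  · exact measurable_count s a (measurableSet_singleton 0)
  · exact (measurable_of_countable fun n : ℕ => bonus (c k) ⊤ n).comp (measurable_count s a)

theorem measurable_vEst (n : ℕ) (s : S) :
    Measurable[X.history M.H k h] fun ω => X.vEst M.H V c (fun _ => ⊤) k ω n s := by
  induction n generalizing s with
  | zero => exact measurable_const
  | succ n ih => exact Measurable.iSup fun a => measurable_backup ih s a

theorem FollowsEQO.measurable_policy (hE : X.FollowsEQO M.H V c (fun _ => ⊤)) (hk : 1 ≤ k) {j : ℕ}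
    (hj : 1 ≤ j) (hjH : j ≤ M.H) (s : S) :
    Measurable[X.history M.H k h] fun ω => X.policy k ω j s := by
  obtain ⟨⟨sel, hsel, hpol⟩, -⟩ := hE
  simp only [hpol k _ j s hk hj hjH]
  exact (hsel k j s).1.comp
    (@measurable_pi_lambda _ _ _ (X.history M.H k h) _ _
      fun a => measurable_backup (fun s => measurable_vEst _ s) s a)

theorem measurable_visitCost {β : ℝ} (s : S) (a : A) :
    Measurable[X.history M.H k h] fun ω => X.visitCost M.H V β k ω s a :=
  (measurable_of_countable fun n : ℕ => if n = 0 then V else β / n).comp (measurable_count s a)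

theorem FollowsEQO.measurable_cappedGo (hE : X.FollowsEQO M.H V c (fun _ => ⊤)) (hk : 1 ≤ k) {β : ℝ}
    {n : ℕ} (hn : n ≤ M.H) (s : S) : Measurable[X.history M.H k h] fun ω =>
      M.cappedGo V (X.visitCost M.H V β k ω) (X.policy k ω) n s := by
  induction n generalizing s with
  | zero => exact measurable_const
  | succ n ih =>
    have hp := hE.measurable_policy (h := h) hk (j := M.H - n) (by omega) (by omega) s
    simp only [MDP.cappedGo]
    refine measurable_const.min (Measurable.add ?_ (Finset.measurable_fun_sum _ fun s' _ =>
      Measurable.mul ?_ (ih (by omega) s')))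
    · exact measurable_at_pair (fun s a => measurable_visitCost s a) measurable_const hp
    · exact (measurable_of_countable fun a => M.P s a s').comp hp

theorem FollowsEQO.measurable_toGo (hE : X.FollowsEQO M.H V c (fun _ => ⊤)) (hk : 1 ≤ k)
    {n : ℕ} (hn : n ≤ M.H) (s : S) : Measurable[X.history M.H k h] fun ω =>
      M.toGo (fun _ => M.r) (X.policy k ω) n s := by
  induction n generalizing s with
  | zero => exact measurable_const
  | succ n ih =>
    have hp := hE.measurable_policy (h := h) hk (j := M.H - n) (by omega) (by omega) s
    simp only [MDP.toGo]
    refine Measurable.add ?_ (Finset.measurable_fun_sum _ fun s' _ =>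
      Measurable.mul ?_ (ih (by omega) s'))
    · exact (measurable_of_countable fun a => M.r s a).comp hp
    · exact (measurable_of_countable fun a => M.P s a s').comp hp

end Measurability

/-! ### Stopping an episode at the first doubling of a count. -/

section Stopping

variable {S A Ω : Type*} [DecidableEq S] [DecidableEq A] (X : Run S A Ω) (H : ℕ)

/-- Visits within episode `k`, up to step `j`, to the pair visited at step `j`. -/
def epVisits (k j : ℕ) (ω : Ω) : ℕ :=
  ∑ i ∈ Finset.Icc 1 j,
    if X.state k i ω = X.state k j ω ∧ X.action k i ω = X.action k j ω then 1 else 0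

/-- At step `j` of episode `k` the count of the visited pair has more than doubled. -/
def Over (k j : ℕ) (ω : Ω) : Prop :=
  X.count H k ω (X.state k j ω) (X.action k j ω) < X.epVisits k j ω

/-- No count has more than doubled before step `h` of episode `k`. -/
def Active (k h : ℕ) (ω : Ω) : Prop := ∀ j, 1 ≤ j → j < h → ¬ X.Over H k j ω

open Classical in
/-- The cost of step `j` of episode `k`. -/
def stepCost (V β : ℝ) (k j : ℕ) (ω : Ω) : ℝ :=
  if X.Over H k j ω then V else β / X.count H k ω (X.state k j ω) (X.action k j ω)

open Classical in
/-- The total cost of the steps before `h` in episode `k`, up to the first doubling. -/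
def totalCost (V β : ℝ) (k h : ℕ) (ω : Ω) : ℝ :=
  ∑ j ∈ Finset.Ico 1 h, if X.Active H k j ω then X.stepCost H V β k j ω else 0

/-- Consequently an unvisited pair is `Over` at its first visit, and at every other step the count
in the denominator is positive. -/
theorem one_le_epVisits {k j : ℕ} (hj : 1 ≤ j) (ω : Ω) : 1 ≤ X.epVisits k j ω := by
  unfold epVisits
  refine le_trans ?_ (Finset.single_le_sum (f := fun i => if X.state k i ω = X.state k j ω ∧
    X.action k i ω = X.action k j ω then 1 else 0) (fun _ _ => Nat.zero_le _)
    (Finset.mem_Icc.2 ⟨hj, le_rfl⟩))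
  simp

theorem active_succ_iff {k h : ℕ} (hh : 1 ≤ h) (ω : Ω) :
    X.Active H k (h + 1) ω ↔ X.Active H k h ω ∧ ¬ X.Over H k h ω := by
  constructor
  · exact fun hA => ⟨fun j hj hlt => hA j hj (by omega), hA h hh (by omega)⟩
  · rintro ⟨hA, hO⟩ j hj hlt
    rcases Nat.lt_succ_iff_lt_or_eq.1 hlt with h' | rfl
    · exact hA j hj h'
    · exact hO

end Stopping

section StoppingMeasurability

variable {S A Ω : Type*} [Fintype S] [DecidableEq S] [MeasurableSpace S] [DiscreteMeasurableSpace S]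
  [Fintype A] [DecidableEq A] [MeasurableSpace A] [DiscreteMeasurableSpace A]
  {X : Run S A Ω} {M : MDP S A} {k h : ℕ}

theorem measurable_count_self (hk : 1 ≤ k) {j : ℕ} (hj : 1 ≤ j) (hjh : j ≤ h) :
    Measurable[X.history M.H k h]
      fun ω => X.count M.H k ω (X.state k j ω) (X.action k j ω) :=
  measurable_at_pair (fun s a => measurable_count s a)
    (measurable_state_history hk hj (Or.inr ⟨rfl, hjh⟩))
    (measurable_action_history hk hj (Or.inr ⟨rfl, hjh⟩))

theorem measurableSet_over (hk : 1 ≤ k) {j : ℕ} (hj : 1 ≤ j) (hjh : j ≤ h) :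
    MeasurableSet[X.history M.H k h] {ω | X.Over M.H k j ω} := by
  refine measurableSet_lt (mδ := X.history M.H k h) (measurable_count_self hk hj hjh) ?_
  refine Finset.measurable_fun_sum _ fun i hi => ?_
  rw [Finset.mem_Icc] at hi
  refine measurable_at_pair (F := fun s a ω => if X.state k i ω = s ∧ X.action k i ω = a then 1 else 0)
    (fun s a => Measurable.ite (measurableSet_visit hk hi.1 (Or.inr ⟨rfl, by omega⟩) s a)
      measurable_const measurable_const)
    (measurable_state_history hk hj (Or.inr ⟨rfl, hjh⟩))
    (measurable_action_history hk hj (Or.inr ⟨rfl, hjh⟩))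

/-- Only steps strictly before `j` matter. The value `j = h + 1` is therefore allowed, and the
potential after step `h` is known at step `h` up to the next state. -/
theorem measurableSet_active (hk : 1 ≤ k) {j : ℕ} (hjh : j ≤ h + 1) :
    MeasurableSet[X.history M.H k h] {ω | X.Active M.H k j ω} := by
  have : {ω | X.Active M.H k j ω} = ⋂ i ∈ Set.Ico 1 j, {ω | X.Over M.H k i ω}ᶜ := by
    ext ω; simp [Active]
  rw [this]
  exact MeasurableSet.biInter (Set.to_countable _) fun i hi =>
    (measurableSet_over hk hi.1 (by have := hi.2; omega)).compl

theorem measurable_totalCost {V β : ℝ} (hk : 1 ≤ k) {j : ℕ} (hjh : j ≤ h + 1) :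
    Measurable[X.history M.H k h] (X.totalCost M.H V β k j) := by
  refine Finset.measurable_fun_sum _ fun i hi => ?_
  rw [Finset.mem_Ico] at hi
  refine Measurable.ite (measurableSet_active hk (by omega)) ?_ measurable_const
  refine Measurable.ite (measurableSet_over hk hi.1 (by omega)) measurable_const ?_
  exact (measurable_of_countable fun n : ℕ => β / n).comp
    (measurable_count_self hk hi.1 (by omega))

end StoppingMeasurability

end Run
end EQOPlus
end

/-! ### From expected to realized costs. -/

noncomputable section
namespace EQOPlus

/-- With e^{-y} ≤ 1/(1 + y), the claim becomes a polynomial inequality. It holds because u ≤ V gives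
1 − u/(8V) ≥ 7/8, so the factor 8/7 between the two normalizations is just enough. -/
theorem exp_neg_mul_one_sub_le {V B p u : ℝ} (hV : 0 < V) (hB : 0 ≤ B) (hpV : p ≤ V)
    (hu : u ≤ V) (huB : u ≤ B + p) :
    Real.exp (-(1 / (7 * V) * B)) * (1 - 1 / (8 * V) * p) ≤ 1 - 1 / (8 * V) * u := by
  have hy : 0 < 1 / (7 * V) := by positivity
  have hα : 0 < 1 / (8 * V) := by positivity
  have h1 : 1 / (8 * V) * u ≤ 1 / 8 := by
    refine (mul_le_mul_of_nonneg_left hu hα.le).trans (le_of_eq ?_); field_simp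
  have h2 : 1 / (8 * V) * p ≤ 1 / 8 := by
    refine (mul_le_mul_of_nonneg_left hpV hα.le).trans (le_of_eq ?_); field_simp
  have hyB : 0 ≤ 1 / (7 * V) * B := by positivity
  have h3 : Real.exp (-(1 / (7 * V) * B)) ≤ 1 / (1 + 1 / (7 * V) * B) := by
    rw [Real.exp_neg, ← one_div]
    exact one_div_le_one_div_of_le (by linarith) (by linarith [Real.add_one_le_exp (1 / (7 * V) * B)])
  refine (mul_le_mul_of_nonneg_right h3 (by linarith)).trans ?_
  rw [div_mul_eq_mul_div, one_mul, div_le_iff₀ (by linarith)]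
  have h4 : 1 / (7 * V) * B = 8 / 7 * (1 / (8 * V) * B) := by field_simp
  have h5 : 1 / (8 * V) * u ≤ 1 / (8 * V) * B + 1 / (8 * V) * p := by
    rw [← mul_add]; exact mul_le_mul_of_nonneg_left huB hα.le
  have h6 : 0 ≤ 1 / (8 * V) * B := by positivity
  rw [h4]
  nlinarith

namespace Run

open scoped ENNReal

section Supermartingale

variable {S A Ω : Type*} [Fintype S] [DecidableEq S] [MeasurableSpace S] [DiscreteMeasurableSpace S]
  [Fintype A] [DecidableEq A] [MeasurableSpace A] [DiscreteMeasurableSpace A]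
  {mΩ : MeasurableSpace Ω} {μ : Measure Ω} [IsProbabilityMeasure μ] {X : Run S A Ω} {M : MDP S A}
  {V β : ℝ} {c : ℕ → ℝ} {k : ℕ}

/-- The expected truncated cost of episode `k` from its initial state. -/
def episodeCost (X : Run S A Ω) (M : MDP S A) (V β : ℝ) (k : ℕ) (ω : Ω) : ℝ :=
  M.cappedGo V (X.visitCost M.H V β k ω) (X.policy k ω) M.H (X.state k 1 ω)

open Classical in
/-- The supermartingale comparing the expected and the realized cost within episode `k`. -/
def costPotential (X : Run S A Ω) (M : MDP S A) (V β : ℝ) (k h : ℕ) (ω : Ω) (s : S) : ℝ :=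
  Real.exp (-(1 / (7 * V) * X.totalCost M.H V β k h ω)) *
    (1 - 1 / (8 * V) * if X.Active M.H k h ω then
      M.cappedGo V (X.visitCost M.H V β k ω) (X.policy k ω) (M.H + 1 - h) s else 0)

omit [MeasurableSpace S] [DiscreteMeasurableSpace S] [Fintype A] [DiscreteMeasurableSpace A] in
-- While the episode is active, the truncated Bellman recursion fits `exp_neg_mul_one_sub_le`;
-- afterwards the potential is frozen.
theorem FollowsEQO.sum_costPotential_le (hE : X.FollowsEQO M.H V c (fun _ => ⊤)) (hk : 1 ≤ k)
    (hV : 0 < V) (hβ : 0 ≤ β) {h : ℕ} (hh : 1 ≤ h) (hH : h ≤ M.H) (ω : Ω) :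
    ∑ s', M.P (X.state k h ω) (X.action k h ω) s' * X.costPotential M V β k (h + 1) ω s'
      ≤ X.costPotential M V β k h ω (X.state k h ω) := by
  classical
  have hB0 := visitCost_nonneg (X := X) (H := M.H) hV.le hβ k ω
  have hU := M.cappedGo_mem hV.le hB0 (X.policy k ω)
  have hact : X.action k h ω = X.policy k ω h (X.state k h ω) := hE.2 k ω h hk hh hH
  set s := X.state k h ω with hs
  set a := X.action k h ω with ha
  have hp := M.P_nonneg s a
  have hp1 := M.P_sum s a
  set U := M.cappedGo V (X.visitCost M.H V β k ω) (X.policy k ω) with hUdef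
  have e1 : M.H + 1 - (h + 1) = M.H - h := by omega
  have e2 : M.H + 1 - h = M.H - h + 1 := by omega
  have htot : X.totalCost M.H V β k (h + 1) ω = X.totalCost M.H V β k h ω
      + if X.Active M.H k h ω then X.stepCost M.H V β k h ω else 0 := by
    simp only [totalCost]
    rw [Finset.sum_Ico_succ_top hh]
  have hUs : U (M.H - h + 1) s = min V (X.visitCost M.H V β k ω s a
      + ∑ s', M.P s a s' * U (M.H - h) s') := by
    rw [hUdef]
    simp only [MDP.cappedGo]
    rw [show M.H - (M.H - h) = h by omega, ← hact]
  have hpuV : ∑ s', M.P s a s' * U (M.H - h) s' ≤ V :=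
    sum_mul_le_of_le hp hp1 fun s' => (hU _ s').2
  simp only [costPotential, e1, e2, htot, X.active_succ_iff M.H hh]
  by_cases hA : X.Active M.H k h ω
  · simp only [hA, true_and, if_true, ← hUdef]
    rw [mul_add, neg_add, Real.exp_add]
    have hUm := hU (M.H - h + 1) s
    -- At the first doubling the charge `V` covers the whole remaining truncated value.
    by_cases hO : X.Over M.H k h ω
    · simp only [hO, not_true, if_false, stepCost, if_true, mul_zero, sub_zero, mul_one]
      rw [← Finset.sum_mul, hp1, one_mul]
      refine mul_le_mul_of_nonneg_left ?_ (Real.exp_pos _).le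
      have := exp_neg_mul_one_sub_le hV hV.le (p := 0) hV.le hUm.2 (by linarith [hUm.2])
      simpa using this
    · simp only [hO, not_false_iff, if_true, stepCost, if_false]
      have hN : X.count M.H k ω s a ≠ 0 := by
        have h1 := X.one_le_epVisits (k := k) hh ω
        unfold Over at hO
        rw [← hs, ← ha] at hO
        omega
      have hcost : β / X.count M.H k ω s a = X.visitCost M.H V β k ω s a := by
        rw [visitCost, if_neg hN]
      rw [hcost]
      have e3 : ∑ s', M.P s a s' * (Real.exp (-(1 / (7 * V) * X.totalCost M.H V β k h ω)) *
          Real.exp (-(1 / (7 * V) * X.visitCost M.H V β k ω s a)) *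
          (1 - 1 / (8 * V) * U (M.H - h) s')) =
          Real.exp (-(1 / (7 * V) * X.totalCost M.H V β k h ω)) *
          (Real.exp (-(1 / (7 * V) * X.visitCost M.H V β k ω s a)) *
          (1 - 1 / (8 * V) * ∑ s', M.P s a s' * U (M.H - h) s')) := by
        have : ∀ x y s', M.P s a s' * (x * y * (1 - 1 / (8 * V) * U (M.H - h) s'))
            = x * y * M.P s a s' - x * y * (1 / (8 * V)) * (M.P s a s' * U (M.H - h) s') := by
          intro x y s'; ring
        simp only [this, Finset.sum_sub_distrib, ← Finset.mul_sum, hp1]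
        ring
      rw [e3]
      refine mul_le_mul_of_nonneg_left ?_ (Real.exp_pos _).le
      refine exp_neg_mul_one_sub_le hV (hB0 s a) hpuV hUm.2 ?_
      rw [hUs]; exact min_le_right _ _
  · simp only [hA, false_and, if_false, mul_zero, sub_zero, mul_one, add_zero]
    rw [← Finset.sum_mul, hp1, one_mul]

omit [Fintype A] [DiscreteMeasurableSpace S] [MeasurableSpace S] [MeasurableSpace A]
  [DiscreteMeasurableSpace A] in
theorem costPotential_nonneg (hV : 0 < V) (hβ : 0 ≤ β) (h : ℕ) (ω : Ω) (s : S) :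
    0 ≤ X.costPotential M V β k h ω s := by
  classical
  refine mul_nonneg (Real.exp_pos _).le ?_
  have hU := M.cappedGo_mem hV.le (visitCost_nonneg (X := X) (H := M.H) hV.le hβ k ω)
    (X.policy k ω) (M.H + 1 - h) s
  have h1 : 1 / (8 * V) * V = 1 / 8 := by field_simp
  have h2 : 0 < 1 / (8 * V) := by positivity
  split_ifs <;> nlinarith

theorem FollowsEQO.lintegral_costPotential_le (hX : X.InEnvironment M μ)
    (hE : X.FollowsEQO M.H V c (fun _ => ⊤)) (hk : 1 ≤ k) (hV : 0 < V) (hβ : 0 ≤ β)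
    {Z : Ω → ℝ≥0∞} (hZ : Measurable[X.history M.H k 1] Z) {h : ℕ} (hH : h ≤ M.H) :
    ∫⁻ ω, Z ω * ENNReal.ofReal (X.costPotential M V β k (h + 1) ω (X.state k (h + 1) ω)) ∂μ ≤
      ∫⁻ ω, Z ω * ENNReal.ofReal (X.costPotential M V β k 1 ω (X.state k 1 ω)) ∂μ := by
  classical
  induction h with
  | zero => exact le_rfl
  | succ h ih =>
    refine le_trans ?_ (ih (by omega))
    refine le_trans (hX.lintegral_next_le hk (h := h + 1) (by omega) hH (G := fun s' ω =>
      Z ω * ENNReal.ofReal (X.costPotential M V β k (h + 1 + 1) ω s')) ?_) ?_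
    · intro s'
      refine (hZ.mono (history_mono M.H_pos (Or.inr ⟨rfl, by omega⟩)) le_rfl).mul
        (ENNReal.measurable_ofReal.comp ?_)
      refine Measurable.mul (Real.measurable_exp.comp
        ((measurable_totalCost hk (by omega)).const_mul _).neg)
        (Measurable.const_sub (Measurable.const_mul ?_ _) _)
      exact Measurable.ite (measurableSet_active hk (by omega))
        (hE.measurable_cappedGo hk (by omega) s') measurable_const
    · refine lintegral_mono fun ω => ?_
      have h1 : ∀ s', ENNReal.ofReal (M.P (X.state k (h + 1) ω) (X.action k (h + 1) ω) s') *
          (Z ω * ENNReal.ofReal (X.costPotential M V β k (h + 1 + 1) ω s')) =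
          Z ω * ENNReal.ofReal (M.P (X.state k (h + 1) ω) (X.action k (h + 1) ω) s' *
            X.costPotential M V β k (h + 1 + 1) ω s') := by
        intro s'
        rw [ENNReal.ofReal_mul (M.P_nonneg _ _ _)]; ring
      simp only [h1, ← Finset.mul_sum]
      rw [← ENNReal.ofReal_sum_of_nonneg fun s' _ =>
        mul_nonneg (M.P_nonneg _ _ _) (costPotential_nonneg hV hβ _ _ _)]
      exact mul_le_mul' le_rfl (ENNReal.ofReal_le_ofReal
        (hE.sum_costPotential_le hk hV hβ (by omega) hH ω))

/-- The expected costs of the episodes are bounded by the realized costs with high probability. -/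
theorem FollowsEQO.measure_sum_episodeCost_le (hX : X.InEnvironment M μ)
    (hE : X.FollowsEQO M.H V c (fun _ => ⊤)) (hV : 0 < V) (hβ : 0 ≤ β) (K : ℕ) (L : ℝ) :
    μ {ω | L < ∑ k ∈ Finset.Icc 1 K, (1 / (8 * V) * X.episodeCost M V β k ω
      - 1 / (7 * V) * X.totalCost M.H V β k (M.H + 1) ω)} ≤ ENNReal.ofReal (Real.exp (-L)) := by
  classical
  set Y : ℕ → Ω → ℝ := fun k ω => 1 / (8 * V) * X.episodeCost M V β k ω
      - 1 / (7 * V) * X.totalCost M.H V β k (M.H + 1) ω with hY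
  have hcm : ∀ i k h, 1 ≤ i → (i < k ∨ (i = k ∧ 1 ≤ h)) →
      Measurable[X.history M.H k h] (X.episodeCost M V β i) := by
    intro i k h hi hlt
    have h1 : Measurable[X.history M.H i 1] (X.episodeCost M V β i) :=
      measurable_at_pair (F := fun s _ ω => M.cappedGo V (X.visitCost M.H V β i ω) (X.policy i ω) M.H s)
        (fun s _ => hE.measurable_cappedGo hi le_rfl s)
        (measurable_state_history hi le_rfl (Or.inr ⟨rfl, le_rfl⟩))
        (measurable_action_history hi le_rfl (Or.inr ⟨rfl, le_rfl⟩))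
    exact h1.mono (history_mono M.H_pos (by omega)) le_rfl
  have hYm : ∀ i k, 1 ≤ i → i < k → Measurable[X.history M.H k 1] (Y i) := by
    intro i k hi hlt
    refine ((hcm i k 1 hi (Or.inl hlt)).const_mul _).sub (Measurable.const_mul ?_ _)
    exact (measurable_totalCost (h := M.H) hi le_rfl).mono (history_mono le_rfl (Or.inl hlt)) le_rfl
  have hone : ∀ K, ∫⁻ ω, ENNReal.ofReal (Real.exp (∑ k ∈ Finset.Icc 1 K, Y k ω)) ∂μ ≤ 1 := by
    intro K
    induction K with
    | zero => simp
    | succ K ih =>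
      refine le_trans ?_ ih
      -- The past episodes and the expected cost of the new one, which is already known at its first
      -- step.
      set Z : Ω → ℝ≥0∞ := fun ω => ENNReal.ofReal (Real.exp (∑ k ∈ Finset.Icc 1 K, Y k ω)
        * Real.exp (1 / (8 * V) * X.episodeCost M V β (K + 1) ω)) with hZ
      have hZm : Measurable[X.history M.H (K + 1) 1] Z := by
        refine ENNReal.measurable_ofReal.comp (Measurable.mul (Real.measurable_exp.comp ?_)
          (Real.measurable_exp.comp ((hcm _ _ _ (by omega) (Or.inr ⟨rfl, le_rfl⟩)).const_mul _)))
        refine Finset.measurable_fun_sum _ fun i hi => ?_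
        rw [Finset.mem_Icc] at hi
        exact hYm i _ hi.1 (by omega)
      have key := FollowsEQO.lintegral_costPotential_le hX hE (k := K + 1) (by omega) hV hβ hZm
        (h := M.H) le_rfl
      refine le_trans (le_of_eq ?_) (key.trans ?_)
      · refine lintegral_congr fun ω => ?_
        rw [hZ, ← ENNReal.ofReal_mul (by positivity), Finset.sum_Icc_succ_top (by omega)]
        congr 1
        simp only [costPotential, Nat.sub_self, MDP.cappedGo, ite_self, mul_zero, sub_zero, mul_one]
        rw [mul_assoc, ← Real.exp_add, ← Real.exp_add]
        congr 1
      · refine lintegral_mono fun ω => ?_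
        rw [hZ, ← ENNReal.ofReal_mul (by positivity)]
        refine ENNReal.ofReal_le_ofReal ?_
        have hA : X.Active M.H (K + 1) 1 ω := fun j hj hlt => by omega
        have e : X.costPotential M V β (K + 1) 1 ω (X.state (K + 1) 1 ω)
            = 1 - 1 / (8 * V) * X.episodeCost M V β (K + 1) ω := by
          simp [costPotential, hA, totalCost, episodeCost]
        rw [e, mul_assoc]
        refine mul_le_of_le_one_right (Real.exp_pos _).le ?_
        -- The initial potential is 1 − x, and e^x (1 − x) ≤ 1 closes the episode.
        set x := 1 / (8 * V) * X.episodeCost M V β (K + 1) ω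
        calc Real.exp x * (1 - x) ≤ Real.exp x * Real.exp (-x) :=
              mul_le_mul_of_nonneg_left (Real.one_sub_le_exp_neg x) (Real.exp_pos _).le
          _ = 1 := by rw [← Real.exp_add]; simp
  have hmeas : Measurable fun ω => ENNReal.ofReal (Real.exp (∑ k ∈ Finset.Icc 1 K, Y k ω)) := by
    refine ENNReal.measurable_ofReal.comp (Real.measurable_exp.comp
      (Finset.measurable_fun_sum _ fun i hi => ?_))
    rw [Finset.mem_Icc] at hi
    exact (hYm i (K + 1) hi.1 (by omega)).mono (hX.history_le _ _) le_rfl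
  -- Only the final `K` matters here, so Markov's inequality replaces the maximal inequality.
  have hmk := (mul_meas_ge_le_lintegral (μ := μ) hmeas (ENNReal.ofReal (Real.exp L))).trans (hone K)
  have hexp : ENNReal.ofReal (Real.exp (-L)) = (ENNReal.ofReal (Real.exp L))⁻¹ := by
    rw [Real.exp_neg, ENNReal.ofReal_inv_of_pos (Real.exp_pos L)]
  rw [hexp, ENNReal.le_inv_iff_mul_le, mul_comm]
  refine le_trans (mul_le_mul' le_rfl (measure_mono ?_)) hmk
  intro ω hω
  exact ENNReal.ofReal_le_ofReal (Real.exp_le_exp.2 (le_of_lt hω))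

end Supermartingale

end Run
end EQOPlus
end

/-! ### Counting visits and doublings. -/

noncomputable section
namespace EQOPlus
namespace Run

section Counting

variable {S A Ω : Type*} [DecidableEq S] [DecidableEq A] (X : Run S A Ω) (H : ℕ)

/-- Visits to `(s, a)` in the first `h` steps of episode `k`. -/
def visits (k h : ℕ) (ω : Ω) (s : S) (a : A) : ℕ :=
  ∑ j ∈ Finset.Icc 1 h, if X.state k j ω = s ∧ X.action k j ω = a then 1 else 0

theorem visits_succ (k h : ℕ) (ω : Ω) (s : S) (a : A) :
    X.visits k (h + 1) ω s a = X.visits k h ω s a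
      + if X.state k (h + 1) ω = s ∧ X.action k (h + 1) ω = a then 1 else 0 := by
  rw [visits, Finset.sum_Icc_succ_top (by omega)]; rfl

theorem visits_mono (k : ℕ) (ω : Ω) (s : S) (a : A) : Monotone fun h => X.visits k h ω s a :=
  monotone_nat_of_le_succ fun h => by rw [visits_succ]; omega

theorem count_succ {k : ℕ} (hk : 1 ≤ k) (ω : Ω) (s : S) (a : A) :
    X.count H (k + 1) ω s a = X.count H k ω s a + X.visits k H ω s a := by
  rw [count, Finset.sum_Ico_succ_top hk]; rfl

theorem count_le {k K : ℕ} (hk : k ≤ K + 1) (ω : Ω) (s : S) (a : A) :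
    X.count H k ω s a ≤ K * H := by
  calc X.count H k ω s a ≤ ∑ i ∈ Finset.Ico 1 k, ∑ h ∈ Finset.Icc 1 H, 1 :=
        Finset.sum_le_sum fun i _ => Finset.sum_le_sum fun h _ => by split_ifs <;> omega
    _ = (k - 1) * H := by simp
    _ ≤ K * H := Nat.mul_le_mul_right _ (by omega)

/-- A frozen count `N` with n + 1 ≤ 2N costs at most 2/(n + 1), and 1/(n + 1) is bounded by the
increment of the logarithm, which telescopes over visits. -/
theorem inv_le_two_mul_log_sub {n N : ℕ} (hn : 1 ≤ n) (hN : 1 ≤ N) (h : n + 1 ≤ 2 * N) :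
    (1 : ℝ) / N ≤ 2 * (Real.log ((n + 1 : ℕ) : ℝ) - Real.log n) := by
  have hn0 : (0 : ℝ) < n := by exact_mod_cast hn
  have hN0 : (0 : ℝ) < N := by exact_mod_cast hN
  have h1 : ((n : ℝ) + 1) ≤ 2 * N := by exact_mod_cast h
  have h2 := Real.one_sub_inv_le_log_of_pos (x := ((n : ℝ) + 1) / n) (by positivity)
  rw [Real.log_div (by positivity) hn0.ne', inv_div] at h2
  have h3 : (1 : ℝ) / N ≤ 2 * (1 / (n + 1)) := by
    rw [mul_one_div, div_le_div_iff₀ hN0 (by positivity)]; linarith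
  have h4 : 1 - (n : ℝ) / (n + 1) = 1 / (n + 1) := by field_simp; ring
  push_cast
  linarith

open Classical in
/-- Inverse counts over the visits to `(s, a)` at which the count has not doubled. -/
def inverseCounts (k h : ℕ) (ω : Ω) (s : S) (a : A) : ℝ :=
  ∑ j ∈ Finset.Icc 1 h, if X.state k j ω = s ∧ X.action k j ω = a ∧ ¬ X.Over H k j ω then
    (1 : ℝ) / X.count H k ω s a else 0

/-- Counts are frozen during an episode, but as long as they have not doubled they are at least half
of the running count. -/
theorem inverseCounts_le (k h : ℕ) (ω : Ω) (s : S) (a : A) :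
    X.inverseCounts H k h ω s a ≤ 2 * (Real.log ((X.count H k ω s a + X.visits k h ω s a : ℕ) : ℝ)
      - Real.log (X.count H k ω s a)) := by
  classical
  induction h with
  | zero => simp [inverseCounts, visits]
  | succ h ih =>
    rw [inverseCounts, Finset.sum_Icc_succ_top (by omega), visits_succ]
    rw [inverseCounts] at ih
    set N := X.count H k ω s a with hN
    set v := X.visits k h ω s a with hv
    by_cases hvis : X.state k (h + 1) ω = s ∧ X.action k (h + 1) ω = a
    · rw [if_pos hvis]
      by_cases hO : X.Over H k (h + 1) ω
      · rw [if_neg (by tauto), add_zero]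
        refine ih.trans ?_
        -- Here `Real.log 0 = 0` serves as the value for a pair without visits.
        have : Real.log ((N + v : ℕ) : ℝ) ≤ Real.log ((N + (v + 1) : ℕ) : ℝ) := by
          rcases Nat.eq_zero_or_pos (N + v) with h0 | h0
          · rw [h0]; simp only [Nat.cast_zero, Real.log_zero]; exact Real.log_natCast_nonneg _
          · exact Real.log_le_log (by exact_mod_cast h0) (by exact_mod_cast (by omega))
        linarith
      · rw [if_pos ⟨hvis.1, hvis.2, hO⟩]
        have hep : X.epVisits k (h + 1) ω = v + 1 := by
          have h1 : X.epVisits k (h + 1) ω = X.visits k (h + 1) ω s a := by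
            rw [epVisits, visits, hvis.1, hvis.2]
          rw [h1, visits_succ, if_pos hvis]
        have h1 : v + 1 ≤ N := by
          unfold Over at hO
          rw [hep, hvis.1, hvis.2, not_lt] at hO
          exact hO
        have h2 := inv_le_two_mul_log_sub (n := N + v) (N := N) (by omega) (by omega) (by omega)
        rw [show N + (v + 1) = N + v + 1 by ring]
        linarith
    · rw [if_neg hvis, if_neg (by tauto), add_zero, add_zero]
      exact ih

theorem sum_inverseCounts_le (K : ℕ) (ω : Ω) (s : S) (a : A) :
    ∑ k ∈ Finset.Icc 1 K, X.inverseCounts H k H ω s a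
      ≤ 2 * Real.log (X.count H (K + 1) ω s a) := by
  induction K with
  | zero => simp [count]
  | succ K ih =>
    rw [Finset.sum_Icc_succ_top (by omega)]
    have h1 := X.inverseCounts_le H (K + 1) H ω s a
    rw [← X.count_succ H (by omega)] at h1
    linarith

/-- The count of `(s, a)` more than doubles in episode `k`. -/
def Doubles (k : ℕ) (ω : Ω) (s : S) (a : A) : Prop :=
  X.count H k ω s a < X.visits k H ω s a

-- If more than N visits are added to N, then N + 1 at least doubles; the added one lets the
-- estimate start from an unvisited pair.
open Classical in
theorem two_pow_doubles_le (K : ℕ) (ω : Ω) (s : S) (a : A) :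
    2 ^ (∑ k ∈ Finset.Icc 1 K, if X.Doubles H k ω s a then 1 else 0)
      ≤ X.count H (K + 1) ω s a + 1 := by
  induction K with
  | zero => simp
  | succ K ih =>
    rw [Finset.sum_Icc_succ_top (by omega), X.count_succ H (by omega), pow_add]
    split_ifs with h
    · unfold Doubles at h
      omega
    · simp only [pow_zero, mul_one]; omega

variable [Fintype S] [Fintype A]

-- At most one active step is `Over`, and it witnesses a doubling of its pair over the whole
-- episode. Hence `V` is charged at most once, and only when some pair doubles.
open Classical in
theorem totalCost_le {V β : ℝ} (hV : 0 ≤ V) (hβ : 0 ≤ β) (k : ℕ) (ω : Ω) :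
    X.totalCost H V β k (H + 1) ω ≤
      V * ∑ s, ∑ a, (if X.Doubles H k ω s a then (1 : ℝ) else 0)
        + β * ∑ s, ∑ a, X.inverseCounts H k H ω s a := by
  -- The charge and the loss of activity occur together.
  have h1 : ∀ h, ∑ j ∈ Finset.Ico 1 (h + 1), (if X.Active H k j ω ∧ X.Over H k j ω then V else 0)
      ≤ if X.Active H k (h + 1) ω then 0 else V := by
    intro h
    induction h with
    | zero => simp; split_ifs <;> simp [hV]
    | succ h ih =>
      rw [Finset.sum_Ico_succ_top (by omega)]
      by_cases hA : X.Active H k (h + 1) ω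
      · rw [if_pos hA] at ih
        by_cases hO : X.Over H k (h + 1) ω
        · rw [if_pos ⟨hA, hO⟩, if_neg (by rw [X.active_succ_iff H (by omega)]; tauto)]
          linarith
        · rw [if_neg (by tauto), if_pos (by rw [X.active_succ_iff H (by omega)]; tauto)]
          linarith
      · rw [if_neg hA] at ih
        rw [if_neg (by tauto), if_neg (by rw [X.active_succ_iff H (by omega)]; tauto)]
        linarith
  have h2 : (if X.Active H k (H + 1) ω then 0 else V) ≤
      V * ∑ s, ∑ a, (if X.Doubles H k ω s a then (1 : ℝ) else 0) := by
    have hnn : ∀ s a, (0 : ℝ) ≤ if X.Doubles H k ω s a then (1 : ℝ) else 0 := fun s a => by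
      split_ifs <;> norm_num
    split_ifs with hA
    · exact mul_nonneg hV (Finset.sum_nonneg fun s _ => Finset.sum_nonneg fun a _ => hnn s a)
    · unfold Active at hA
      push Not at hA
      obtain ⟨j, hj, hjH, hO⟩ := hA
      have hd : X.Doubles H k ω (X.state k j ω) (X.action k j ω) := by
        refine lt_of_lt_of_le hO ?_
        exact X.visits_mono k ω _ _ (show j ≤ H by omega)
      refine le_mul_of_one_le_right hV ?_
      calc (1 : ℝ) = if X.Doubles H k ω (X.state k j ω) (X.action k j ω) then (1 : ℝ) else 0 := by
            rw [if_pos hd]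
        _ ≤ ∑ a, if X.Doubles H k ω (X.state k j ω) a then (1 : ℝ) else 0 :=
            Finset.single_le_sum (f := fun a => if X.Doubles H k ω (X.state k j ω) a then (1 : ℝ)
              else 0) (fun a _ => hnn _ a) (Finset.mem_univ _)
        _ ≤ _ := Finset.single_le_sum (f := fun s => ∑ a, if X.Doubles H k ω s a then (1 : ℝ)
              else 0) (fun s _ => Finset.sum_nonneg fun a _ => hnn s a) (Finset.mem_univ _)
  have h3 : ∑ s, ∑ a, X.inverseCounts H k H ω s a = ∑ j ∈ Finset.Icc 1 H,
      if X.Over H k j ω then 0 else (1 : ℝ) / X.count H k ω (X.state k j ω) (X.action k j ω) := by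
    unfold inverseCounts
    have : ∀ s, ∑ a, ∑ j ∈ Finset.Icc 1 H, (if X.state k j ω = s ∧ X.action k j ω = a ∧
        ¬ X.Over H k j ω then (1 : ℝ) / X.count H k ω s a else 0) = ∑ j ∈ Finset.Icc 1 H, ∑ a,
        (if X.state k j ω = s ∧ X.action k j ω = a ∧
        ¬ X.Over H k j ω then (1 : ℝ) / X.count H k ω s a else 0) := fun s => Finset.sum_comm
    simp only [this]
    rw [Finset.sum_comm]
    refine Finset.sum_congr rfl fun j _ => ?_
    rw [Finset.sum_eq_single (X.state k j ω), Finset.sum_eq_single (X.action k j ω)]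
    · by_cases hO : X.Over H k j ω <;> simp [hO]
    · intro a _ ha; rw [if_neg]; tauto
    · simp
    · intro s _ hs; exact Finset.sum_eq_zero fun a _ => by rw [if_neg]; tauto
    · simp
  have hIco : Finset.Icc 1 H = Finset.Ico 1 (H + 1) := by
    ext j; simp only [Finset.mem_Icc, Finset.mem_Ico]; omega
  rw [h3, hIco]
  refine le_trans ?_ (add_le_add ((h1 H).trans h2) le_rfl)
  rw [Finset.mul_sum, ← Finset.sum_add_distrib]
  refine Finset.sum_le_sum fun j _ => ?_
  have hc : 0 ≤ β * (1 / (X.count H k ω (X.state k j ω) (X.action k j ω) : ℝ)) := by positivity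
  unfold stepCost
  by_cases hA : X.Active H k j ω <;> by_cases hO : X.Over H k j ω <;> simp only [hA, hO, if_true,
    if_false, and_true, and_false, mul_zero, add_zero, zero_add, le_refl]
  · exact le_of_eq (by ring)
  · exact hc

theorem sum_totalCost_le {V β : ℝ} (hV : 0 ≤ V) (hβ : 0 ≤ β) {K : ℕ} (hK : 1 ≤ K) (hH : 1 ≤ H)
    (ω : Ω) :
    ∑ k ∈ Finset.Icc 1 K, X.totalCost H V β k (H + 1) ω ≤
      V * (Fintype.card S * Fintype.card A) * (Real.log (2 * K * H) / Real.log 2)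
        + β * (Fintype.card S * Fintype.card A) * (2 * Real.log (K * H)) := by
  classical
  have hKH : 1 ≤ K * H := Nat.mul_pos hK hH
  have hKHr : (1 : ℝ) ≤ K * H := by exact_mod_cast hKH
  have hd : ∀ s a, ∑ k ∈ Finset.Icc 1 K, (if X.Doubles H k ω s a then (1 : ℝ) else 0)
      ≤ Real.log (2 * K * H) / Real.log 2 := by
    intro s a
    rw [le_div_iff₀ (Real.log_pos (by norm_num))]
    have h1 := X.two_pow_doubles_le H K ω s a
    have h2 : X.count H (K + 1) ω s a + 1 ≤ 2 * K * H := by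
      have := X.count_le H (K := K) le_rfl ω s a
      nlinarith
    have h3 : ((2 : ℝ) ^ (∑ k ∈ Finset.Icc 1 K, if X.Doubles H k ω s a then 1 else 0)) ≤
        2 * K * H := by exact_mod_cast h1.trans h2
    have h4 := Real.log_le_log (by positivity) h3
    rw [Real.log_pow] at h4
    push_cast at h4
    exact h4
  have hi : ∀ s a, ∑ k ∈ Finset.Icc 1 K, X.inverseCounts H k H ω s a ≤ 2 * Real.log (K * H) := by
    intro s a
    refine (X.sum_inverseCounts_le H K ω s a).trans ?_
    have hle : ((X.count H (K + 1) ω s a : ℕ) : ℝ) ≤ K * H := by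
      exact_mod_cast X.count_le H (K := K) le_rfl ω s a
    rcases Nat.eq_zero_or_pos (X.count H (K + 1) ω s a) with h0 | h0
    · rw [h0]; simp only [Nat.cast_zero, Real.log_zero, mul_zero]
      exact mul_nonneg zero_le_two (Real.log_nonneg hKHr)
    · have := Real.log_le_log (by exact_mod_cast h0) hle
      linarith
  calc ∑ k ∈ Finset.Icc 1 K, X.totalCost H V β k (H + 1) ω
      ≤ ∑ k ∈ Finset.Icc 1 K, (V * ∑ s, ∑ a, (if X.Doubles H k ω s a then (1 : ℝ) else 0)
        + β * ∑ s, ∑ a, X.inverseCounts H k H ω s a) :=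
        Finset.sum_le_sum fun k _ => X.totalCost_le H hV hβ k ω
    _ = V * ∑ s, ∑ a, ∑ k ∈ Finset.Icc 1 K, (if X.Doubles H k ω s a then (1 : ℝ) else 0)
        + β * ∑ s, ∑ a, ∑ k ∈ Finset.Icc 1 K, X.inverseCounts H k H ω s a := by
        rw [Finset.sum_add_distrib, ← Finset.mul_sum, ← Finset.mul_sum]
        congr 2
        · rw [Finset.sum_comm]
          exact Finset.sum_congr rfl fun s _ => Finset.sum_comm
        · rw [Finset.sum_comm]
          exact Finset.sum_congr rfl fun s _ => Finset.sum_comm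
    _ ≤ V * ∑ _s : S, ∑ _a : A, (Real.log (2 * K * H) / Real.log 2)
        + β * ∑ _s : S, ∑ _a : A, (2 * Real.log (K * H)) := by
        gcongr with s _ a _ s _ a _
        · exact hd s a
        · exact hi s a
    _ = _ := by
        simp only [Finset.sum_const, Finset.card_univ, nsmul_eq_mul]; ring

end Counting

end Run
end EQOPlus
end

/-! ### High-probability regret for general bonuses. -/

noncomputable section
namespace EQOPlus
namespace Run

open scoped ENNReal

variable {S A Ω : Type*} [Fintype S] [DecidableEq S] [MeasurableSpace S] [DiscreteMeasurableSpace S]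
  [Fintype A] [DecidableEq A] [MeasurableSpace A] [DiscreteMeasurableSpace A]
  {mΩ : MeasurableSpace Ω} {μ : Measure Ω} {X : Run S A Ω} {M : MDP S A}
  {V : ℝ} {c : ℕ → ℝ}

omit [DecidableEq S] [MeasurableSpace S] [DiscreteMeasurableSpace S] [DecidableEq A]
  [MeasurableSpace A] [DiscreteMeasurableSpace A] in
theorem regret_eq [Nonempty A] (K : ℕ) (ω : Ω) : X.regret M K ω = ∑ k ∈ Finset.Icc 1 K,
    (M.optGo (fun _ => M.r) M.H (X.state k 1 ω)
      - M.toGo (fun _ => M.r) (X.policy k ω) M.H (X.state k 1 ω)) := by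
  unfold regret
  refine Finset.sum_congr rfl fun k _ => ?_
  rw [M.Vstar_eq_optGo le_rfl, MDP.V, MDP.expSum, Nat.add_sub_cancel]

omit [DecidableEq S] [MeasurableSpace S] [DiscreteMeasurableSpace S] [DecidableEq A]
  [MeasurableSpace A] [DiscreteMeasurableSpace A] in
theorem regret_mem [Nonempty A] (hM : M.ValuesIn V) (hV : 0 ≤ V) (K : ℕ) (ω : Ω) :
    0 ≤ X.regret M K ω ∧ X.regret M K ω ≤ K * V := by
  rw [regret_eq]
  constructor
  · exact Finset.sum_nonneg fun k _ => sub_nonneg.2 (M.toGo_le_optGo _ _ _ _)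
  · refine (Finset.sum_le_card_nsmul _ _ V fun k _ => ?_).trans (by simp)
    linarith [(hM.optGo_mem hV le_rfl (X.state k 1 ω)).2,
      (hM.toGo_mem hV (X.policy k ω) le_rfl (X.state k 1 ω)).1]

omit [DecidableEq S] [MeasurableSpace S] [DiscreteMeasurableSpace S] [DecidableEq A]
  [MeasurableSpace A] [DiscreteMeasurableSpace A] in
/-- With a single action there is nothing to regret. -/
theorem regret_eq_zero_of_card_le_one [Nonempty A] (hA : Fintype.card A ≤ 1) (K : ℕ) (ω : Ω) :
    X.regret M K ω = 0 := by
  have : Subsingleton A := Fintype.card_le_one_iff_subsingleton.1 hA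
  obtain ⟨π, hπ⟩ := M.exists_toGo_eq_optGo (fun _ => M.r)
  rw [regret_eq]
  refine Finset.sum_eq_zero fun k _ => ?_
  rw [← hπ _ le_rfl, Subsingleton.elim π (X.policy k ω), sub_self]

theorem FollowsEQO.integrable_regret [Nonempty A] [IsFiniteMeasure μ] (hX : X.InEnvironment M μ)
    (hE : X.FollowsEQO M.H V c (fun _ => ⊤)) (hM : M.ValuesIn V) (hV : 0 ≤ V) (K : ℕ) :
    Integrable (X.regret M K) μ := by
  have hmeas : Measurable (X.regret M K) := by
    have : X.regret M K = fun ω => ∑ k ∈ Finset.Icc 1 K,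
        (M.optGo (fun _ => M.r) M.H (X.state k 1 ω)
          - M.toGo (fun _ => M.r) (X.policy k ω) M.H (X.state k 1 ω)) := funext fun ω => regret_eq K ω
    rw [this]
    refine Finset.measurable_fun_sum _ fun k hk => Measurable.sub ?_ ?_
    · exact (measurable_of_countable (M.optGo (fun _ => M.r) M.H)).comp (hX.measurable_state k 1)
    · rw [Finset.mem_Icc] at hk
      exact measurable_at_pair (F := fun s _ ω => M.toGo (fun _ => M.r) (X.policy k ω) M.H s)
        (fun s _ => (hE.measurable_toGo (h := 1) hk.1 le_rfl s).mono (hX.history_le k 1) le_rfl)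
        (hX.measurable_state k 1) (hX.measurable_action k 1)
  refine Integrable.of_bound hmeas.aestronglyMeasurable (K * V)
    (Filter.Eventually.of_forall fun ω => ?_)
  have := regret_mem (X := X) hM hV K ω
  rw [Real.norm_eq_abs, abs_of_nonneg this.1]
  exact this.2

/-- High-probability regret bound for general bonuses `c k / N`. -/
theorem InClass.measure_regret_gt_le [Nonempty A] [IsProbabilityMeasure μ] (hX : X.InClass M μ V)
    (hE : X.FollowsEQO M.H V c (fun _ => ⊤)) (hV : 0 < V) {K : ℕ} (hK : 1 ≤ K)
    {J : Finset ℕ} {φ : ℕ → ℕ} {lam L : ℕ → ℝ} {L' L'' cmax : ℝ} {G : ℕ}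
    (hφ : ∀ k, 1 ≤ k → k ≤ K → φ k ∈ J) (hlam : ∀ j ∈ J, 0 < lam j) (hL : ∀ j ∈ J, 0 ≤ L j)
    (hc : ∀ k, 1 ≤ k → k ≤ K → 9 / 8 * (L (φ k) / lam (φ k)) ≤ c k)
    (hcm : ∀ k, 1 ≤ k → k ≤ K → c k ≤ cmax) (hL' : 1 ≤ L')
    (hG : 2 * (K * M.H : ℝ) ≤ (3 / 2 : ℝ) ^ G) :
    μ {ω | ∑ k ∈ Finset.Icc 1 K, 10 * V ^ 2 * lam (φ k) + 3 / 2 * (8 * V * L'' + 8 / 7 *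
        (V * (Fintype.card S * Fintype.card A) * (Real.log (2 * K * M.H) / Real.log 2)
          + (2 * cmax + 9 * Fintype.card S * L' * V) * (Fintype.card S * Fintype.card A)
            * (2 * Real.log (K * M.H)))) < X.regret M K ω} ≤
      ENNReal.ofReal (3 * (M.H * Fintype.card S * Fintype.card A) * ∑ j ∈ J, Real.exp (-L j)
        + 2 * (Fintype.card S ^ 2 * Fintype.card A) * (G + 1) * Real.exp (-L')
        + Real.exp (-L'')) := by
  classical
  obtain ⟨σ, Vα, -, -, hα, hW, hsub⟩ := hX.subExp
  have hM : M.ValuesIn V := hX.bounded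
  have hcm0 : 0 ≤ cmax := by
    refine le_trans ?_ ((hc 1 le_rfl hK).trans (hcm 1 le_rfl hK))
    have h1 := hlam _ (hφ 1 le_rfl hK)
    have h2 := hL _ (hφ 1 le_rfl hK)
    positivity
  set β := 2 * cmax + 9 * Fintype.card S * L' * V with hβ
  have hβ0 : 0 ≤ β := by positivity
  -- Concentration is available only for rates with λV ≤ 1/10; the other rates need none.
  set J' := J.filter fun j => lam j * V ≤ 1 / 10 with hJ'
  have hev1 := measure_not_concentrated_le hX.env hV hα hW hsub J' lam L
    (fun j hj => hlam j (Finset.mem_filter.1 hj).1) (fun j hj => (Finset.mem_filter.1 hj).2) L' G K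
  have hev2 := hE.measure_sum_episodeCost_le hX.env hV hβ0 K L''
  have hsumJ : ∑ j ∈ J', Real.exp (-L j) ≤ ∑ j ∈ J, Real.exp (-L j) :=
    Finset.sum_le_sum_of_subset_of_nonneg (Finset.filter_subset _ _)
      fun _ _ _ => (Real.exp_pos _).le
  have hs0 : 0 ≤ ∑ j ∈ J, Real.exp (-L j) := Finset.sum_nonneg fun _ _ => (Real.exp_pos _).le
  rw [ENNReal.ofReal_add (by positivity) (Real.exp_pos _).le]
  refine le_trans (measure_mono ?_) ((measure_union_le _ _).trans (add_le_add
    (hev1.trans (ENNReal.ofReal_le_ofReal ?_)) hev2))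
  · intro ω hω
    by_contra hcon
    rw [Set.mem_union, not_or] at hcon
    obtain ⟨h1, h2⟩ := hcon
    simp only [Set.mem_ofPred_eq, not_exists, not_and, not_not, not_lt] at h1 h2 hω
    refine absurd hω (not_lt.2 ?_)
    have hcost := X.sum_totalCost_le M.H hV.le hβ0 hK M.H_pos ω
    have hep0 : ∀ k, 0 ≤ X.episodeCost M V β k ω := fun k =>
      (M.cappedGo_mem hV.le (visitCost_nonneg hV.le hβ0 k ω) _ _ _).1
    have hU : ∑ k ∈ Finset.Icc 1 K, X.episodeCost M V β k ω ≤ 8 * V * L'' + 8 / 7 *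
        ∑ k ∈ Finset.Icc 1 K, X.totalCost M.H V β k (M.H + 1) ω := by
      rw [Finset.sum_sub_distrib, ← Finset.mul_sum, ← Finset.mul_sum] at h2
      have h3 := mul_le_mul_of_nonneg_left h2 (show 0 ≤ 8 * V by positivity)
      have h4 : ∀ x y : ℝ, 8 * V * (1 / (8 * V) * x - 1 / (7 * V) * y) = x - 8 / 7 * y := by
        intro x y; field_simp
      rw [h4] at h3
      linarith
    have hper : ∀ k ∈ Finset.Icc 1 K, M.optGo (fun _ => M.r) M.H (X.state k 1 ω)
        - M.toGo (fun _ => M.r) (X.policy k ω) M.H (X.state k 1 ω)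
        ≤ 10 * V ^ 2 * lam (φ k) + 3 / 2 * X.episodeCost M V β k ω := by
      intro k hk
      rw [Finset.mem_Icc] at hk
      have hj := hφ k hk.1 hk.2
      by_cases hsmall : lam (φ k) * V ≤ 1 / 10
      · have hC := h1 k hk.1 (by omega) (φ k) (Finset.mem_filter.2 ⟨hj, hsmall⟩)
        refine hC.episode_regret hE hk.1 hV hM hW hL' (T := K * M.H) (fun s a => ?_) hG
          (hlam _ hj) (hL _ hj) hsmall (hc k hk.1 hk.2) (hcm k hk.1 hk.2) hβ (X.state k 1 ω)
        exact_mod_cast X.count_le M.H (k := k) (K := K) (by omega) ω s a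
      -- For λV > 1/10 the term 10V²λ exceeds `V`, the trivial bound for one episode.
      · have h3 := (hM.optGo_mem hV.le le_rfl (X.state k 1 ω)).2
        have h4 := (hM.toGo_mem hV.le (X.policy k ω) le_rfl (X.state k 1 ω)).1
        have h5 := hep0 k
        push Not at hsmall
        nlinarith
    rw [regret_eq]
    refine (Finset.sum_le_sum hper).trans ?_
    rw [Finset.sum_add_distrib, ← Finset.mul_sum (Finset.Icc 1 K) _ (3 / 2 : ℝ)]
    linarith
  · gcongr

end Run
end EQOPlus
end

/-! ### Tail integration, logarithmic factors and lower-order terms. -/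

noncomputable section
namespace EQOPlus

/-- The layer-cake formula for the positive part of f − a, with δ = e^{-t/b} at height t; the tail
integrates to b. -/
theorem integral_le_of_exp_tail {Ω : Type*} [MeasurableSpace Ω] {μ : Measure Ω}
    [IsProbabilityMeasure μ] {f : Ω → ℝ} (hf : Integrable f μ) {a b : ℝ} (hb : 0 < b)
    (h : ∀ δ : ℝ, 0 < δ → δ ≤ 1 → μ {ω | a + b * Real.log (1 / δ) < f ω} ≤ ENNReal.ofReal δ) :
    ∫ ω, f ω ∂μ ≤ a + b := by
  set g : Ω → ℝ := fun ω => max (f ω - a) 0 with hg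
  have hgi : Integrable g μ := (hf.sub (integrable_const a)).sup (integrable_const 0)
  have hg0 : ∀ ω, 0 ≤ g ω := fun ω => le_max_right _ _
  have key : ∫⁻ ω, ENNReal.ofReal (g ω) ∂μ ≤ ENNReal.ofReal b := by
    rw [lintegral_eq_lintegral_meas_lt μ (Filter.Eventually.of_forall hg0) hgi.aemeasurable]
    have hneg : -(1 / b) < 0 := by simpa using hb
    calc ∫⁻ t in Set.Ioi (0 : ℝ), μ {ω | t < g ω}
        ≤ ∫⁻ t in Set.Ioi (0 : ℝ), ENNReal.ofReal (Real.exp (-(1 / b) * t)) := by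
          refine setLIntegral_mono' measurableSet_Ioi fun t ht => ?_
          have ht0 : 0 < t := ht
          have h1 := h (Real.exp (-(1 / b) * t)) (Real.exp_pos _)
            (Real.exp_le_one_iff.2 (mul_nonpos_of_nonpos_of_nonneg hneg.le ht0.le))
          refine le_trans (measure_mono fun ω hω => ?_) h1
          have hω' : t < max (f ω - a) 0 := hω
          have h2 : t < f ω - a := by
            rcases lt_max_iff.1 hω' with h' | h'
            · exact h'
            · exact absurd h' (not_lt.2 ht0.le)
          change a + b * Real.log (1 / Real.exp (-(1 / b) * t)) < f ω
          rw [one_div, Real.log_inv, Real.log_exp]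
          have h3 : b * -(-(1 / b) * t) = t := by field_simp
          rw [h3]; linarith
      _ = ENNReal.ofReal (∫ t in Set.Ioi (0 : ℝ), Real.exp (-(1 / b) * t)) := by
          rw [ofReal_integral_eq_lintegral_ofReal (integrableOn_exp_mul_Ioi hneg 0)
            (Filter.Eventually.of_forall fun _ => (Real.exp_pos _).le)]
      _ = ENNReal.ofReal b := by
          rw [integral_exp_mul_Ioi hneg]; congr 1; simp
  have h1 : ∫ ω, g ω ∂μ ≤ b := by
    rw [← ofReal_integral_eq_lintegral_ofReal hgi (Filter.Eventually.of_forall hg0)] at key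
    exact (ENNReal.ofReal_le_ofReal_iff hb.le).1 key
  calc ∫ ω, f ω ∂μ ≤ ∫ ω, (a + g ω) ∂μ := by
        refine integral_mono hf ((integrable_const a).add hgi) fun ω => ?_
        have : f ω - a ≤ g ω := le_max_left _ _
        change f ω ≤ a + g ω
        linarith
    _ = a + ∫ ω, g ω ∂μ := by
        rw [integral_add (integrable_const a) hgi]; simp
    _ ≤ a + b := by linarith

section Ell

variable {H S A k : ℕ}

theorem log_exp_two_mul (hk : 1 ≤ k) (hH : 1 ≤ H) :
    Real.log (Real.exp 2 * k * H) = 2 + Real.log (k * H) := by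
  have h1 : (0 : ℝ) < k := by exact_mod_cast hk
  have h2 : (0 : ℝ) < H := by exact_mod_cast hH
  rw [mul_assoc, Real.log_mul (Real.exp_pos 2).ne' (by positivity), Real.log_exp]

theorem ell_eq_add {δ : ℝ} (hk : 1 ≤ k) (hH : 1 ≤ H) (hS : 1 ≤ S) (hA : 1 ≤ A) (hδ : 0 < δ) :
    ell H S A k δ = ell H S A k 1 + Real.log (1 / δ) := by
  have h1 : (0 : ℝ) < S := by exact_mod_cast hS
  have h2 : (0 : ℝ) < H := by exact_mod_cast hH
  have h3 : (0 : ℝ) < A := by exact_mod_cast hA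
  have h4 : 0 ≤ Real.log (k * H) := by exact_mod_cast Real.log_natCast_nonneg (k * H)
  have h5 : 0 < Real.log (Real.exp 2 * k * H) := by rw [log_exp_two_mul hk hH]; linarith
  rw [ell, ell, div_one, ← Real.log_mul (by positivity) (by positivity), mul_one_div]

theorem log_le_ell_one (hk : 1 ≤ k) (hH : 1 ≤ H) {x : ℝ} (hx : 0 < x)
    (h : x ≤ 32 * H * S * A * (2 + Real.log (k * H)) ^ 2) : Real.log x ≤ ell H S A k 1 := by
  rw [ell, div_one, log_exp_two_mul hk hH]
  exact Real.log_le_log hx h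

theorem ell_one_mono {k' : ℕ} (hk : 1 ≤ k) (hkk : k ≤ k') (hH : 1 ≤ H) (hS : 1 ≤ S) (hA : 1 ≤ A) :
    ell H S A k 1 ≤ ell H S A k' 1 := by
  have h1 : (0 : ℝ) < S := by exact_mod_cast hS
  have h2 : (0 : ℝ) < H := by exact_mod_cast hH
  have h3 : (0 : ℝ) < A := by exact_mod_cast hA
  have h4 : 0 ≤ Real.log (k * H) := by exact_mod_cast Real.log_natCast_nonneg (k * H)
  have hk0 : (0 : ℝ) < k := by exact_mod_cast hk
  have hkk' : (k : ℝ) ≤ k' := by exact_mod_cast hkk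
  have h5 : Real.log (k * H) ≤ Real.log (k' * H) := Real.log_le_log (by positivity) (by gcongr)
  rw [ell, div_one, log_exp_two_mul hk hH]
  exact log_le_ell_one (hk.trans hkk) hH (by positivity) (by gcongr)

theorem log_le_ell_of_le (hk : 1 ≤ k) (hH : 1 ≤ H) {x : ℝ} (hx : 0 < x)
    (h : x ≤ 128 * (H * S * A)) : Real.log x ≤ ell H S A k 1 := by
  have h4 : 0 ≤ Real.log (k * H) := by exact_mod_cast Real.log_natCast_nonneg (k * H)
  refine log_le_ell_one hk hH hx (h.trans ?_)
  have h5 : (4 : ℝ) ≤ (2 + Real.log (k * H)) ^ 2 := by nlinarith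
  calc (128 : ℝ) * (H * S * A) = 32 * H * S * A * 4 := by ring
    _ ≤ _ := by gcongr

theorem log_le_ell (hk : 1 ≤ k) (hH : 1 ≤ H) (hS : 1 ≤ S) (hA : 1 ≤ A) :
    Real.log (H * S * A) ≤ ell H S A k 1 := by
  have h1 : (0 : ℝ) < S := by exact_mod_cast hS
  have h2 : (0 : ℝ) < H := by exact_mod_cast hH
  have h3 : (0 : ℝ) < A := by exact_mod_cast hA
  have h5 : (0 : ℝ) < H * S * A := by positivity
  exact log_le_ell_of_le hk hH h5 (by linarith)

theorem three_le_ell (hk : 1 ≤ k) (hH : 1 ≤ H) (hS : 1 ≤ S) (hA : 1 ≤ A) :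
    3 ≤ ell H S A k 1 := by
  have h5 : (1 : ℝ) ≤ H * S * A := by exact_mod_cast Nat.mul_pos (Nat.mul_pos hH hS) hA
  have := log_le_ell_of_le (S := S) (A := A) hk hH (x := 128) (by norm_num) (by linarith)
  have h6 : Real.log 128 = 7 * Real.log 2 := by
    rw [show (128 : ℝ) = 2 ^ 7 by norm_num, Real.log_pow]; norm_num
  linarith [Real.log_two_gt_d9]

theorem five_le_ell (hk : 1 ≤ k) (hH : 1 ≤ H) (hS : 1 ≤ S) (hA : 2 ≤ A) :
    5 ≤ ell H S A k 1 := by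
  have h5 : (2 : ℝ) ≤ H * S * A := by
    have := Nat.mul_le_mul (Nat.mul_pos hH hS) hA
    exact_mod_cast this
  have := log_le_ell_of_le (S := S) (A := A) hk hH (x := 256) (by norm_num) (by linarith)
  have h6 : Real.log 256 = 8 * Real.log 2 := by
    rw [show (256 : ℝ) = 2 ^ 8 by norm_num, Real.log_pow]; norm_num
  linarith [Real.log_two_gt_d9]

end Ell

/-- The number of rates in the grid for `n` samples. -/
def gridSize (n : ℕ) : ℕ := 2 * Nat.clog 2 (2 * n)

/-- The factor 2 in `gridSize` suffices because (3/2)² ≥ 2. -/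
theorem le_pow_gridSize (n : ℕ) : 2 * (n : ℝ) ≤ (3 / 2 : ℝ) ^ gridSize n := by
  have h1 : 2 * n ≤ 2 ^ Nat.clog 2 (2 * n) := Nat.le_pow_clog (by norm_num) _
  have h2 : (2 * n : ℝ) ≤ 2 ^ Nat.clog 2 (2 * n) := by exact_mod_cast h1
  refine h2.trans ?_
  rw [gridSize, pow_mul]
  exact pow_le_pow_left₀ (by norm_num) (by norm_num) _

theorem gridSize_add_one_le {n : ℕ} (hn : 1 ≤ n) :
    (gridSize n : ℝ) + 1 ≤ 5 * (2 + Real.log n) := by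
  have h1 : 2 ^ (Nat.clog 2 (2 * n)).pred < 2 * n := Nat.pow_pred_clog_lt_self (by norm_num) (by omega)
  have hpos : 0 < Nat.clog 2 (2 * n) := Nat.clog_pos (by norm_num) (by omega)
  have h2 : (2 : ℝ) ^ (Nat.clog 2 (2 * n)).pred ≤ 2 * n := by exact_mod_cast h1.le
  have hn0 : (0 : ℝ) < n := by exact_mod_cast hn
  have h3 := Real.log_le_log (by positivity) h2
  rw [Real.log_pow, Real.log_mul (by norm_num) hn0.ne'] at h3
  have h4 : ((Nat.clog 2 (2 * n)).pred : ℝ) = Nat.clog 2 (2 * n) - 1 := by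
    rw [Nat.pred_eq_sub_one, Nat.cast_sub hpos]; simp
  rw [h4] at h3
  have h5 : 0 ≤ Real.log n := Real.log_natCast_nonneg n
  rw [gridSize]
  push_cast
  nlinarith [Real.log_two_gt_d9, Real.log_two_lt_d9]

/-- The union over next states brings S² where `ell` has S; squaring the argument of `ell` absorbs
this, at the price of a factor 2. -/
theorem grid_log_le {H S A K : ℕ} {δ : ℝ} (hK : 1 ≤ K) (hH : 1 ≤ H) (hS : 1 ≤ S) (hA : 1 ≤ A)
    (hδ : 0 < δ) (hδ1 : δ ≤ 1) :
    Real.log (8 * (S ^ 2 * A) * (gridSize (K * H) + 1) / δ) ≤ 2 * ell H S A K δ := by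
  have h1 : (1 : ℝ) ≤ S := by exact_mod_cast hS
  have h2 : (1 : ℝ) ≤ H := by exact_mod_cast hH
  have h3 : (1 : ℝ) ≤ A := by exact_mod_cast hA
  have h4 : 0 ≤ Real.log (K * H) := by exact_mod_cast Real.log_natCast_nonneg (K * H)
  have hg := gridSize_add_one_le (n := K * H) (Nat.mul_pos hK hH)
  rw [Nat.cast_mul] at hg
  have e : 2 * ell H S A K δ = Real.log ((32 * H * S * A * (2 + Real.log (K * H)) ^ 2 / δ) ^ 2) := by
    rw [ell, log_exp_two_mul hK hH, Real.log_pow]; norm_num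
  rw [e]
  refine Real.log_le_log (by positivity) ?_
  set x := 2 + Real.log (K * H) with hx
  have hx2 : 2 ≤ x := by linarith
  rw [div_pow, div_le_div_iff₀ hδ (by positivity)]
  have a1 : 8 * ((S : ℝ) ^ 2 * A) * (gridSize (K * H) + 1) ≤ 40 * (S ^ 2 * A * x) := by
    have : 0 ≤ (S : ℝ) ^ 2 * A := by positivity
    nlinarith
  have a2 : 40 * ((S : ℝ) ^ 2 * A * x) ≤ (32 * H * S * A * x ^ 2) ^ 2 := by
    have b1 : (S : ℝ) ^ 2 * A * x ≤ (S : ℝ) ^ 2 * A * x * (H ^ 2 * A * x ^ 3) := by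
      refine le_mul_of_one_le_right (by positivity) ?_
      have c1 : (1 : ℝ) ≤ H ^ 2 := one_le_pow₀ h2
      have c2 : (1 : ℝ) ≤ x ^ 3 := one_le_pow₀ (by linarith)
      exact one_le_mul_of_one_le_of_one_le (one_le_mul_of_one_le_of_one_le c1 h3) c2
    have b2 : (32 * H * S * A * x ^ 2) ^ 2 = 1024 * ((S : ℝ) ^ 2 * A * x * (H ^ 2 * A * x ^ 3)) := by
      ring
    have b3 : 0 ≤ (S : ℝ) ^ 2 * A * x := by positivity
    rw [b2]; linarith
  have a3 : 0 ≤ (32 * H * S * A * x ^ 2) ^ 2 := by positivity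
  calc 8 * ((S : ℝ) ^ 2 * A) * (gridSize (K * H) + 1) * δ ^ 2
      ≤ (32 * H * S * A * x ^ 2) ^ 2 * δ ^ 2 := by gcongr; exact a1.trans a2
    _ = (32 * H * S * A * x ^ 2) ^ 2 * δ * δ := by ring
    _ ≤ (32 * H * S * A * x ^ 2) ^ 2 * δ * 1 := by gcongr
    _ = (32 * H * S * A * x ^ 2) ^ 2 * δ := by ring

/-- The lower-order part of the regret bound. -/
theorem lower_order_le {s a V l x L' L'' : ℝ} (hs : 1 ≤ s) (ha : 2 ≤ a) (hV : 0 ≤ V) (hl : 5 ≤ l)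
    (hx : Real.log 2 ≤ x) (hL' : L' ≤ 2 * l) (hL'' : L'' ≤ l) :
    3 / 2 * (8 * V * L'' + 8 / 7 * (V * (s * a) * ((Real.log 2 + x) / Real.log 2)
      + 9 * s * L' * V * (s * a) * (2 * x))) ≤ 72 * V * s ^ 2 * a * l * (Real.log 2 + x) := by
  have hlog := Real.log_two_gt_d9
  have hlog0 : 0 < Real.log 2 := by linarith
  set y := Real.log 2 + x with hy
  have hy1 : 27 / 20 ≤ y := by linarith
  have hsa : 2 ≤ s ^ 2 * a := by nlinarith [one_le_pow₀ (n := 2) hs]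
  have hss : s * a ≤ s ^ 2 * a := by nlinarith
  have h1 : V * L'' ≤ 20 / 54 * (V * (s ^ 2 * a) * l * y) := by
    have b1 : 1 ≤ 20 / 54 * ((s ^ 2 * a) * y) := by nlinarith
    have b2 : V * L'' ≤ V * l := by gcongr
    have b3 : 0 ≤ V * l := by positivity
    nlinarith
  have h2 : V * (s * a) * (y / Real.log 2) ≤ 3 / 10 * (V * (s ^ 2 * a) * l * y) := by
    have b1 : y / Real.log 2 ≤ 3 / 10 * (l * y) := by
      rw [div_le_iff₀ hlog0]
      have : 1 ≤ 3 / 10 * l * Real.log 2 := by nlinarith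
      nlinarith
    calc V * (s * a) * (y / Real.log 2) ≤ V * (s ^ 2 * a) * (3 / 10 * (l * y)) := by
          gcongr
      _ = _ := by ring
  have h3 : 9 * s * L' * V * (s * a) * (2 * x) ≤ 36 * (V * (s ^ 2 * a) * l * y) := by
    have hx0 : 0 ≤ x := by linarith
    have hxy : x ≤ y := by linarith
    calc 9 * s * L' * V * (s * a) * (2 * x) ≤ 9 * s * (2 * l) * V * (s * a) * (2 * y) := by
          gcongr
      _ = _ := by ring
  -- In this unit the total is 3/2·(8·20/54 + 8/7·(3/10 + 36)) < 72.
  have h4 : 0 ≤ V * (s ^ 2 * a) * l * y := by positivity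
  have e : 72 * V * s ^ 2 * a * l * y = 72 * (V * (s ^ 2 * a) * l * y) := by ring
  rw [e]
  linarith

namespace Run

variable {S A Ω : Type*} [Fintype S] [DecidableEq S] [MeasurableSpace S] [DiscreteMeasurableSpace S]
  [Fintype A] [DecidableEq A] [MeasurableSpace A] [DiscreteMeasurableSpace A]
  {mΩ : MeasurableSpace Ω} {μ : Measure Ω} [IsProbabilityMeasure μ] {X : Run S A Ω} {M : MDP S A}
  {V : ℝ} {c : ℕ → ℝ}

/-- The regret bound at confidence level `δ`, for general bonuses. -/
theorem InClass.measure_regret_gt_le_ofReal [Nonempty S] (hX : X.InClass M μ V)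
    (hE : X.FollowsEQO M.H V c (fun _ => ⊤)) (hV : 0 < V) {K : ℕ} (hK : 1 ≤ K)
    (hKH : 2 ≤ K * M.H) (hA : 2 ≤ Fintype.card A) {δ : ℝ} (hδ : 0 < δ) (hδ1 : δ ≤ 1)
    {J : Finset ℕ} {φ : ℕ → ℕ} {lam L : ℕ → ℝ} {cmax : ℝ}
    (hφ : ∀ k, 1 ≤ k → k ≤ K → φ k ∈ J) (hlam : ∀ j ∈ J, 0 < lam j) (hL : ∀ j ∈ J, 0 ≤ L j)
    (hc : ∀ k, 1 ≤ k → k ≤ K → 9 / 8 * (L (φ k) / lam (φ k)) ≤ c k)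
    (hcm : ∀ k, 1 ≤ k → k ≤ K → c k ≤ cmax)
    (hJ : 3 * (M.H * Fintype.card S * Fintype.card A) * ∑ j ∈ J, Real.exp (-L j) ≤ δ / 2) :
    μ {ω | ∑ k ∈ Finset.Icc 1 K, 10 * V ^ 2 * lam (φ k)
        + 48 / 7 * cmax * (Fintype.card S * Fintype.card A * Real.log (K * M.H))
        + 72 * V * (Fintype.card S : ℝ) ^ 2 * Fintype.card A
          * ell M.H (Fintype.card S) (Fintype.card A) K δ * Real.log (2 * K * M.H)
        < X.regret M K ω} ≤ ENNReal.ofReal δ := by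
  have hAne : Nonempty A := Fintype.card_pos_iff.1 (by omega)
  have hH := M.H_pos
  have hS1 : 1 ≤ Fintype.card S := Fintype.card_pos
  set s : ℝ := (Fintype.card S : ℝ) with hs
  set a : ℝ := (Fintype.card A : ℝ) with ha
  have hs1 : 1 ≤ s := by rw [hs]; exact_mod_cast hS1
  have ha2 : 2 ≤ a := by rw [ha]; exact_mod_cast hA
  set G := gridSize (K * M.H) with hG
  -- The failure probability is split as δ/2 for rewards and deficits, δ/4 for transitions and δ/4
  -- for the comparison of costs.
  set L' := Real.log (8 * (s ^ 2 * a) * (G + 1) / δ) with hL'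
  set L'' := Real.log (4 / δ) with hL''
  have hKHr : (2 : ℝ) ≤ K * M.H := by exact_mod_cast hKH
  set l := ell M.H (Fintype.card S) (Fintype.card A) K δ with hl
  have hδlog : 0 ≤ Real.log (1 / δ) := Real.log_nonneg (by rw [le_div_iff₀ hδ]; linarith)
  have hell := ell_eq_add (k := K) hK hH hS1 (show 1 ≤ Fintype.card A by omega) hδ
  have h5 := five_le_ell (k := K) hK hH hS1 hA
  have hl5 : 5 ≤ l := by rw [hl, hell]; linarith
  have hL'l : L' ≤ 2 * l := grid_log_le hK hH hS1 (by omega) hδ hδ1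
  have hlog4 : Real.log 4 = 2 * Real.log 2 := by
    rw [show (4 : ℝ) = 2 ^ 2 by norm_num, Real.log_pow]; norm_num
  have hL''l : L'' ≤ l := by
    rw [hL'', hl, hell, Real.log_div (by norm_num) hδ.ne', hlog4, one_div, Real.log_inv]
    linarith [Real.log_two_lt_d9]
  have hsa2 : 2 ≤ s ^ 2 * a := by nlinarith [one_le_pow₀ (n := 2) hs1]
  have hG0 : (0 : ℝ) ≤ G := Nat.cast_nonneg _
  have hL'1 : 1 ≤ L' := by
    rw [hL', Real.le_log_iff_exp_le (by positivity), le_div_iff₀ hδ]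
    have h1 : Real.exp 1 * δ ≤ 3 * 1 := by
      have := Real.exp_one_lt_d9
      have := Real.exp_pos 1
      nlinarith
    nlinarith
  have key := hX.measure_regret_gt_le hE hV hK (J := J) (φ := φ) (lam := lam) (L := L) (L' := L')
    (L'' := L'') (cmax := cmax) (G := G) hφ hlam hL hc hcm hL'1
    (by have := le_pow_gridSize (K * M.H); rw [Nat.cast_mul] at this; exact this)
  refine le_trans (measure_mono fun ω hω => ?_) (key.trans (ENNReal.ofReal_le_ofReal ?_))
  · rw [Set.mem_ofPred_eq] at hω ⊢
    refine lt_of_le_of_lt ?_ hω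
    have hlow := lower_order_le (s := s) (a := a) (V := V) (l := l) (x := Real.log (K * M.H))
      hs1 ha2 hV.le hl5 (Real.log_le_log (by norm_num) hKHr) hL'l hL''l
    have e1 : Real.log (2 * K * M.H) = Real.log 2 + Real.log (K * M.H) := by
      rw [mul_assoc, Real.log_mul (by norm_num) (by linarith)]
    rw [e1]
    -- Only the bonus part of the cost is of main order; its factor is 3/2 · 8/7 · 2 · 2 = 48/7.
    have e2 : 3 / 2 * (8 * V * L'' + 8 / 7 * (V * (s * a) * ((Real.log 2 + Real.log (K * M.H))
        / Real.log 2) + (2 * cmax + 9 * s * L' * V) * (s * a) * (2 * Real.log (K * M.H))))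
        = 48 / 7 * cmax * (s * a * Real.log (K * M.H)) +
        3 / 2 * (8 * V * L'' + 8 / 7 * (V * (s * a) * ((Real.log 2 + Real.log (K * M.H))
        / Real.log 2) + 9 * s * L' * V * (s * a) * (2 * Real.log (K * M.H)))) := by ring
    rw [e2]
    linarith
  · have e1 : 2 * (s ^ 2 * a) * (G + 1) * Real.exp (-L') = δ / 4 := by
      rw [hL', Real.exp_neg, Real.exp_log (by positivity)]
      field_simp; norm_num
    have e2 : Real.exp (-L'') = δ / 4 := by
      rw [hL'', Real.exp_neg, Real.exp_log (by positivity)]; field_simp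
    rw [e1, e2]
    linarith

end Run
end EQOPlus
end

/-! ### The two parameter choices. -/

noncomputable section
namespace EQOPlus

theorem sum_inv_sqrt_le (K : ℕ) :
    ∑ k ∈ Finset.Icc 1 K, 1 / Real.sqrt k ≤ 2 * Real.sqrt K := by
  induction K with
  | zero => simp
  | succ K ih =>
    rw [Finset.sum_Icc_succ_top (by omega)]
    have h1 : (0 : ℝ) < Real.sqrt ((K + 1 : ℕ) : ℝ) := Real.sqrt_pos.2 (by positivity)
    have h2 : 0 ≤ Real.sqrt (K : ℝ) := Real.sqrt_nonneg _
    have h3 : Real.sqrt ((K + 1 : ℕ) : ℝ) ^ 2 = Real.sqrt (K : ℝ) ^ 2 + 1 := by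
      rw [Real.sq_sqrt (by positivity), Real.sq_sqrt (by positivity)]; push_cast; ring
    have h4 : 1 / Real.sqrt ((K + 1 : ℕ) : ℝ) ≤ 2 * (Real.sqrt ((K + 1 : ℕ) : ℝ) - Real.sqrt K) := by
      rw [div_le_iff₀ h1]
      nlinarith [sq_nonneg (Real.sqrt ((K + 1 : ℕ) : ℝ) - Real.sqrt K)]
    linarith

theorem sum_inv_mul_succ_le (n : ℕ) :
    ∑ j ∈ Finset.range n, 1 / (((j : ℝ) + 1) * (j + 2)) ≤ 1 - 1 / ((n : ℝ) + 1) := by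
  induction n with
  | zero => simp
  | succ n ih =>
    rw [Finset.sum_range_succ]
    have : 1 / (((n : ℝ) + 1) * (n + 2)) = 1 / ((n : ℝ) + 1) - 1 / (((n + 1 : ℕ) : ℝ) + 1) := by
      push_cast; field_simp; ring
    rw [this]
    linarith

/-- Inserting λ = 9/8 · L/c turns the per-episode term into 45/4 · (V/c₁)θ√(Dl/κ). Replacing the
block start κ by k costs √2 ≤ 64/45, and 45/4 · 64/45 = 16. -/
theorem rate_term_le {V c₁ D l lK L θ κ k : ℝ} (hV : 0 < V) (hc : 0 < c₁) (hD : 0 < D) (hl : 0 < l)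
    (hlK : l ≤ lK) (hκ : 0 < κ) (hk : 0 < k) (hkκ : k ≤ 2 * κ) (hθ : 0 ≤ θ) (hL : L ≤ l * θ) :
    10 * V ^ 2 * (9 / 8 * (L / (c₁ * V * Real.sqrt (κ * l / D)))) ≤
      16 * (V / c₁) * θ * Real.sqrt (D * lK) * (1 / Real.sqrt k) := by
  have e1 : Real.sqrt (κ * l / D) = Real.sqrt κ * Real.sqrt l / Real.sqrt D := by
    rw [Real.sqrt_div (by positivity), Real.sqrt_mul hκ.le]
  have e2 : Real.sqrt (D * lK) = Real.sqrt D * Real.sqrt lK := Real.sqrt_mul hD.le _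
  have hsκ := Real.sqrt_pos.2 hκ
  have hsl := Real.sqrt_pos.2 hl
  have hsD := Real.sqrt_pos.2 hD
  have hsk := Real.sqrt_pos.2 hk
  have hll : Real.sqrt l * Real.sqrt l = l := Real.mul_self_sqrt hl.le
  have hslK : Real.sqrt l ≤ Real.sqrt lK := Real.sqrt_le_sqrt hlK
  have hkk : 45 / 4 * (1 / Real.sqrt κ) ≤ 16 * (1 / Real.sqrt k) := by
    have h1 : Real.sqrt k ≤ Real.sqrt 2 * Real.sqrt κ := by
      rw [← Real.sqrt_mul (by norm_num)]; exact Real.sqrt_le_sqrt hkκ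
    have h2 : Real.sqrt 2 ≤ 64 / 45 := by
      rw [Real.sqrt_le_left (by norm_num)]; norm_num
    rw [mul_one_div, mul_one_div, div_le_div_iff₀ hsκ hsk]
    nlinarith
  calc 10 * V ^ 2 * (9 / 8 * (L / (c₁ * V * Real.sqrt (κ * l / D))))
      ≤ 10 * V ^ 2 * (9 / 8 * (l * θ / (c₁ * V * Real.sqrt (κ * l / D)))) := by
        gcongr
    _ = V / c₁ * θ * Real.sqrt D * Real.sqrt l * (45 / 4 * (1 / Real.sqrt κ)) := by
        rw [e1]
        nth_rewrite 1 [← hll]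
        field_simp; ring
    _ ≤ V / c₁ * θ * Real.sqrt D * Real.sqrt lK * (16 * (1 / Real.sqrt k)) := by
        gcongr
    _ = 16 * (V / c₁) * θ * Real.sqrt (D * lK) * (1 / Real.sqrt k) := by rw [e2]; ring

theorem sqrt_div_mul_self {x D : ℝ} (hx : 0 ≤ x) (hD : 0 < D) :
    Real.sqrt (x / D) * D = Real.sqrt (D * x) := by
  rw [Real.sqrt_div hx, Real.sqrt_mul hD.le, div_mul_eq_mul_div,
    div_eq_iff (Real.sqrt_pos.2 hD).ne', mul_right_comm, Real.mul_self_sqrt hD.le, mul_comm]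

theorem paramEll_mono {c₁ V : ℝ} {H S A K k k' : ℕ} (hc : 0 ≤ c₁) (hV : 0 ≤ V) (hk : 1 ≤ k)
    (hkk : k ≤ k') (hH : 1 ≤ H) (hS : 1 ≤ S) (hA : 1 ≤ A) :
    paramEll c₁ V H S A K k ≤ paramEll c₁ V H S A K k' := by
  unfold paramEll
  have h1 := ell_one_mono hk hkk hH hS hA
  have h2 := three_le_ell hk hH hS hA
  have h3 : 0 ≤ Real.log (K * H) := by exact_mod_cast Real.log_natCast_nonneg (K * H)
  gcongr

/-- Since log 2^j ≥ j/2, the squared logarithm in `ell` dominates the weight (j + 1)(j + 2) of the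
union over blocks. -/
theorem block_log_le_ell {H S A j : ℕ} {δ : ℝ} (hH : 1 ≤ H) (hS : 1 ≤ S) (hA : 1 ≤ A) (hδ : 0 < δ) :
    Real.log (6 * (H * S * A) * ((j + 1) * (j + 2)) / δ) ≤ ell H S A (2 ^ j) δ := by
  have hj : 1 ≤ 2 ^ j := Nat.one_le_two_pow
  have h1 : (0 : ℝ) < S := by exact_mod_cast hS
  have h2 : (1 : ℝ) ≤ H := by exact_mod_cast hH
  have h3 : (0 : ℝ) < A := by exact_mod_cast hA
  have h4 : (j : ℝ) * Real.log 2 ≤ Real.log (((2 ^ j : ℕ) : ℝ) * H) := by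
    rw [← Real.log_pow]
    refine Real.log_le_log (by positivity) ?_
    push_cast
    exact le_mul_of_one_le_right (by positivity) h2
  have h5 : (j : ℝ) / 2 ≤ Real.log (((2 ^ j : ℕ) : ℝ) * H) := by
    have : (0 : ℝ) ≤ j := Nat.cast_nonneg j
    nlinarith [Real.log_two_gt_d9]
  rw [ell, log_exp_two_mul hj hH]
  refine Real.log_le_log (by positivity) (div_le_div_of_nonneg_right ?_ hδ.le)
  have hj0 : (0 : ℝ) ≤ j := Nat.cast_nonneg j
  have h6 : (2 + (j : ℝ) / 2) ^ 2 ≤ (2 + Real.log (((2 ^ j : ℕ) : ℝ) * H)) ^ 2 := by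
    gcongr
  have h7 : 6 * (((j : ℝ) + 1) * (j + 2)) ≤ 32 * (2 + Real.log (((2 ^ j : ℕ) : ℝ) * H)) ^ 2 := by
    nlinarith
  have h8 : (0 : ℝ) < H * S * A := by positivity
  calc 6 * ((H : ℝ) * S * A) * ((j + 1) * (j + 2)) = (H * S * A) * (6 * ((j + 1) * (j + 2))) := by ring
    _ ≤ (H * S * A) * (32 * (2 + Real.log (((2 ^ j : ℕ) : ℝ) * H)) ^ 2) := by gcongr
    _ = _ := by ring

/-- From log H ≤ H − 1, the sum 2 + log KH is at most 3H log K. The argument of `ell` is then at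
most 2⁹y³ with y = HSA log K, and y ≥ 2 because of `2 ≤ A`, so 9 log 2 + 3 log y ≤ 12 log y. -/
theorem ell_le_mul_log {H S A K : ℕ} (hH : 1 ≤ H) (hS : 1 ≤ S) (hA : 2 ≤ A) (hK : 3 ≤ K) :
    ell H S A K 1 ≤ 12 * Real.log (H * S * A * Real.log K) ∧
      1 / 2 ≤ Real.log (H * S * A * Real.log K) := by
  have h1 : (1 : ℝ) ≤ S := by exact_mod_cast hS
  have h2 : (1 : ℝ) ≤ H := by exact_mod_cast hH
  have h3 : (2 : ℝ) ≤ A := by exact_mod_cast hA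
  have hKr : (3 : ℝ) ≤ K := by exact_mod_cast hK
  have hlK : 1 ≤ Real.log K := by
    rw [Real.le_log_iff_exp_le (by linarith)]
    linarith [Real.exp_one_lt_d9]
  set z := Real.log (K : ℝ) with hz
  have hSA : (2 : ℝ) ≤ S * A := by nlinarith
  set y := (H : ℝ) * S * A * z with hy
  have hHz : (H : ℝ) * z * 2 ≤ y := by
    have : 0 ≤ (H : ℝ) * z := by positivity
    rw [hy]; nlinarith
  have hy2 : 2 ≤ y := by nlinarith
  have hlogy : Real.log 2 ≤ Real.log y := Real.log_le_log (by norm_num) hy2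
  refine ⟨?_, by linarith [Real.log_two_gt_d9]⟩
  have hlogHK : Real.log (K * H) = z + Real.log H := by
    rw [Real.log_mul (by linarith) (by linarith)]
  have hlH : Real.log H ≤ H - 1 := Real.log_le_sub_one_of_pos (by linarith)
  have hlH0 : 0 ≤ Real.log H := Real.log_nonneg h2
  have h4 : 2 + Real.log (K * H) ≤ 3 * (H * z) := by rw [hlogHK]; nlinarith
  have h5 : 32 * H * S * A * Real.log (Real.exp 2 * K * H) ^ 2 / 1 ≤ 2 ^ 9 * y ^ 3 := by
    rw [log_exp_two_mul (by omega) hH, div_one]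
    have a1 : (2 + Real.log (K * H)) ^ 2 ≤ (3 * (H * z)) ^ 2 :=
      pow_le_pow_left₀ (by rw [hlogHK]; linarith) h4 2
    have a2 : (H : ℝ) * S * A ≤ y := by
      rw [hy]; exact le_mul_of_one_le_right (by positivity) hlK
    have a3 : (3 * ((H : ℝ) * z)) ^ 2 ≤ (3 / 2 * y) ^ 2 :=
      pow_le_pow_left₀ (by positivity) (by linarith) 2
    calc 32 * (H : ℝ) * S * A * (2 + Real.log (K * H)) ^ 2
        = 32 * (H * S * A * (2 + Real.log (K * H)) ^ 2) := by ring
      _ ≤ 32 * (y * (3 / 2 * y) ^ 2) := by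
          exact mul_le_mul_of_nonneg_left
            (mul_le_mul a2 (a1.trans a3) (sq_nonneg _) (by positivity)) (by norm_num)
      _ = 72 * y ^ 3 := by ring
      _ ≤ 2 ^ 9 * y ^ 3 := by
          have : 0 ≤ y ^ 3 := by positivity
          linarith
  have hpos : 0 < 32 * (H : ℝ) * S * A * Real.log (Real.exp 2 * K * H) ^ 2 / 1 := by
    have : 0 < Real.log (Real.exp 2 * K * H) := by
      rw [log_exp_two_mul (by omega) hH, hlogHK]; linarith
    positivity
  have h6 := Real.log_le_log hpos h5
  have h7 : Real.log (2 ^ 9 * y ^ 3) = 9 * Real.log 2 + 3 * Real.log y := by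
    rw [Real.log_mul (by positivity) (by positivity), Real.log_pow, Real.log_pow]
    norm_num
  rw [h7] at h6
  rw [ell]
  linarith

/-- The regret bound at confidence level `δ` for the parameters `paramEll`. -/
def ellBound (c₁ V : ℝ) (H S A K : ℕ) (δ : ℝ) : ℝ :=
  (36 * Real.log (1 / δ) / (c₁ * Real.log (H * S * A)) + 36 / c₁ + 8 * c₁) * V
      * Real.sqrt (K * S * A * ell H S A K 1 * Real.log (K * H))
    + 72 * V * (S : ℝ) ^ 2 * A * ell H S A K δ * Real.log (2 * K * H)

namespace Run

variable {S A Ω : Type*} [Fintype S] [DecidableEq S] [MeasurableSpace S] [DiscreteMeasurableSpace S]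
  [Fintype A] [DecidableEq A] [MeasurableSpace A] [DiscreteMeasurableSpace A]
  {mΩ : MeasurableSpace Ω} {μ : Measure Ω} [IsProbabilityMeasure μ] {X : Run S A Ω} {M : MDP S A}
  {V c₁ : ℝ}

/-- One rate serves each dyadic block of episodes, since the parameters grow by a bounded factor
inside it. Blocks are weighted by 1/((j + 1)(j + 2)), so the union over them costs only an iterated
logarithm. -/
theorem InClass.measure_ellBound_lt_regret_le [Nonempty S] (hX : X.InClass M μ V) {K : ℕ}
    (hE : X.FollowsEQO M.H V (paramEll c₁ V M.H (Fintype.card S) (Fintype.card A) K) (fun _ => ⊤))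
    (hc₁ : 0 < c₁) (hV : 0 < V) (hK : 1 ≤ K) (hKH : 2 ≤ K * M.H) (hA : 2 ≤ Fintype.card A)
    {δ : ℝ} (hδ : 0 < δ) (hδ1 : δ ≤ 1) :
    μ {ω | ellBound c₁ V M.H (Fintype.card S) (Fintype.card A) K δ < X.regret M K ω}
      ≤ ENNReal.ofReal δ := by
  have hH := M.H_pos
  have hS1 : 1 ≤ Fintype.card S := Fintype.card_pos
  have hA1 : 1 ≤ Fintype.card A := by omega
  set s := Fintype.card S with hs
  set a := Fintype.card A with ha
  have hs1 : (1 : ℝ) ≤ s := by exact_mod_cast hS1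
  have ha2 : (2 : ℝ) ≤ a := by exact_mod_cast hA
  have hH1 : (1 : ℝ) ≤ M.H := by exact_mod_cast hH
  have hKHr : (2 : ℝ) ≤ K * M.H := by exact_mod_cast hKH
  have hlogKH : 0 < Real.log (K * M.H) := Real.log_pos (by linarith)
  set D : ℝ := s * a * Real.log (K * M.H) with hD
  have hD0 : 0 < D := by positivity
  have hHSA : (2 : ℝ) ≤ M.H * s * a := by nlinarith [one_le_mul_of_one_le_of_one_le hH1 hs1]
  set g := Real.log (M.H * s * a) with hg
  have hg0 : 0 < g := Real.log_pos (by linarith)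
  set t := Real.log (1 / δ) with ht
  have ht0 : 0 ≤ t := Real.log_nonneg (by rw [le_div_iff₀ hδ]; linarith)
  set c := paramEll c₁ V M.H s a K with hc
  set L : ℕ → ℝ := fun j => Real.log (6 * (M.H * s * a) * ((j + 1) * (j + 2)) / δ) with hL
  -- The largest admissible bonus requirement at the start of the block determines the rate; `c`
  -- increases, so the requirement persists throughout the block. The level δ affects this rate but
  -- not the bonus.
  set lam : ℕ → ℝ := fun j => 9 / 8 * (L j / c (2 ^ j)) with hlam
  have hcpos : ∀ k, 1 ≤ k → 0 < c k := by
    intro k hk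
    have h1 := three_le_ell (H := M.H) (S := s) (A := a) hk hH hS1 hA1
    have hk0 : (0 : ℝ) < k := by exact_mod_cast hk
    rw [hc, paramEll]
    have : 0 < Real.sqrt (k * ell M.H s a k 1 / (s * a * Real.log (K * M.H))) :=
      Real.sqrt_pos.2 (div_pos (mul_pos hk0 (by linarith)) hD0)
    positivity
  have hL0 : ∀ j, 0 < L j := by
    intro j
    refine Real.log_pos ?_
    rw [lt_div_iff₀ hδ]
    have h1 : (0 : ℝ) ≤ j := Nat.cast_nonneg j
    have h2 : (1 : ℝ) ≤ (j + 1) * (j + 2) := by nlinarith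
    nlinarith
  have hlam0 : ∀ j, 0 < lam j := fun j => by
    have := hL0 j
    have := hcpos (2 ^ j) Nat.one_le_two_pow
    simp only [hlam]; positivity
  have hpow : ∀ k, 1 ≤ k → 2 ^ Nat.log 2 k ≤ k := fun k hk => Nat.pow_log_le_self 2 (by omega)
  have hcmono : ∀ k k', 1 ≤ k → k ≤ k' → c k ≤ c k' := fun k k' hk hkk =>
    paramEll_mono hc₁.le hV.le hk hkk hH hS1 hA1
  have key := hX.measure_regret_gt_le_ofReal hE hV hK hKH hA hδ hδ1
    (J := Finset.range (Nat.log 2 K + 1)) (φ := Nat.log 2) (lam := lam) (L := L) (cmax := c K)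
    (fun k _ hkK => Finset.mem_range.2 (Nat.lt_succ_of_le (Nat.log_mono_right hkK)))
    (fun j _ => hlam0 j) (fun j _ => (hL0 j).le)
    (fun k hk _ => by
      have h1 := (hL0 (Nat.log 2 k)).ne'
      have h2 := (hcpos (2 ^ Nat.log 2 k) Nat.one_le_two_pow).ne'
      have e : 9 / 8 * (L (Nat.log 2 k) / lam (Nat.log 2 k)) = c (2 ^ Nat.log 2 k) := by
        simp only [hlam]; field_simp
      rw [e]
      exact hcmono _ _ Nat.one_le_two_pow (hpow k hk))
    (fun k hk hkK => hcmono _ _ hk hkK)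
    (by
      have e : ∀ j ∈ Finset.range (Nat.log 2 K + 1), Real.exp (-L j)
          = δ / (6 * (M.H * s * a)) * (1 / (((j : ℝ) + 1) * (j + 2))) := by
        intro j _
        simp only [hL]
        rw [Real.exp_neg, Real.exp_log (by positivity)]
        field_simp
      rw [Finset.sum_congr rfl e, ← Finset.mul_sum]
      have h1 := sum_inv_mul_succ_le (Nat.log 2 K + 1)
      have h2 : (0 : ℝ) ≤ 1 / (((Nat.log 2 K + 1 : ℕ) : ℝ) + 1) := by positivity
      have e2 : ∀ x : ℝ, 3 * ((M.H : ℝ) * s * a) * (δ / (6 * (M.H * s * a)) * x) = δ / 2 * x := by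
        intro x; field_simp; ring
      rw [e2]
      nlinarith)
  refine le_trans (measure_mono fun ω hω => ?_) key
  rw [Set.mem_ofPred_eq] at hω ⊢
  refine lt_of_le_of_lt ?_ hω
  set lK := ell M.H s a K 1 with hlK
  have hlK3 : 3 ≤ lK := three_le_ell hK hH hS1 hA1
  have hterm : ∀ k ∈ Finset.Icc 1 K, 10 * V ^ 2 * lam (Nat.log 2 k) ≤
      16 * (V / c₁) * (1 + t / g) * Real.sqrt (D * lK) * (1 / Real.sqrt k) := by
    intro k hk
    rw [Finset.mem_Icc] at hk
    set κ := 2 ^ Nat.log 2 k with hκ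
    have hκ1 : 1 ≤ κ := Nat.one_le_two_pow
    have hκk : κ ≤ k := hpow k hk.1
    have hkκ : k < 2 * κ := by
      have := Nat.lt_pow_succ_log_self (b := 2) (by norm_num) k
      rw [pow_succ] at this; omega
    have h3 := three_le_ell (H := M.H) (S := s) (A := a) hκ1 hH hS1 hA1
    have hgl := log_le_ell (H := M.H) (S := s) (A := a) hκ1 hH hS1 hA1
    refine rate_term_le (l := ell M.H s a κ 1) (κ := κ) (D := D) hV hc₁ hD0 (by linarith)
      (ell_one_mono hκ1 (hκk.trans hk.2) hH hS1 hA1) (by exact_mod_cast hκ1)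
      (by exact_mod_cast hk.1) (by exact_mod_cast hkκ.le) (by positivity) ?_
    have h5 : L (Nat.log 2 k) ≤ ell M.H s a κ δ := block_log_le_ell hH hS1 hA1 hδ
    rw [ell_eq_add hκ1 hH hS1 hA1 hδ] at h5
    -- Comparing `ell` with log HSA produces the quotient log(1/δ)/log HSA in the main term.
    have h6 : t ≤ ell M.H s a κ 1 * (t / g) := by
      calc t = g * (t / g) := by field_simp
        _ ≤ _ := mul_le_mul_of_nonneg_right hgl (by positivity)
    linarith
  have hsum : ∑ k ∈ Finset.Icc 1 K, 10 * V ^ 2 * lam (Nat.log 2 k) ≤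
      16 * (V / c₁) * (1 + t / g) * Real.sqrt (D * lK) * (2 * Real.sqrt K) := by
    refine (Finset.sum_le_sum hterm).trans ?_
    rw [← Finset.mul_sum]
    exact mul_le_mul_of_nonneg_left (sum_inv_sqrt_le K) (by positivity)
  have hR : Real.sqrt (K * s * a * lK * Real.log (K * M.H)) = Real.sqrt (D * lK) * Real.sqrt K := by
    rw [← Real.sqrt_mul (by positivity)]; congr 1; rw [hD]; ring
  have hcK : c K * D = c₁ * V * (Real.sqrt (D * lK) * Real.sqrt K) := by
    rw [hc, paramEll, mul_assoc]
    congr 1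
    rw [sqrt_div_mul_self (by positivity) hD0, ← Real.sqrt_mul (by positivity)]
    congr 1; ring
  have hc48 : 48 / 7 * c K * D = 48 / 7 * (c₁ * V * (Real.sqrt (D * lK) * Real.sqrt K)) := by
    rw [mul_assoc, hcK]
  rw [ellBound, ← hlK, hR, ← hg, ← ht, hc48]
  set R := Real.sqrt (D * lK) * Real.sqrt K with hRdef
  have hR0 : 0 ≤ R := by positivity
  -- The proof yields 32 and 48/7, rounded up to 36 and 8.
  have e1 : (36 * t / (c₁ * g) + 36 / c₁ + 8 * c₁) * V * R
      = 36 * (V / c₁ * (1 + t / g) * R) + 8 * (c₁ * V * R) := by field_simp; ring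
  have e2 : 16 * (V / c₁) * (1 + t / g) * Real.sqrt (D * lK) * (2 * Real.sqrt K)
      = 32 * (V / c₁ * (1 + t / g) * R) := by rw [hRdef]; ring
  have p1 : 0 ≤ V / c₁ * (1 + t / g) * R := by positivity
  have p2 : 0 ≤ c₁ * V * R := by positivity
  rw [e1]
  rw [e2] at hsum
  linarith

/-- The regret bound for the constant parameters `paramKnown`. -/
theorem InClass.measure_known_lt_regret_le [Nonempty S] (hX : X.InClass M μ V) {K : ℕ}
    (hE : X.FollowsEQO M.H V (fun _ => paramKnown c₁ V M.H (Fintype.card S) (Fintype.card A) K)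
      (fun _ => ⊤))
    (hc₁ : 0 < c₁) (hV : 0 < V) (hK : 1 ≤ K) (hKH : 2 ≤ K * M.H) (hA : 2 ≤ Fintype.card A)
    {δ : ℝ} (hδ : 0 < δ) (hδ1 : δ ≤ 1) :
    μ {ω | (64 / c₁ + 8 * c₁ + 32 / c₁ * Real.log (1 / δ)) * V
        * Real.sqrt (Fintype.card S * Fintype.card A * K * Real.log (K * M.H)
          * Real.log (M.H * Fintype.card S * Fintype.card A))
      + 72 * V * (Fintype.card S : ℝ) ^ 2 * Fintype.card A
        * ell M.H (Fintype.card S) (Fintype.card A) K δ * Real.log (2 * K * M.H)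
      < X.regret M K ω} ≤ ENNReal.ofReal δ := by
  have hH := M.H_pos
  have hS1 : 1 ≤ Fintype.card S := Fintype.card_pos
  set s := Fintype.card S with hs
  set a := Fintype.card A with ha
  have hs1 : (1 : ℝ) ≤ s := by exact_mod_cast hS1
  have ha2 : (2 : ℝ) ≤ a := by exact_mod_cast hA
  have hH1 : (1 : ℝ) ≤ M.H := by exact_mod_cast hH
  have hK0 : (0 : ℝ) < K := by exact_mod_cast hK
  have hKHr : (2 : ℝ) ≤ K * M.H := by exact_mod_cast hKH
  have hlogKH : 0 < Real.log (K * M.H) := Real.log_pos (by linarith)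
  set D : ℝ := s * a * Real.log (K * M.H) with hD
  have hD0 : 0 < D := by positivity
  have hHSA : (2 : ℝ) ≤ M.H * s * a := by nlinarith [one_le_mul_of_one_le_of_one_le hH1 hs1]
  set g := Real.log (M.H * s * a) with hg
  have hg2 : Real.log 2 ≤ g := Real.log_le_log (by norm_num) hHSA
  have hlog2 := Real.log_two_gt_d9
  have hg0 : 0 < g := by linarith
  set t := Real.log (1 / δ) with ht
  have ht0 : 0 ≤ t := Real.log_nonneg (by rw [le_div_iff₀ hδ]; linarith)
  set c := paramKnown c₁ V M.H s a K with hc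
  have hc0 : 0 < c := by
    have : 0 < Real.sqrt (K * g / D) := Real.sqrt_pos.2 (by positivity)
    rw [hc, paramKnown]; positivity
  -- The bonus does not depend on the episode, so one rate suffices and no iterated logarithm enters
  -- the main term.
  set L := Real.log (6 * (M.H * s * a) / δ) with hL
  have hLeq : L = Real.log 6 + g + t := by
    rw [hL, mul_div_assoc, Real.log_mul (by norm_num) (by positivity), div_eq_mul_one_div,
      Real.log_mul (by positivity) (by positivity), ← hg, ← ht]
    ring
  have hlog6 : Real.log 6 ≤ 3 * Real.log 2 := by
    have : Real.log ((2 : ℝ) ^ 3) = 3 * Real.log 2 := by rw [Real.log_pow]; norm_num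
    rw [← this]
    exact Real.log_le_log (by norm_num) (by norm_num)
  have hlog60 : 0 ≤ Real.log 6 := Real.log_nonneg (by norm_num)
  have hL0 : 0 < L := by rw [hLeq]; linarith
  set lam := 9 / 8 * (L / c) with hlam
  have hlam0 : 0 < lam := by positivity
  have key := hX.measure_regret_gt_le_ofReal hE hV hK hKH hA hδ hδ1
    (J := {0}) (φ := fun _ => 0) (lam := fun _ => lam) (L := fun _ => L) (cmax := c)
    (fun k _ _ => Finset.mem_singleton_self 0) (fun _ _ => hlam0) (fun _ _ => hL0.le)
    (fun k hk _ => le_of_eq (by rw [hlam]; field_simp)) (fun k hk hkK => le_rfl)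
    (by
      rw [Finset.sum_singleton, hL, Real.exp_neg, Real.exp_log (by positivity)]
      change 3 * ((M.H : ℝ) * s * a) * _ ≤ _
      refine le_of_eq ?_
      field_simp; ring)
  refine le_trans (measure_mono fun ω hω => ?_) key
  rw [Set.mem_ofPred_eq] at hω ⊢
  refine lt_of_le_of_lt ?_ hω
  have hterm : 10 * V ^ 2 * lam ≤
      16 * (V / c₁) * (4 + 2 * t) * Real.sqrt (D * g) * (1 / Real.sqrt K) := by
    -- Here L = log 6 + g + t, and log 6 ≤ 3g, t ≤ 2gt (because g ≥ log 2 ≥ 1/2) give θ = 4 + 2t.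
    refine rate_term_le (l := g) (κ := K) (D := D) hV hc₁ hD0 hg0 le_rfl hK0 hK0 (by linarith)
      (by positivity) ?_
    rw [hLeq]
    nlinarith
  have hsq : (K : ℝ) * (1 / Real.sqrt K) = Real.sqrt K := by
    rw [mul_one_div, Real.div_sqrt]
  set R := Real.sqrt (D * g) * Real.sqrt K with hR
  have hR0 : 0 ≤ R := by positivity
  have hsum : ∑ k ∈ Finset.Icc 1 K, 10 * V ^ 2 * lam ≤ 16 * (V / c₁) * (4 + 2 * t) * R := by
    rw [Finset.sum_const, Nat.card_Icc, Nat.add_sub_cancel, nsmul_eq_mul]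
    calc (K : ℝ) * (10 * V ^ 2 * lam)
        ≤ K * (16 * (V / c₁) * (4 + 2 * t) * Real.sqrt (D * g) * (1 / Real.sqrt K)) := by gcongr
      _ = 16 * (V / c₁) * (4 + 2 * t) * (Real.sqrt (D * g) * (K * (1 / Real.sqrt K))) := by ring
      _ = _ := by rw [hsq]
  have hRe : Real.sqrt (s * a * K * Real.log (K * M.H) * g) = R := by
    rw [hR, ← Real.sqrt_mul (by positivity)]; congr 1; rw [hD]; ring
  have hcK : c * D = c₁ * V * R := by
    rw [hc, paramKnown, mul_assoc, hR]
    congr 1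
    rw [sqrt_div_mul_self (by positivity) hD0, ← Real.sqrt_mul (by positivity)]
    congr 1; ring
  have hc48 : 48 / 7 * c * D = 48 / 7 * (c₁ * V * R) := by rw [mul_assoc, hcK]
  rw [hRe, hc48]
  have e1 : (64 / c₁ + 8 * c₁ + 32 / c₁ * t) * V * R
      = 16 * (V / c₁) * (4 + 2 * t) * R + 8 * (c₁ * V * R) := by field_simp; ring
  have p2 : 0 ≤ c₁ * V * R := by positivity
  rw [e1]
  linarith

end Run
end EQOPlus
end

/-! ### Degenerate cases and expected regret. -/

noncomputable section
namespace EQOPlus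

theorem log_two_mul_le {x : ℝ} (hx : 2 ≤ x) : Real.log (2 * x) ≤ 2 * Real.log x := by
  rw [Real.log_mul (by norm_num) (by linarith)]
  linarith [Real.log_le_log (by norm_num) hx]

theorem one_le_log_of_three_le {K : ℕ} (hK : 3 ≤ K) : 1 ≤ Real.log K := by
  have hKr : (3 : ℝ) ≤ K := by exact_mod_cast hK
  rw [Real.le_log_iff_exp_le (by linarith)]
  linarith [Real.exp_one_lt_d9]

theorem two_le_natCast_mul {H S A : ℕ} (hH : 1 ≤ H) (hS : 1 ≤ S) (hA : 2 ≤ A) :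
    (2 : ℝ) ≤ H * S * A := by
  have : 2 ≤ H * S * A := le_trans hA (Nat.le_mul_of_pos_left A (Nat.mul_pos hH hS))
  exact_mod_cast this

/-- Bounds the terms of lower order in the expected regret. -/
theorem lower_order_expectation_le {V W W2 l Λ : ℝ} {S A : ℕ} (hV : 0 ≤ V) (hW : 0 ≤ W)
    (hW2 : W2 ≤ 2 * W) (hl0 : 0 ≤ l) (hl : l ≤ 12 * Λ) (hΛ : 1 / 2 ≤ Λ) :
    72 * V * (S : ℝ) ^ 2 * A * l * W2 + 72 * V * (S : ℝ) ^ 2 * A * W2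
      ≤ 2016 * (V * (S : ℝ) ^ 2 * A * W * Λ) := by
  have h1 : (l + 1) * W2 ≤ 28 * (W * Λ) :=
    calc (l + 1) * W2 ≤ (l + 1) * (2 * W) := by gcongr
      -- As Λ ≥ 1/2, 12Λ + 1 ≤ 14Λ; then 72 · 28 = 2016.
      _ ≤ (14 * Λ) * (2 * W) := by gcongr; linarith
      _ = 28 * (W * Λ) := by ring
  calc 72 * V * (S : ℝ) ^ 2 * A * l * W2 + 72 * V * (S : ℝ) ^ 2 * A * W2
      = 72 * (V * (S : ℝ) ^ 2 * A) * ((l + 1) * W2) := by ring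
    _ ≤ 72 * (V * (S : ℝ) ^ 2 * A) * (28 * (W * Λ)) := by gcongr
    _ = _ := by ring

theorem sqrt_ell_le {x l Λ y z : ℝ} (hx : 0 ≤ x) (hl : l ≤ 12 * Λ) (hΛ : 0 ≤ Λ) (hy : y = x * l)
    (hz : z = x * Λ) : Real.sqrt y ≤ 4 * Real.sqrt z := by
  have h : (4 : ℝ) * Real.sqrt z = Real.sqrt (16 * z) := by
    rw [Real.sqrt_mul (by norm_num), show (16 : ℝ) = 4 ^ 2 by norm_num, Real.sqrt_sq (by norm_num)]
  rw [h, hy, hz]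
  refine Real.sqrt_le_sqrt ?_
  have : 0 ≤ x * Λ := by positivity
  nlinarith

theorem lower_order_le_ellBound {V c₁ δ : ℝ} (hV : 0 ≤ V) (hc₁ : 0 < c₁) (H S A K : ℕ)
    (hδ : 0 < δ) (hδ1 : δ ≤ 1) :
    72 * V * (S : ℝ) ^ 2 * A * ell H S A K δ * Real.log (2 * K * H)
      ≤ ellBound c₁ V H S A K δ := by
  have h1 : 0 ≤ Real.log (1 / δ) := Real.log_nonneg (by rw [le_div_iff₀ hδ]; linarith)
  have h2 : 0 ≤ Real.log (H * S * A) := by exact_mod_cast Real.log_natCast_nonneg (H * S * A)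
  rw [ellBound]
  have : 0 ≤ (36 * Real.log (1 / δ) / (c₁ * Real.log (H * S * A)) + 36 / c₁ + 8 * c₁) * V
      * Real.sqrt (K * S * A * ell H S A K 1 * Real.log (K * H)) := by positivity
  linarith

namespace Run

variable {S A Ω : Type*} [Fintype S] [DecidableEq S] [MeasurableSpace S] [DiscreteMeasurableSpace S]
  [Fintype A] [DecidableEq A] [MeasurableSpace A] [DiscreteMeasurableSpace A]
  {mΩ : MeasurableSpace Ω} {μ : Measure Ω} [IsProbabilityMeasure μ] {X : Run S A Ω} {M : MDP S A}
  {V c₁ : ℝ}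

omit [DiscreteMeasurableSpace S] [DecidableEq A] [DiscreteMeasurableSpace A]
  [IsProbabilityMeasure μ] in
/-- Without a choice between actions, or with `V = 0`, there is no regret. -/
theorem InClass.regret_eq_zero_of_trivial [Nonempty A] (hX : X.InClass M μ V)
    (h : V = 0 ∨ Fintype.card A ≤ 1) (K : ℕ) (ω : Ω) : X.regret M K ω = 0 := by
  rcases h with h | h
  · have := Run.regret_mem (X := X) hX.bounded hX.Vmax_nonneg K ω
    rw [h, mul_zero] at this
    exact le_antisymm this.2 this.1
  · exact Run.regret_eq_zero_of_card_le_one h K ω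

/-- The lower-order term alone settles the degenerate cases: the regret is 0 with one action or V =
0, and at most `V` for K = H = 1, where log KH = 0 makes the parameter formula meaningless. -/
theorem InClass.measure_ellBound_lt_regret_le_of_pos (hX : X.InClass M μ V) {K : ℕ}
    (hE : X.FollowsEQO M.H V (paramEll c₁ V M.H (Fintype.card S) (Fintype.card A) K) (fun _ => ⊤))
    (hc₁ : 0 < c₁) (hK : 1 ≤ K) {δ : ℝ} (hδ : 0 < δ) (hδ1 : δ ≤ 1) :
    μ {ω | ellBound c₁ V M.H (Fintype.card S) (Fintype.card A) K δ < X.regret M K ω}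
      ≤ ENNReal.ofReal δ := by
  -- A probability space has a point, and the run evaluated there inhabits `S` and `A`.
  obtain ⟨ω₀⟩ := μ.nonempty_of_neZero
  have : Nonempty S := ⟨X.state 0 0 ω₀⟩
  have : Nonempty A := ⟨X.action 0 0 ω₀⟩
  have hV := hX.Vmax_nonneg
  have hH := M.H_pos
  have hS1 : 1 ≤ Fintype.card S := Fintype.card_pos
  have hA1 : 1 ≤ Fintype.card A := Fintype.card_pos
  have hb := lower_order_le_ellBound hV hc₁ M.H (Fintype.card S) (Fintype.card A) K hδ hδ1
  have hl5 : 3 ≤ ell M.H (Fintype.card S) (Fintype.card A) K δ := by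
    rw [ell_eq_add hK hH hS1 hA1 hδ]
    have h1 : 0 ≤ Real.log (1 / δ) := Real.log_nonneg (by rw [le_div_iff₀ hδ]; linarith)
    linarith [three_le_ell hK hH hS1 hA1]
  have h2 : 0 ≤ Real.log (2 * K * M.H) := by exact_mod_cast Real.log_natCast_nonneg (2 * K * M.H)
  by_cases h0 : V = 0 ∨ Fintype.card A ≤ 1
  · have : {ω | ellBound c₁ V M.H (Fintype.card S) (Fintype.card A) K δ < X.regret M K ω} = ∅ := by
      ext ω
      simp only [Set.mem_ofPred_eq, Set.mem_empty_iff_false, iff_false, not_lt]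
      rw [hX.regret_eq_zero_of_trivial h0 K ω]
      exact le_trans (by positivity) hb
    rw [this, measure_empty]; exact zero_le
  · push Not at h0
    have hV0 : 0 < V := lt_of_le_of_ne hV (Ne.symm h0.1)
    by_cases hKH : 2 ≤ K * M.H
    · exact hX.measure_ellBound_lt_regret_le hE hc₁ hV0 hK hKH h0.2 hδ hδ1
    · have hKH1 : K = 1 ∧ M.H = 1 := by
        have : K * M.H = 1 := le_antisymm (by omega) (Nat.mul_pos hK hH)
        exact mul_eq_one.1 this
      have : {ω | ellBound c₁ V M.H (Fintype.card S) (Fintype.card A) K δ < X.regret M K ω} = ∅ := by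
        ext ω
        simp only [Set.mem_ofPred_eq, Set.mem_empty_iff_false, iff_false, not_lt]
        refine le_trans ?_ hb
        have h3 := (Run.regret_mem (X := X) hX.bounded hV K ω).2
        have h4 : Real.log (2 * K * M.H) = Real.log 2 := by
          rw [hKH1.1, hKH1.2]; norm_num
        have h5 := Real.log_two_gt_d9
        rw [h4]
        have h6 : (1 : ℝ) ≤ (Fintype.card S : ℝ) ^ 2 * Fintype.card A := by
          exact_mod_cast Nat.mul_pos (pow_pos hS1 2) hA1
        rw [hKH1.1, Nat.cast_one, one_mul] at h3
        have h7 : 1 ≤ ell M.H (Fintype.card S) (Fintype.card A) K δ * Real.log 2 := by nlinarith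
        have h8 := one_le_mul_of_one_le_of_one_le h6 h7
        rw [← hKH1.1] at h3
        calc X.regret M K ω ≤ V := h3
          _ ≤ 72 * V * ((Fintype.card S : ℝ) ^ 2 * Fintype.card A
              * (ell M.H (Fintype.card S) (Fintype.card A) K δ * Real.log 2)) := by nlinarith
          _ = _ := by ring
      rw [this, measure_empty]; exact zero_le

theorem InClass.distRegret_le (hX : X.InClass M μ V) {K : ℕ}
    (hE : X.FollowsEQO M.H V (paramEll c₁ V M.H (Fintype.card S) (Fintype.card A) K) (fun _ => ⊤))
    (hc₁ : 0 < c₁) (hK : 1 ≤ K) {δ : ℝ} (hδ : 0 < δ) (hδ1 : δ ≤ 1) :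
    X.distRegret M μ K δ
      ≤ (ellBound c₁ V M.H (Fintype.card S) (Fintype.card A) K δ : EReal) :=
  sInf_le ⟨_, hX.measure_ellBound_lt_regret_le_of_pos hE hc₁ hK hδ hδ1, rfl⟩

theorem InClass.integral_regret_le_of_paramEll (hX : X.InClass M μ V) {K : ℕ}
    (hE : X.FollowsEQO M.H V (paramEll c₁ V M.H (Fintype.card S) (Fintype.card A) K) (fun _ => ⊤))
    (hc₁ : 0 < c₁) (hK : 3 ≤ K) :
    Integrable (X.regret M K) μ ∧
      ∫ ω, X.regret M K ω ∂μ ≤ (432 / c₁ + 32 * c₁ + 2016) *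
        (V * Real.sqrt (Fintype.card S * Fintype.card A * K * Real.log (K * M.H)
            * Real.log (M.H * Fintype.card S * Fintype.card A * Real.log K))
          + V * (Fintype.card S : ℝ) ^ 2 * Fintype.card A * Real.log (K * M.H)
            * Real.log (M.H * Fintype.card S * Fintype.card A * Real.log K)) := by
  obtain ⟨ω₀⟩ := μ.nonempty_of_neZero
  have : Nonempty S := ⟨X.state 0 0 ω₀⟩
  have : Nonempty A := ⟨X.action 0 0 ω₀⟩
  have hV := hX.Vmax_nonneg
  have h_int := hE.integrable_regret hX.env hX.bounded hV K
  refine ⟨h_int, ?_⟩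
  have hH := M.H_pos
  have hS1 : 1 ≤ Fintype.card S := Fintype.card_pos
  have hA1 : 1 ≤ Fintype.card A := Fintype.card_pos
  have hW := Real.log_natCast_nonneg (K * M.H)
  push_cast at hW
  have hlK := one_le_log_of_three_le hK
  have hΛ0 : 0 ≤ Real.log (M.H * Fintype.card S * Fintype.card A * Real.log K) := by
    refine Real.log_nonneg (one_le_mul_of_one_le_of_one_le ?_ hlK)
    exact_mod_cast Nat.mul_pos (Nat.mul_pos hH hS1) hA1
  by_cases h0 : V = 0 ∨ Fintype.card A ≤ 1
  · rw [integral_congr_ae (ae_of_all _ (hX.regret_eq_zero_of_trivial h0 K)), integral_zero]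
    positivity
  push Not at h0
  have hV0 : 0 < V := lt_of_le_of_ne hV (Ne.symm h0.1)
  have hA : 2 ≤ Fintype.card A := h0.2
  have hKH : 2 ≤ K * M.H := le_trans (by omega) (Nat.le_mul_of_pos_right K hH)
  obtain ⟨hl, hΛ⟩ := ell_le_mul_log hH hS1 hA hK
  have htail := fun δ hδ hδ1 => hX.measure_ellBound_lt_regret_le_of_pos hE hc₁ (by omega) (δ := δ) hδ hδ1
  have hHSA := two_le_natCast_mul hH hS1 hA
  have hl3 := three_le_ell (k := K) (by omega) hH hS1 hA1
  have hell := fun δ (hδ : 0 < δ) => ell_eq_add (k := K) (by omega) hH hS1 hA1 hδ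
  have hKHr : (2 : ℝ) ≤ K * M.H := by exact_mod_cast hKH
  have hW2 := log_two_mul_le hKHr
  rw [← mul_assoc] at hW2
  have hW20 : 0 < Real.log (2 * K * M.H) := Real.log_pos (by linarith)
  have hs : (0 : ℝ) < Fintype.card S := by exact_mod_cast hS1
  have ha : (0 : ℝ) < Fintype.card A := by exact_mod_cast hA1
  set s := (Fintype.card S : ℝ) with hs_eq
  set a := (Fintype.card A : ℝ) with ha_eq
  set W := Real.log (K * M.H)
  set W2 := Real.log (2 * K * M.H) with hW2def
  set l := ell M.H (Fintype.card S) (Fintype.card A) K 1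
  set Λ := Real.log (M.H * s * a * Real.log K)
  set g := Real.log (M.H * s * a) with hgdef
  have hg : 1 / 2 ≤ g := by
    have := Real.log_le_log (by norm_num) hHSA
    linarith [Real.log_two_gt_d9]
  have hg0 : 0 < g := by linarith
  set R := Real.sqrt (K * s * a * l * W) with hR
  have hR4 : R ≤ 4 * Real.sqrt (s * a * K * W * Λ) :=
    sqrt_ell_le (x := s * a * K * W) (by positivity) hl hΛ0 (by ring) rfl
  have hR0 : 0 ≤ R := Real.sqrt_nonneg _
  -- By `ell_eq_add`, the bound is affine in log(1/δ); `b` collects the slope. For the constants, g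
  -- ≥ 1/2 gives 36/(c₁g) ≤ 72/c₁, and √12 ≤ 4 gives (36 + 72)·4 = 432 and 8·4 = 32.
  have key := integral_le_of_exp_tail (a := (36 / c₁ + 8 * c₁) * V * R + 72 * V * s ^ 2 * a * l * W2)
    (b := 36 / (c₁ * g) * V * R + 72 * V * s ^ 2 * a * W2) h_int (by positivity) (fun δ hδ hδ1 => by
      have e : ellBound c₁ V M.H (Fintype.card S) (Fintype.card A) K δ
          = (36 / c₁ + 8 * c₁) * V * R + 72 * V * s ^ 2 * a * l * W2
            + (36 / (c₁ * g) * V * R + 72 * V * s ^ 2 * a * W2) * Real.log (1 / δ) := by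
        rw [ellBound, hell δ hδ, ← hs_eq, ← ha_eq, ← hR, ← hW2def, ← hgdef]
        ring
      rw [← e]
      exact htail δ hδ hδ1)
  refine key.trans ?_
  have h1 := lower_order_expectation_le (S := Fintype.card S) (A := Fintype.card A) hV hW hW2
    (by linarith) hl hΛ
  have h2 : 36 / (c₁ * g) ≤ 72 / c₁ := by
    rw [div_le_div_iff₀ (by positivity) hc₁]; nlinarith
  have h3 : (36 / c₁ + 8 * c₁) * V * R + 36 / (c₁ * g) * V * R
      ≤ (432 / c₁ + 32 * c₁) * (V * Real.sqrt (s * a * K * W * Λ)) :=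
    calc (36 / c₁ + 8 * c₁) * V * R + 36 / (c₁ * g) * V * R
        = (36 / c₁ + 8 * c₁ + 36 / (c₁ * g)) * V * R := by ring
      _ ≤ (36 / c₁ + 8 * c₁ + 72 / c₁) * V * (4 * Real.sqrt (s * a * K * W * Λ)) := by gcongr
      _ = _ := by ring
  have p1 : 0 ≤ V * Real.sqrt (s * a * K * W * Λ) := by positivity
  have p2 : 0 ≤ (432 / c₁ + 32 * c₁) * (V * s ^ 2 * a * W * Λ) := by positivity
  linarith

theorem InClass.integral_regret_le_of_paramKnown (hX : X.InClass M μ V) {K : ℕ}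
    (hE : X.FollowsEQO M.H V (fun _ => paramKnown c₁ V M.H (Fintype.card S) (Fintype.card A) K)
      (fun _ => ⊤))
    (hc₁ : 0 < c₁) (hK : 3 ≤ K) :
    Integrable (X.regret M K) μ ∧
      ∫ ω, X.regret M K ω ∂μ ≤ (96 / c₁ + 8 * c₁ + 2016) *
        (V * Real.sqrt (Fintype.card S * Fintype.card A * K * Real.log (K * M.H)
            * Real.log (M.H * Fintype.card S * Fintype.card A))
          + V * (Fintype.card S : ℝ) ^ 2 * Fintype.card A * Real.log (K * M.H)
            * Real.log (M.H * Fintype.card S * Fintype.card A * Real.log K)) := by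
  obtain ⟨ω₀⟩ := μ.nonempty_of_neZero
  have : Nonempty S := ⟨X.state 0 0 ω₀⟩
  have : Nonempty A := ⟨X.action 0 0 ω₀⟩
  have hV := hX.Vmax_nonneg
  have h_int := hE.integrable_regret hX.env hX.bounded hV K
  refine ⟨h_int, ?_⟩
  have hH := M.H_pos
  have hS1 : 1 ≤ Fintype.card S := Fintype.card_pos
  have hA1 : 1 ≤ Fintype.card A := Fintype.card_pos
  have hW := Real.log_natCast_nonneg (K * M.H)
  push_cast at hW
  have hlK := one_le_log_of_three_le hK
  have hΛ0 : 0 ≤ Real.log (M.H * Fintype.card S * Fintype.card A * Real.log K) := by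
    refine Real.log_nonneg (one_le_mul_of_one_le_of_one_le ?_ hlK)
    exact_mod_cast Nat.mul_pos (Nat.mul_pos hH hS1) hA1
  by_cases h0 : V = 0 ∨ Fintype.card A ≤ 1
  · rw [integral_congr_ae (ae_of_all _ (hX.regret_eq_zero_of_trivial h0 K)), integral_zero]
    positivity
  push Not at h0
  have hV0 : 0 < V := lt_of_le_of_ne hV (Ne.symm h0.1)
  have hA : 2 ≤ Fintype.card A := h0.2
  have hKH : 2 ≤ K * M.H := le_trans (by omega) (Nat.le_mul_of_pos_right K hH)
  obtain ⟨hl, hΛ⟩ := ell_le_mul_log hH hS1 hA hK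
  have htail := fun δ hδ hδ1 =>
    hX.measure_known_lt_regret_le hE hc₁ hV0 (by omega) hKH hA (δ := δ) hδ hδ1
  have hl3 := three_le_ell (k := K) (by omega) hH hS1 hA1
  have hell := fun δ (hδ : 0 < δ) => ell_eq_add (k := K) (by omega) hH hS1 hA1 hδ
  have hKHr : (2 : ℝ) ≤ K * M.H := by exact_mod_cast hKH
  have hW2 := log_two_mul_le hKHr
  rw [← mul_assoc] at hW2
  have hW20 : 0 < Real.log (2 * K * M.H) := Real.log_pos (by linarith)
  have hs : (0 : ℝ) < Fintype.card S := by exact_mod_cast hS1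
  have ha : (0 : ℝ) < Fintype.card A := by exact_mod_cast hA1
  set s := (Fintype.card S : ℝ)
  set a := (Fintype.card A : ℝ)
  set W := Real.log (K * M.H)
  set W2 := Real.log (2 * K * M.H)
  set l := ell M.H (Fintype.card S) (Fintype.card A) K 1
  set Λ := Real.log (M.H * s * a * Real.log K)
  set R := Real.sqrt (s * a * K * W * Real.log (M.H * s * a))
  have hR0 : 0 ≤ R := Real.sqrt_nonneg _
  have key := integral_le_of_exp_tail (a := (64 / c₁ + 8 * c₁) * V * R + 72 * V * s ^ 2 * a * l * W2)
    (b := 32 / c₁ * V * R + 72 * V * s ^ 2 * a * W2) h_int (by positivity) (fun δ hδ hδ1 => by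
      have e : (64 / c₁ + 8 * c₁ + 32 / c₁ * Real.log (1 / δ)) * V * R
            + 72 * V * s ^ 2 * a * ell M.H (Fintype.card S) (Fintype.card A) K δ * W2
          = (64 / c₁ + 8 * c₁) * V * R + 72 * V * s ^ 2 * a * l * W2
            + (32 / c₁ * V * R + 72 * V * s ^ 2 * a * W2) * Real.log (1 / δ) := by
        rw [hell δ hδ]
        ring
      rw [← e]
      exact htail δ hδ hδ1)
  refine key.trans ?_
  have h1 := lower_order_expectation_le (S := Fintype.card S) (A := Fintype.card A) hV hW hW2
    (by linarith) hl hΛ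
  have h3 : (64 / c₁ + 8 * c₁) * V * R + 32 / c₁ * V * R = (96 / c₁ + 8 * c₁) * (V * R) := by ring
  have p1 : 0 ≤ V * R := by positivity
  have p2 : 0 ≤ (96 / c₁ + 8 * c₁) * (V * s ^ 2 * a * W * Λ) := by positivity
  linarith

end Run
end EQOPlus
end

theorem corollary1 (c₁ : ℝ) (hc₁ : 0 < c₁) :
    -- distributional regret
    (∀ (S A Ω : Type*) [Fintype S] [Fintype A] [DecidableEq S] [DecidableEq A]
        [MeasurableSpace S] [DiscreteMeasurableSpace S]
        [MeasurableSpace A] [DiscreteMeasurableSpace A] [MeasurableSpace Ω]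
        (μ : MeasureTheory.Measure Ω) [MeasureTheory.IsProbabilityMeasure μ]
        (M : EQOPlus.MDP S A) (X : EQOPlus.Run S A Ω) (Vmax : ℝ) (K : ℕ) (δ : ℝ),
      X.InClass M μ Vmax → 1 ≤ K → 0 < δ → δ ≤ 1 →
      X.FollowsEQO M.H Vmax
        (EQOPlus.paramEll c₁ Vmax M.H (Fintype.card S) (Fintype.card A) K) (fun _ => ⊤) →
      X.distRegret M μ K δ ≤
        (((36 * Real.log (1 / δ) / (c₁ * Real.log (M.H * Fintype.card S * Fintype.card A))
              + 36 / c₁ + 8 * c₁) * Vmax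
            * Real.sqrt (K * Fintype.card S * Fintype.card A
                * EQOPlus.ell M.H (Fintype.card S) (Fintype.card A) K 1 * Real.log (K * M.H))
          + 72 * Vmax * (Fintype.card S : ℝ) ^ 2 * Fintype.card A
              * EQOPlus.ell M.H (Fintype.card S) (Fintype.card A) K δ
              * Real.log (2 * K * M.H) : ℝ) : EReal)) ∧
    -- expected regret
    (∃ C : ℝ, 0 < C ∧
      ∀ (S A Ω : Type*) [Fintype S] [Fintype A] [DecidableEq S] [DecidableEq A]
        [MeasurableSpace S] [DiscreteMeasurableSpace S]
        [MeasurableSpace A] [DiscreteMeasurableSpace A] [MeasurableSpace Ω]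
        (μ : MeasureTheory.Measure Ω) [MeasureTheory.IsProbabilityMeasure μ]
        (M : EQOPlus.MDP S A) (X : EQOPlus.Run S A Ω) (Vmax : ℝ) (K : ℕ),
      X.InClass M μ Vmax → 3 ≤ K →
      X.FollowsEQO M.H Vmax
        (EQOPlus.paramEll c₁ Vmax M.H (Fintype.card S) (Fintype.card A) K) (fun _ => ⊤) →
      MeasureTheory.Integrable (X.regret M K) μ ∧
      ∫ ω, X.regret M K ω ∂μ ≤
        C * (Vmax * Real.sqrt (Fintype.card S * Fintype.card A * K * Real.log (K * M.H)
                * Real.log (M.H * Fintype.card S * Fintype.card A * Real.log K))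
          + Vmax * (Fintype.card S : ℝ) ^ 2 * Fintype.card A * Real.log (K * M.H)
              * Real.log (M.H * Fintype.card S * Fintype.card A * Real.log K))) ∧
    -- expected regret when the number of episodes is known
    (∃ C : ℝ, 0 < C ∧
      ∀ (S A Ω : Type*) [Fintype S] [Fintype A] [DecidableEq S] [DecidableEq A]
        [MeasurableSpace S] [DiscreteMeasurableSpace S]
        [MeasurableSpace A] [DiscreteMeasurableSpace A] [MeasurableSpace Ω]
        (μ : MeasureTheory.Measure Ω) [MeasureTheory.IsProbabilityMeasure μ]
        (M : EQOPlus.MDP S A) (X : EQOPlus.Run S A Ω) (Vmax : ℝ) (K : ℕ),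
      X.InClass M μ Vmax → 3 ≤ K →
      X.FollowsEQO M.H Vmax
        (fun _ => EQOPlus.paramKnown c₁ Vmax M.H (Fintype.card S) (Fintype.card A) K)
        (fun _ => ⊤) →
      MeasureTheory.Integrable (X.regret M K) μ ∧
      ∫ ω, X.regret M K ω ∂μ ≤
        C * (Vmax * Real.sqrt (Fintype.card S * Fintype.card A * K * Real.log (K * M.H)
                * Real.log (M.H * Fintype.card S * Fintype.card A))
          + Vmax * (Fintype.card S : ℝ) ^ 2 * Fintype.card A * Real.log (K * M.H)
              * Real.log (M.H * Fintype.card S * Fintype.card A * Real.log K))) := by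
  refine ⟨fun S A Ω _ _ _ _ _ _ _ _ _ μ _ M X Vmax K δ hX hK hδ hδ1 hE =>
      hX.distRegret_le hE hc₁ hK hδ hδ1,
    ⟨432 / c₁ + 32 * c₁ + 2016, by positivity,
      fun S A Ω _ _ _ _ _ _ _ _ _ μ _ M X Vmax K hX hK hE =>
        hX.integral_regret_le_of_paramEll hE hc₁ hK⟩,
    ⟨96 / c₁ + 8 * c₁ + 2016, by positivity,
      fun S A Ω _ _ _ _ _ _ _ _ _ μ _ M X Vmax K hX hK hE =>
        hX.integral_regret_le_of_paramKnown hE hc₁ hK⟩⟩
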